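/- Let $Y=\,]-\tfrac12,\tfrac12[^3$ and let $\Sigma\subset Y$ be a connected compact set with Lipschitz boundary such that $\Sigma^*:=Y\setminus\Sigma$ is simply connected. Let $\varepsilon_r\in\mathbb{C}$ with $\operatorname{Im}\varepsilon_r>0$ and let $k_0>0$. Let $W^{1,2}_\sharp(Y)$ be the space of $Y$-periodic functions that are in $L^2_{loc}(\mathbb R^3)$ together with their first distributional derivatives, and let $e_1,e_2,e_3$ be the canonical basis. **The cell problem.** If $u\in W^{1,2}_\sharp(Y;\mathbb{C}^3)$ satisfies $\operatorname{curl}u=0$ in $\Sigma^*$, its circulation vector $\oint u\in\mathbb{C}^3$ is the vector $c$ for which $u=\nabla\psi+c$ in $\Sigma^*$ for some $\psi$ that is the restriction to $\Sigma^*$ of a function in $W^{1,2}_\sharp(Y)$. Put $$X_0^{\rm div}=\Big\{u\in W^{1,2}_\sharp(Y;\mathbb{C}^3):\ \operatorname{curl}u=0\text{ in }\Sigma^*,\ \operatorname{div}u=0\text{ in }Y,\ \oint u=0\Big\},\qquad b_0(u,v)=\int_\Sigma\operatorname{curl}u\cdot\overline{\operatorname{curl}v}.$$ The magnetic shape functions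 are $H^k=e_k+u^k$ $(k=1,2,3)$, where $u^k$ is the solution in $X_0^{\rm div}$ of $$b_0(u^k,v)-\varepsilon_rk_0^2\int_Y u^k\cdot\overline v=\varepsilon_rk_0^2\int_Y e_k\cdot\overline v\qquad\text{for all }v\in X_0^{\rm div},$$ and the effective permeability tensor is $\mu^{\rm eff}_{ij}=\int_Y H^i\cdot e_j$. **The spectral problem.** Let $Z_0$ be the space of $f\in L^2(Y;\mathbb{C}^3)$ with $\operatorname{div}f=0$ and $f=0$ in $\Sigma^*$. For $f\in Z_0$ let $\psi_f\in W^{1,2}_\sharp(Y;\mathbb{C}^3)$ be the solution of $-\Delta\psi_f=f$, $\int_Y\psi_f=0$, and put $$\Gamma f=\operatorname{curl}\psi_f+\frac12\int_\Sigma y\wedge f\,dy,\qquad a_0(f,g)=\int_Y\Gamma f\cdot\overline{\Gamma g}.$$ Let $\alpha_0\ge\alpha_1\ge\dots>0$ with $\alpha_n\to0$, and let $(f_n)_{n\in\mathbb N}$ be an orthonormal basis of $Z_0$ (for the $L^2$ scalar product) consisting of real valued fields such that $a_0(f_n,g)=\alpha_n\int_Y f_n\cdot\overline g$ for all $g\in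 Z_0$ and all $n$. Put $\lambda_n=1/\alpha_n$ and $u_n=\alpha_n^{-1/2}\,\Gamma f_n$. **Claim.** Then: 1. The $(\lambda_n,u_n)$ are the eigenpairs of the curl–curl problem on $X_0^{\rm div}$: the $u_n$ are real valued and belong to $X_0^{\rm div}$, $b_0(u_n,v)=\lambda_n\int_Y u_n\cdot\overline v$ for all $v\in X_0^{\rm div}$, $\int_Y u_n\cdot u_m=\delta_{nm}$, and the only $v\in X_0^{\rm div}$ with $b_0(v,u_n)=0$ for all $n$ is $v=0$. 2. For $k=1,2,3$ the problem defining $u^k$ has exactly one solution, and, with unconditional convergence in $W^{1,2}_\sharp(Y;\mathbb{C}^3)$, $$H^k=e_k+\sum_{n}\Big(\int_Y e_k\cdot\overline{u_n}\Big)\,\frac{\varepsilon_rk_0^2}{\lambda_n-\varepsilon_rk_0^2}\,u_n .$$ 3. For all $i,j\in\{1,2,3\}$, with absolutely convergent series, $$\mu^{\rm eff}_{ij}=\delta_{ij}+\sum_n\frac{\varepsilon_rk_0^2}{\lambda_n-\varepsilon_rk_0^2}\Big(\int_Y u_n\cdot e_i\Big)\Big(\int_Y u_n\cdot e_j\Big)=\delta_{ij}+\frac14\sum_n\frac{\varepsilon_rk_0^2}{1-\varepsilon_r\alpha_nk_0^2}\Big(\int_\Sigma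 y\wedge f_n\Big)_i\Big(\int_\Sigma y\wedge f_n\Big)_j .$$ -/

import Mathlib

open MeasureTheory Filter Topology
open scoped ContDiff

noncomputable section

namespace MagneticCell

/-- The physical space `ℝ³`. -/
abbrev E3 : Type := EuclideanSpace ℝ (Fin 3)

/-- The space `ℂ³` of values of the fields. -/
abbrev C3 : Type := EuclideanSpace ℂ (Fin 3)

/-- The open unit cell `Y = ]-1/2, 1/2[³`. -/
def cellY : Set E3 := {y | ∀ i, -(1 / 2 : ℝ) < y i ∧ y i < 1 / 2}

/-- Lebesgue measure on the unit cell. -/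
def muY : Measure E3 := volume.restrict cellY

theorem isBounded_cellY : Bornology.IsBounded cellY := by
  refine (Metric.isBounded_closedBall (x := (0 : E3)) (r := 3)).subset ?_
  intro y hy
  rw [Metric.mem_closedBall, dist_zero_right, EuclideanSpace.norm_eq]
  rw [Real.sqrt_le_left (by norm_num), Fin.sum_univ_three]
  have h : ∀ i, ‖y i‖ ^ 2 ≤ 1 := by
    intro i
    have h1 := (hy i).1
    have h2 := (hy i).2
    rw [Real.norm_eq_abs, sq_abs]
    nlinarith
  linarith [h 0, h 1, h 2]

instance : IsFiniteMeasure muY :=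
  ⟨by rw [muY, Measure.restrict_apply_univ]; exact isBounded_cellY.measure_lt_top⟩

/-- `L²(Y; F)`; by periodic extension it is identified with the space of `Y`-periodic functions
in `L²_loc(ℝ³; F)`. -/
abbrev L2 (F : Type) [NormedAddCommGroup F] : Type := Lp F 2 muY

/-- The vector of `ℂ³` with the same (real) coordinates as `y`. -/
def toC3 (y : E3) : C3 := WithLp.toLp 2 fun i => ((y i : ℝ) : ℂ)

/-- The `k`-th vector of the canonical basis of `ℂ³`. -/
def basisC (k : Fin 3) : C3 := EuclideanSpace.single k 1

/-- The (bilinear) cross product on `ℂ³`, as a linear map of the second variable. -/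
def crossL (a : C3) : C3 →L[ℂ] C3 :=
  LinearMap.toContinuousLinearMap
    ((WithLp.linearEquiv 2 ℂ (Fin 3 → ℂ)).symm.toLinearMap ∘ₗ crossProduct (WithLp.ofLp a) ∘ₗ
      (WithLp.linearEquiv 2 ℂ (Fin 3 → ℂ)).toLinearMap)

/-- The constant field equal to `c`, as an element of `L²(Y; ℂ³)`. -/
def constField (c : C3) : L2 C3 := Lp.const 2 muY c

/-! ### Geometry of the inclusion -/

/-- `S` has Lipschitz boundary: near each boundary point, and in suitable orthonormal coordinates,
`S` is the set of points lying below the graph of a Lipschitz function of two variables. -/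
def HasLipschitzBoundary (S : Set E3) : Prop :=
  ∀ x ∈ frontier S, ∃ U : Set E3, IsOpen U ∧ x ∈ U ∧
    ∃ e : E3 ≃ₗᵢ[ℝ] E3, ∃ γ : ℝ × ℝ → ℝ, (∃ K, LipschitzWith K γ) ∧
      ∀ y ∈ U, y ∈ S ↔ e y 2 ≤ γ (e y 0, e y 1)

/-- Standing assumption on the inclusion: it is a connected compact subset of the open cell with
Lipschitz boundary, and its complement in the cell is simply connected. -/
structure IsInclusion (S : Set E3) : Prop where
  subset_cell : S ⊆ cellY
  isCompact : IsCompact S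
  isConnected : IsConnected S
  lipschitz : HasLipschitzBoundary S
  compl_simplyConnected : IsSimplyConnected (cellY \ S)

/-! ### Periodic Sobolev space and differential operators -/

/-- `φ ∈ C^∞_♯(Y)`: smooth on `ℝ³` and `1`-periodic in each coordinate direction. -/
def IsPeriodicSmooth (φ : E3 → ℝ) : Prop :=
  ContDiff ℝ ∞ φ ∧ ∀ (i : Fin 3) (y : E3), φ (y + EuclideanSpace.single i 1) = φ y

/-- The classical partial derivative of a test function. -/
def pd (i : Fin 3) (φ : E3 → ℝ) (y : E3) : ℝ := fderiv ℝ φ y (EuclideanSpace.single i 1)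

section Sobolev

variable {F : Type} [NormedAddCommGroup F] [NormedSpace ℝ F]

/-- `g` is the `i`-th distributional derivative of (the periodic extension of) `u`. -/
def IsWeakPartial (i : Fin 3) (u g : L2 F) : Prop :=
  ∀ φ : E3 → ℝ, IsPeriodicSmooth φ →
    ∫ y, pd i φ y • u y ∂muY = -∫ y, φ y • g y ∂muY

/-- `u ∈ W^{1,2}_♯(Y; F)`. -/
def MemW12 (u : L2 F) : Prop := ∀ i, ∃ g, IsWeakPartial i u g

open Classical in
/-- The `i`-th weak partial derivative of `u` (with value `0` if there is none in `L²`). -/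
def wpd (i : Fin 3) (u : L2 F) : L2 F :=
  if h : ∃ g, IsWeakPartial i u g then h.choose else 0

end Sobolev

/-- The curl of `u ∈ W^{1,2}_♯(Y; ℂ³)`, that is `∑ᵢ eᵢ ∧ ∂ᵢ u`. -/
def curl (u : L2 C3) : L2 C3 := ∑ i, (crossL (basisC i)).compLp (wpd i u)

/-- The divergence of `u ∈ W^{1,2}_♯(Y; ℂ³)`. -/
def dvg (u : L2 C3) (y : E3) : ℂ := ∑ i, wpd i u y i

/-- The curl in coordinates. -/
theorem curl_ae (u : L2 C3) : ∀ᵐ y ∂muY,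
    curl u y 0 = wpd 1 u y 2 - wpd 2 u y 1 ∧
    curl u y 1 = wpd 2 u y 0 - wpd 0 u y 2 ∧
    curl u y 2 = wpd 0 u y 1 - wpd 1 u y 0 := by
  have h : ∀ i, ∀ᵐ y ∂muY, ((crossL (basisC i)).compLp (wpd i u) : E3 → C3) y
      = crossL (basisC i) (wpd i u y) :=
    fun i => ContinuousLinearMap.coeFn_compLp _ _
  have e1 := Lp.coeFn_add ((crossL (basisC 0)).compLp (wpd 0 u) +
    (crossL (basisC 1)).compLp (wpd 1 u)) ((crossL (basisC 2)).compLp (wpd 2 u))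
  have e2 := Lp.coeFn_add ((crossL (basisC 0)).compLp (wpd 0 u))
    ((crossL (basisC 1)).compLp (wpd 1 u))
  filter_upwards [h 0, h 1, h 2, e1, e2] with y h0 h1 h2 e1 e2
  have key : (curl u : E3 → C3) y = crossL (basisC 0) (wpd 0 u y) +
      crossL (basisC 1) (wpd 1 u y) + crossL (basisC 2) (wpd 2 u y) := by
    rw [curl, Fin.sum_univ_three, e1, Pi.add_apply, e2, Pi.add_apply, h0, h1, h2]
  rw [key]
  refine ⟨?_, ?_, ?_⟩ <;>
    · simp [crossL, basisC, crossProduct]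
      try ring

/-! ### Circulation vector and the space `X₀^div` -/

/-- `c` is the circulation vector `∮u` of the field `u` (curl-free outside `S`):
`u = ∇ψ + c` in `Y \ S` for some `ψ` in the space `W^{1,2}_♯(Y \ S)` of restrictions to `Y \ S` of
functions of `W^{1,2}_♯(Y)`. -/
def HasCirculation (S : Set E3) (u : L2 C3) (c : C3) : Prop :=
  ∃ ψ : L2 ℂ, MemW12 ψ ∧
    ∀ᵐ y ∂volume.restrict (cellY \ S), ∀ j, u y j = wpd j ψ y + c j

/-- `u ∈ X₀^div`: periodic `W^{1,2}` fields that are curl-free outside `S`, divergence-free in `Y`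
and have zero circulation vector. -/
structure MemX0div (S : Set E3) (u : L2 C3) : Prop where
  memW12 : MemW12 u
  curl_eq_zero : ∀ᵐ y ∂volume.restrict (cellY \ S), curl u y = 0
  div_eq_zero : ∀ᵐ y ∂muY, dvg u y = 0
  circulation_eq_zero : HasCirculation S u 0

/-- The Hermitian form `b₀(u, v) = ∫_S curl u · conj (curl v)`. The inner product of Mathlib is
conjugate-linear in its first argument. -/
def b0 (S : Set E3) (u v : L2 C3) : ℂ := ∫ y in S, inner ℂ (curl v y) (curl u y)

/-! ### Magnetic shape functions and effective permeability -/

/-- `u` solves the cell problem with datum `z`: `u ∈ X₀^div` and, for all `v ∈ X₀^div`,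
`b₀(u, v) - ε k₀² ∫_Y u · conj v = ε k₀² ∫_Y z · conj v`. -/
def IsCellSolution (S : Set E3) (εr : ℂ) (k0 : ℝ) (z : C3) (u : L2 C3) : Prop :=
  MemX0div S u ∧ ∀ v, MemX0div S v →
    b0 S u v - εr * (k0 : ℂ) ^ 2 * inner ℂ v u = εr * (k0 : ℂ) ^ 2 * inner ℂ v (constField z)

open Classical in
/-- The solution of the cell problem with datum `z` (with value `0` if there is none). -/
def cellSolution (S : Set E3) (εr : ℂ) (k0 : ℝ) (z : C3) : L2 C3 :=
  if h : ∃ u, IsCellSolution S εr k0 z u then h.choose else 0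

/-- The magnetic shape function `H^k = e_k + u^k`. -/
def shapeField (S : Set E3) (εr : ℂ) (k0 : ℝ) (k : Fin 3) : L2 C3 :=
  constField (basisC k) + cellSolution S εr k0 (basisC k)

/-- The effective permeability tensor, with entries `∫_Y H^k · e_l`. -/
def muEff (S : Set E3) (εr : ℂ) (k0 : ℝ) : Matrix (Fin 3) (Fin 3) ℂ :=
  Matrix.of fun k l => ∫ y, shapeField S εr k0 k y l ∂muY

/-! ### The space `Z₀`, the operator `Γ` and the spectral problem -/

/-- `f ∈ Z₀`: (complex valued) `L²` fields that are divergence-free in the sense of distributions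
and vanish outside `S`. -/
structure MemZ0 (S : Set E3) (f : L2 C3) : Prop where
  div_eq_zero : ∀ φ : E3 → ℝ, IsPeriodicSmooth φ → ∫ y, ∑ i, (pd i φ y : ℂ) * f y i ∂muY = 0
  eq_zero : ∀ᵐ y ∂volume.restrict (cellY \ S), f y = 0

/-- `ψ ∈ W^{1,2}_♯(Y; ℂ³)` is a weak periodic solution of `-Δψ = f` with zero mean. -/
def IsPotential (f ψ : L2 C3) : Prop :=
  MemW12 ψ ∧ ∫ y, ψ y ∂muY = 0 ∧
    ∀ φ : E3 → ℝ, IsPeriodicSmooth φ →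
      ∫ y, ∑ i, pd i φ y • wpd i ψ y ∂muY = ∫ y, φ y • f y ∂muY

open Classical in
/-- The potential `ψ_f` (with value `0` if there is none). -/
def potential (f : L2 C3) : L2 C3 := if h : ∃ ψ, IsPotential f ψ then h.choose else 0

/-- The moment `∫_S y ∧ f(y) dy`. -/
def moment (S : Set E3) (f : L2 C3) : C3 := ∫ y in S, crossL (toC3 y) (f y)

/-- `Γ f = curl ψ_f + (1/2) ∫_S y ∧ f`. -/
def Gam (S : Set E3) (f : L2 C3) : L2 C3 :=
  curl (potential f) + constField ((1 / 2 : ℂ) • moment S f)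

/-- The Hermitian form `a₀(f, g) = ∫_Y Γf · conj (Γg)`. -/
def a0 (S : Set E3) (f g : L2 C3) : ℂ := inner ℂ (Gam S g) (Gam S f)

/-- `(αₙ, fₙ)` diagonalizes `a₀` on `Z₀`: the `αₙ` are positive, nonincreasing and tend to `0`,
the `fₙ` are real valued and form an orthonormal (Hilbert) basis of `Z₀`, and
`a₀(fₙ, g) = αₙ ∫_Y fₙ · conj g` for all `g ∈ Z₀`. -/
structure IsSpectralSystem (S : Set E3) (α : ℕ → ℝ) (f : ℕ → L2 C3) : Prop where
  pos : ∀ n, 0 < α n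
  antitone : Antitone α
  tendsto_zero : Tendsto α atTop (𝓝 0)
  real_valued : ∀ n, ∀ᵐ y ∂muY, ∀ j, (f n y j).im = 0
  orthonormal : Orthonormal ℂ f
  closed_span : ∀ g, MemZ0 S g ↔ g ∈ (Submodule.span ℂ (Set.range f)).topologicalClosure
  eigen : ∀ n g, MemZ0 S g → a0 S (f n) g = α n * inner ℂ g (f n)

/-- The eigenvalues `λₙ = 1 / αₙ`. -/
def lam (α : ℕ → ℝ) (n : ℕ) : ℝ := 1 / α n

/-- The eigenfields `uₙ = αₙ^{-1/2} Γ fₙ`. -/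
def uField (S : Set E3) (α : ℕ → ℝ) (f : ℕ → L2 C3) (n : ℕ) : L2 C3 :=
  ((1 / Real.sqrt (α n) : ℝ) : ℂ) • Gam S (f n)

/-- `(λₙ, uₙ)` is a complete normalized system of eigenpairs of the curl-curl problem on `X₀^div`:
`b₀(uₙ, v) = λₙ ∫_Y uₙ · conj v` for all `v ∈ X₀^div`, the `uₙ` are real valued, orthonormal in
`L²`, and only the zero field of `X₀^div` is `b₀`-orthogonal to all of them. -/
structure IsCurlEigenbasis (S : Set E3) (l : ℕ → ℝ) (u : ℕ → L2 C3) : Prop where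
  mem : ∀ n, MemX0div S (u n)
  eigen : ∀ n v, MemX0div S v → b0 S (u n) v = l n * inner ℂ v (u n)
  real_valued : ∀ n, ∀ᵐ y ∂muY, ∀ j, (u n y j).im = 0
  orthonormal : Orthonormal ℂ u
  complete : ∀ v, MemX0div S v → (∀ n, b0 S v (u n) = 0) → v = 0

end MagneticCell

end

open MeasureTheory Filter Topology
open scoped ContDiff

noncomputable section

namespace MagneticCell

set_option linter.unusedSectionVars false

/-! ### Fourier series on the unit cell -/

/-! The heart of the matter is that `Γ` is a bijection from `Z₀` onto `X₀^div` with inverse `curl`.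
It turns `a₀` into the `L²` product and the `L²` product of `Z₀` into `b₀`, so a diagonalization of
`a₀` on `Z₀` is one of the curl-curl problem. Writing `u = Γg` and `ε = εr k₀²`, the cell problem
with datum `z` becomes `⟨g, h⟩ - ε⟨Γg, Γh⟩ = ε⟨z, Γh⟩` (products linear in the first argument) for
all `h` in `Z₀`. In the basis `fₙ` this is the diagonal system `(1 - ε αₙ) gₙ = ε⟨z, Γfₙ⟩`, solvable
because `Im ε > 0`. Its factors `ε / (1 - ε αₙ)` are bounded since `αₙ → 0`, so the series for `g`
converges in `L²`. As `Γ` is bounded from `L²` to `W^{1,2}`, the series for `u` converges there, and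
taking means gives the permeability.

The differential calculus is done on Fourier coefficients (`weak_divergence_iff`): `∂ᵢ` is
multiplication by `2iπkᵢ`, and bounded symbols give bounded operators (`exists_multiplier`). The
constant term of `Γ` is fixed by an elementary fact (`fc_zero_eq_momentL`): a field supported in `S`
has as mean half the moment of its curl, as one sees by testing with coordinate functions.

If `v` is in `X₀^div`, then `v = ∇ψ` outside `S` with `ψ` periodic, so `v - ∇ψ` is supported in `S`
and the mean of `v` is half the moment of `curl v`. Hence `v - Γ curl v` is curl-free,
divergence-free and of mean zero, so it vanishes (`MemX0div.eq_GamL`).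

Conversely (`MemZ0.memX0div_GamL`), the circulation of `u = Γf` must be shown to vanish. In `Y \ S`
the components of `u` are harmonic, hence smooth by Weyl's lemma, and simple connectedness gives `u
= ∇w` there. Near `S` the function `w` agrees outside `S` with some `ψ` in `W^{1,2}_♯`
(`exists_extension`). Then `u - ∇ψ` vanishes near `S` outside `S`, and its restriction `d` to `S`,
extended by zero, still has curl `f`. So `u - d` is curl-free, and of mean zero by the mean-moment
identity: it is a periodic gradient that equals `u` outside `S`.

The extension needs no trace theory. If `n` is transversal to the boundary, `w(y) = w(y + hn) - ∫₀ʰ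
(n · u)(y + sn) ds` outside `S`. On the right, the first term lives away from `S`, and the second is
a Fourier multiplier applied to the globally defined `W^{1,2}` function `n · u`. -/

/-- The measure on the torus `(ℝ/ℤ)³`. -/
abbrev torusMeasure : Measure (UnitAddTorus (Fin 3)) :=
  Measure.pi fun _ => AddCircle.haarAddCircle

/-- The projection of `ℝ³` onto the torus. -/
def toTorus (y : E3) : UnitAddTorus (Fin 3) := fun i => (y i : UnitAddCircle)

/-- The half-open unit cell. -/
def cellIoc : Set (Fin 3 → ℝ) := Set.pi Set.univ fun _ => Set.Ioc (-(1 / 2 : ℝ)) (-(1 / 2) + 1)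

theorem isOpen_cellY : IsOpen cellY := by
  have : cellY = ⋂ i : Fin 3, {y : E3 | -(1 / 2 : ℝ) < y i ∧ y i < 1 / 2} := by
    ext y; simp [cellY]
  rw [this]
  refine isOpen_iInter_of_finite fun i => ?_
  have hc : Continuous fun y : E3 => y i := by fun_prop
  exact (isOpen_lt continuous_const hc).inter (isOpen_lt hc continuous_const)

theorem measurableSet_cellY : MeasurableSet cellY := isOpen_cellY.measurableSet

/-- The open and half-open cells differ by a null set; only the half-open one is a fundamental
domain for the projection to the torus. -/
theorem muY_eq : muY = volume.restrict (WithLp.ofLp ⁻¹' cellIoc : Set E3) := by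
  refine Measure.restrict_congr_set ?_
  have h1 : (cellY : Set E3) = WithLp.ofLp ⁻¹'
      (Set.pi Set.univ fun _ : Fin 3 => Set.Ioo (-(1 / 2 : ℝ)) (-(1 / 2) + 1)) := by
    ext y
    simp only [cellY, Set.mem_ofPred_eq, Set.mem_preimage, Set.mem_pi, Set.mem_univ, true_imp_iff,
      Set.mem_Ioo]
    norm_num
  rw [h1]
  exact (PiLp.volume_preserving_ofLp (Fin 3)).quasiMeasurePreserving.preimage_ae_eq
    Measure.univ_pi_Ioo_ae_eq_Icc |>.trans
    ((PiLp.volume_preserving_ofLp (Fin 3)).quasiMeasurePreserving.preimage_ae_eq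
    Measure.univ_pi_Ioc_ae_eq_Icc).symm

theorem measurePreserving_toTorus : MeasurePreserving toTorus muY torusMeasure := by
  rw [muY_eq]
  have h1 := (PiLp.volume_preserving_ofLp (Fin 3)).restrict_preimage
    (s := cellIoc) (MeasurableSet.univ_pi fun _ => measurableSet_Ioc)
  have h2 : MeasurePreserving (fun (a : Fin 3 → ℝ) i => (a i : UnitAddCircle))
      (volume.restrict cellIoc) torusMeasure := by
    have := measurePreserving_pi (fun _ : Fin 3 => volume.restrict
      (Set.Ioc (-(1 / 2 : ℝ)) (-(1 / 2) + 1))) (fun _ => (volume : Measure UnitAddCircle))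
      (fun i => AddCircle.measurePreserving_mk 1 (-(1 / 2)))
    rw [← Measure.restrict_pi_pi] at this
    have hv : (volume : Measure UnitAddCircle) = AddCircle.haarAddCircle := by
      rw [AddCircle.volume_eq_smul_haarAddCircle]; simp
    rw [hv] at this
    exact this
  exact h2.comp h1

instance : IsProbabilityMeasure muY where
  measure_univ := by
    have h := measurePreserving_toTorus.measure_preimage (s := Set.univ)
      MeasurableSet.univ.nullMeasurableSet
    simpa using h

/-- A section of `toTorus` with values in the half-open cell. -/
def ofTorus (x : UnitAddTorus (Fin 3)) : E3 :=
  WithLp.toLp 2 (UnitAddTorus.measurableEquivPiIoc (fun _ => -(1 / 2 : ℝ)) x).1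

theorem measurable_ofTorus : Measurable ofTorus := by
  unfold ofTorus
  exact (WithLp.measurable_toLp 2 _).comp
    (measurable_subtype_coe.comp (UnitAddTorus.measurableEquivPiIoc _).measurable)

theorem ofTorus_toTorus {y : E3} (hy : y ∈ cellY) : ofTorus (toTorus y) = y := by
  have hy' : ∀ i, y i ∈ Set.Ioc (-(1 / 2 : ℝ)) (-(1 / 2) + 1) := fun i =>
    ⟨(hy i).1, by linarith [(hy i).2]⟩
  have h := (UnitAddTorus.measurableEquivPiIoc (fun _ : Fin 3 => -(1 / 2 : ℝ))).apply_symm_apply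
    ⟨WithLp.ofLp y, hy'⟩
  rw [UnitAddTorus.coe_symm_measurableEquivPiIoc_apply] at h
  unfold ofTorus
  have h' : (UnitAddTorus.measurableEquivPiIoc (fun _ : Fin 3 => -(1 / 2 : ℝ))) (toTorus y) =
    ⟨WithLp.ofLp y, hy'⟩ := h
  rw [h']

theorem ae_muY_mem : ∀ᵐ y ∂muY, y ∈ cellY := ae_restrict_mem measurableSet_cellY

/-- The character `y ↦ exp (2 i π k · y)`. -/
def char (k : Fin 3 → ℤ) (y : E3) : ℂ := UnitAddTorus.mFourier k (toTorus y)

theorem char_eq (k : Fin 3 → ℤ) (y : E3) :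
    char k y = Complex.exp (2 * Real.pi * Complex.I * ∑ i, (k i : ℂ) * (y i : ℂ)) := by
  simp only [char, UnitAddTorus.mFourier, toTorus, ContinuousMap.coe_mk, fourier_coe_apply]
  rw [← Complex.exp_sum, Finset.mul_sum]
  congr 1
  refine Finset.sum_congr rfl fun i _ => ?_
  simp; ring

theorem contDiff_char (k : Fin 3 → ℤ) : ContDiff ℝ ∞ (char k) := by
  have : char k = fun y : E3 =>
    Complex.exp (2 * Real.pi * Complex.I * ∑ i, (k i : ℂ) * (y i : ℂ)) := funext (char_eq k)
  rw [this]
  have h : ∀ i, ContDiff ℝ ∞ (fun y : E3 => ((y i : ℝ) : ℂ)) := fun i =>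
    Complex.ofRealCLM.contDiff.comp (by fun_prop)
  fun_prop

theorem continuous_char (k : Fin 3 → ℤ) : Continuous (char k) := (contDiff_char k).continuous

theorem norm_char (k : Fin 3 → ℤ) (y : E3) : ‖char k y‖ = 1 := by
  rw [char_eq, show (2 * Real.pi * Complex.I * ∑ i, (k i : ℂ) * (y i : ℂ)) =
    ((2 * Real.pi * ∑ i, (k i : ℝ) * y i : ℝ) : ℂ) * Complex.I by push_cast; ring]
  exact Complex.norm_exp_ofReal_mul_I _

theorem char_neg (k : Fin 3 → ℤ) (y : E3) : char (-k) y = (starRingEnd ℂ) (char k y) :=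
  UnitAddTorus.mFourier_neg

theorem char_zero (y : E3) : char 0 y = 1 := by simp [char, UnitAddTorus.mFourier_zero]

theorem char_add (k l : Fin 3 → ℤ) (y : E3) : char (k + l) y = char k y * char l y :=
  UnitAddTorus.mFourier_add

theorem char_add_right (k : Fin 3 → ℤ) (x y : E3) : char k (x + y) = char k x * char k y := by
  rw [char_eq, char_eq, char_eq, ← Complex.exp_add]
  congr 1
  simp only [PiLp.add_apply, Complex.ofReal_add, mul_add, Finset.sum_add_distrib]

theorem integral_char (k : Fin 3 → ℤ) : ∫ y, char k y ∂muY = if k = 0 then 1 else 0 := by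
  have h := orthonormal_iff_ite.1 (UnitAddTorus.orthonormal_mFourier (d := Fin 3)) 0 k
  have hm : ∫ x, (UnitAddTorus.mFourier k) x ∂torusMeasure = ∫ y, char k y ∂muY := by
    rw [← measurePreserving_toTorus.map_eq, integral_map
      measurePreserving_toTorus.measurable.aemeasurable]
    · rfl
    · exact (UnitAddTorus.mFourier k).continuous.aestronglyMeasurable
  rw [← hm]
  erw [ContinuousMap.inner_toLp] at h
  simp only [UnitAddTorus.mFourier_zero, ContinuousMap.one_apply, map_one, mul_one,
    eq_comm (a := (0 : Fin 3 → ℤ))] at h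
  exact h

/-- A scalar field whose Fourier coefficients all vanish is zero. -/
theorem eq_zero_of_integral_char (u : L2 ℂ)
    (h : ∀ k, ∫ y, char (-k) y * u y ∂muY = 0) : u = 0 := by
  -- Pulling `u` back by the measurable section reduces the claim to completeness of the characters
  -- on the torus.
  set v : UnitAddTorus (Fin 3) → ℂ := fun x => u (ofTorus x) with hv
  have hvu : v ∘ toTorus =ᵐ[muY] u := by
    filter_upwards [ae_muY_mem] with y hy
    simp [hv, ofTorus_toTorus hy]
  have hvm : AEStronglyMeasurable v torusMeasure :=
    ((Lp.stronglyMeasurable u).comp_measurable measurable_ofTorus).aestronglyMeasurable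
  have hvL : MemLp v 2 torusMeasure := by
    refine ⟨hvm, ?_⟩
    rw [← eLpNorm_comp_measurePreserving hvm measurePreserving_toTorus, eLpNorm_congr_ae hvu]
    exact Lp.eLpNorm_lt_top u
  have hz : hvL.toLp v = 0 := by
    refine (UnitAddTorus.mFourierBasis (d := Fin 3)).repr.injective ?_
    ext k
    rw [map_zero, UnitAddTorus.mFourierBasis_repr]
    have e1 : UnitAddTorus.mFourierCoeff (hvL.toLp v) k =
        ∫ x, UnitAddTorus.mFourier (-k) x • v x ∂torusMeasure := by
      refine integral_congr_ae ?_
      filter_upwards [hvL.coeFn_toLp] with x hx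
      rw [hx]
    rw [e1, ← measurePreserving_toTorus.map_eq,
      integral_map measurePreserving_toTorus.measurable.aemeasurable]
    · refine (integral_congr_ae ?_).trans (h k)
      filter_upwards [hvu] with y hy
      simp only [Function.comp_apply] at hy
      simp [char, hy]
    · rw [measurePreserving_toTorus.map_eq]
      exact (UnitAddTorus.mFourier (-k)).continuous.aestronglyMeasurable.smul hvm
  have hv0 : v =ᵐ[torusMeasure] 0 := by
    refine hvL.coeFn_toLp.symm.trans ?_
    rw [hz]; exact Lp.coeFn_zero _ _ _
  refine Lp.ext ?_
  have := measurePreserving_toTorus.quasiMeasurePreserving.ae_eq_comp hv0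
  filter_upwards [this, hvu, Lp.coeFn_zero ℂ 2 muY] with y h1 h2 h3
  rw [h3, ← h2, h1]; rfl

/-! ### Fourier series of vector valued fields and Fourier multipliers. -/

section Vector

variable {F : Type} [NormedAddCommGroup F] [InnerProductSpace ℂ F] [NormedSpace ℝ F]
  [IsScalarTower ℝ ℂ F]

theorem memLp_char_smul (k : Fin 3 → ℤ) (a : F) : MemLp (fun y => char k y • a) 2 muY := by
  refine MemLp.of_bound (C := ‖a‖) ?_ ?_
  · exact ((continuous_char k).smul continuous_const).aestronglyMeasurable
  · exact Eventually.of_forall fun y => by rw [norm_smul, norm_char, one_mul]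

/-- The field `y ↦ exp (2 i π k · y) a`. -/
def charField (k : Fin 3 → ℤ) : F →ₗᵢ[ℂ] L2 F where
  toFun a := (memLp_char_smul k a).toLp _
  map_add' a b := by
    rw [← MemLp.toLp_add]
    refine MemLp.toLp_congr _ _ (Eventually.of_forall fun y => ?_)
    simp [smul_add]
  map_smul' c a := by
    rw [RingHom.id_apply, ← MemLp.toLp_const_smul]
    refine MemLp.toLp_congr _ _ (Eventually.of_forall fun y => ?_)
    simp [smul_comm c]
  norm_map' a := by
    simp only [LinearMap.coe_mk, AddHom.coe_mk]
    rw [Lp.norm_toLp, eLpNorm_congr_norm_ae (g := fun _ => a)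
      (Eventually.of_forall fun y => by rw [norm_smul, norm_char, one_mul])]
    rw [eLpNorm_const _ (by norm_num) (NeZero.ne _)]
    simp

theorem coeFn_charField (k : Fin 3 → ℤ) (a : F) :
    (charField k a : E3 → F) =ᵐ[muY] fun y => char k y • a :=
  (memLp_char_smul k a).coeFn_toLp

variable [CompleteSpace F]

theorem integrable_L2 (u : L2 F) : Integrable u muY := (Lp.memLp u).integrable (by norm_num)

theorem integrable_bdd_smul {φ : E3 → ℂ} (hφ : Continuous φ) {C : ℝ} (hC : ∀ y, ‖φ y‖ ≤ C)
    (u : L2 F) : Integrable (fun y => φ y • u y) muY :=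
  (integrable_L2 u).bdd_smul C hφ.aestronglyMeasurable (Eventually.of_forall hC)

theorem inner_charField (k : Fin 3 → ℤ) (a : F) (u : L2 F) :
    inner ℂ (charField k a) u = inner ℂ a (∫ y, char (-k) y • u y ∂muY) := by
  rw [L2.inner_def, ← integral_inner
    (integrable_bdd_smul (continuous_char _) (fun y => (norm_char _ y).le) u)]
  refine integral_congr_ae ?_
  filter_upwards [coeFn_charField k a] with y hy
  rw [hy, inner_smul_left, inner_smul_right, char_neg]

theorem orthogonalFamily_charField :
    OrthogonalFamily ℂ (fun _ : Fin 3 → ℤ => F) (fun k => charField k) := by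
  intro k l hkl a b
  rw [inner_charField]
  have : ∫ y, char (-k) y • (charField l b : E3 → F) y ∂muY = (∫ y, char (l - k) y ∂muY) • b := by
    rw [← integral_smul_const]
    refine integral_congr_ae ?_
    filter_upwards [coeFn_charField l b] with y hy
    rw [hy, smul_smul, sub_eq_neg_add, char_add]
  rw [this, integral_char, if_neg (sub_ne_zero.2 (Ne.symm hkl)), zero_smul, inner_zero_right]

variable [FiniteDimensional ℂ F]

/-- Completeness reduces to the scalar case: if `u` is orthogonal to every `charField k a`, each
scalar field `⟨a, u⟩` has zero Fourier coefficients, and an orthonormal basis of `F` recovers `u`.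
-/
theorem isHilbertSum_charField :
    IsHilbertSum ℂ (fun _ : Fin 3 → ℤ => F) (fun k => charField k) := by
  refine IsHilbertSum.mk orthogonalFamily_charField ?_
  rw [top_le_iff, Submodule.topologicalClosure_eq_top_iff, Submodule.eq_bot_iff]
  intro u hu
  have h0 : ∀ k, ∀ a : F, inner ℂ (charField k a) u = 0 := by
    intro k a
    rw [Submodule.mem_orthogonal] at hu
    refine hu _ (Submodule.mem_iSup_of_mem k ?_)
    exact ⟨a, rfl⟩
  have h1 : ∀ a : F, (innerSL ℂ a).compLp u = 0 := by
    intro a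
    refine eq_zero_of_integral_char _ fun k => ?_
    rw [← h0 k a, inner_charField, ← integral_inner
      (integrable_bdd_smul (continuous_char _) (fun y => (norm_char _ y).le) u)]
    refine integral_congr_ae ?_
    filter_upwards [(innerSL ℂ a).coeFn_compLp u] with y hy
    rw [hy, inner_smul_right, innerSL_apply_apply]
  let b := stdOrthonormalBasis ℂ F
  refine Lp.ext ?_
  have h2 : ∀ i, ∀ᵐ y ∂muY, inner ℂ (b i) (u y) = 0 := by
    intro i
    filter_upwards [(innerSL ℂ (b i)).coeFn_compLp u, Lp.coeFn_zero ℂ 2 muY] with y hy h3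
    rw [h1] at hy
    rw [← innerSL_apply_apply ℂ, ← hy, h3]; rfl
  filter_upwards [ae_all_iff.2 h2, Lp.coeFn_zero F 2 muY] with y hy h3
  rw [h3]
  refine InnerProductSpace.ext_inner_left_basis (𝕜 := ℂ) b.toBasis fun i => ?_
  rw [b.coe_toBasis, Pi.zero_apply, inner_zero_right, hy i]

/-- The Fourier transform on `L²(Y; F)`. -/
def fourier : L2 F ≃ₗᵢ[ℂ] lp (fun _ : Fin 3 → ℤ => F) 2 :=
  isHilbertSum_charField.linearIsometryEquiv

/-- The `k`-th Fourier coefficient. -/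
def fc (k : Fin 3 → ℤ) : L2 F →L[ℂ] F :=
  ContinuousLinearMap.adjoint (charField (F := F) k).toContinuousLinearMap

theorem fourier_apply (u : L2 F) (k : Fin 3 → ℤ) : fourier u k = fc k u := by
  classical
  refine ext_inner_left ℂ fun a => ?_
  rw [fc, ContinuousLinearMap.adjoint_inner_right]
  have h := IsHilbertSum.linearIsometryEquiv_symm_apply_single
    (isHilbertSum_charField (F := F)) (i := k) a
  rw [LinearIsometry.coe_toContinuousLinearMap, ← h, ← (fourier (F := F)).inner_map_map]
  erw [LinearIsometryEquiv.apply_symm_apply]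
  rw [lp.inner_single_left]

theorem fc_eq_integral (u : L2 F) (k : Fin 3 → ℤ) :
    fc k u = ∫ y, char (-k) y • u y ∂muY := by
  refine ext_inner_left ℂ fun a => ?_
  rw [fc, ContinuousLinearMap.adjoint_inner_right]
  exact inner_charField k a u

theorem fc_ext {u v : L2 F} (h : ∀ k, fc k u = fc k v) : u = v := by
  refine fourier.injective (lp.ext (funext fun k => ?_))
  rw [fourier_apply, fourier_apply, h]

theorem hasSum_charField (u : L2 F) : HasSum (fun k => charField k (fc k u)) u := by
  have h := isHilbertSum_charField.hasSum_linearIsometryEquiv_symm (fourier u)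
  simp only [fourier_apply] at h
  convert h
  exact (LinearIsometryEquiv.symm_apply_apply _ _).symm

theorem fc_charField (k l : Fin 3 → ℤ) (a : F) :
    fc k (charField l a) = if k = l then a else 0 := by
  refine ext_inner_left ℂ fun b => ?_
  rw [fc, ContinuousLinearMap.adjoint_inner_right]
  split_ifs with h
  · subst h; exact LinearIsometry.inner_map_map (𝕜 := ℂ) (charField k) b a
  · rw [inner_zero_right]; exact orthogonalFamily_charField h b a

/-- By Parseval a uniformly bounded symbol acts boundedly on the `ℓ²` coefficients. Every operator
below (inverse Laplacian, Biot-Savart, averages along a segment) is produced this way. -/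
theorem exists_multiplier {G : Type} [NormedAddCommGroup G] [InnerProductSpace ℂ G]
    [NormedSpace ℝ G] [IsScalarTower ℝ ℂ G] [CompleteSpace G] [FiniteDimensional ℂ G] (m : (Fin 3 → ℤ) → F →L[ℂ] G) {C : ℝ}
    (hm : ∀ k, ‖m k‖ ≤ C) :
    ∃ T : L2 F →L[ℂ] L2 G, ∀ u k, fc k (T u) = m k (fc k u) := by
  have hC : 0 ≤ C := (norm_nonneg _).trans (hm 0)
  refine ⟨(fourier (F := G)).symm.toContinuousLinearEquiv.toContinuousLinearMap ∘L
    (lp.mapCLM 2 m hC hm) ∘L (fourier (F := F)).toContinuousLinearEquiv.toContinuousLinearMap,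
    fun u k => ?_⟩
  rw [← fourier_apply, ← fourier_apply]
  simp [lp.mapCLM]

end Vector

/-! ### Periodic functions and integration by parts -/

/-- The `i`-th vector of the canonical basis of `ℝ³`. -/
abbrev ee (i : Fin 3) : E3 := EuclideanSpace.single i 1

theorem integral_muY {V : Type} [NormedAddCommGroup V] [NormedSpace ℝ V] (g : E3 → V) :
    ∫ y, g y ∂muY = ∫ x in Set.Icc (fun _ : Fin 3 => -(1 / 2 : ℝ)) (fun _ => 1 / 2),
      g (WithLp.toLp 2 x) := by
  have h1 := (PiLp.volume_preserving_ofLp (Fin 3)).setIntegral_preimage_emb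
    (MeasurableEquiv.toLp 2 (Fin 3 → ℝ)).symm.measurableEmbedding
    (fun x => g (WithLp.toLp 2 x)) cellIoc
  rw [muY_eq]
  refine Eq.trans ?_ (h1.trans ?_)
  · rfl
  · refine setIntegral_congr_set ?_
    have := Measure.univ_pi_Ioc_ae_eq_Icc (μ := fun _ : Fin 3 => (volume : Measure ℝ))
      (f := fun _ => -(1 / 2 : ℝ)) (g := fun _ => -(1 / 2) + 1)
    norm_num at this
    norm_num [cellIoc]
    exact this

/-- Divergence theorem on the cube for the field whose only nonzero component is the `i`-th: the
fluxes through opposite faces cancel by periodicity. -/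
theorem integral_fderiv_eq_zero {V : Type} [NormedAddCommGroup V] [NormedSpace ℝ V]
    [CompleteSpace V] {G : E3 → V} (hG : ContDiff ℝ 1 G) (i : Fin 3)
    (hp : ∀ y, G (y + ee i) = G y) : ∫ y, fderiv ℝ G y (ee i) ∂muY = 0 := by
  classical
  rw [integral_muY]
  let L : (Fin 3 → ℝ) →L[ℝ] E3 := (PiLp.continuousLinearEquiv 2 ℝ (fun _ : Fin 3 => ℝ)).symm
  have hL : ∀ x, L x = WithLp.toLp 2 x := fun x => rfl
  have hd : Differentiable ℝ G := hG.differentiable (by norm_num)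
  have key := integral_divergence_of_hasFDerivAt_off_countable' (E := V)
    (fun _ : Fin 3 => -(1 / 2 : ℝ)) (fun _ => 1 / 2) (fun _ => by norm_num)
    (fun j x => if j = i then G (WithLp.toLp 2 x) else 0)
    (fun j x => if j = i then (fderiv ℝ G (WithLp.toLp 2 x)).comp L else 0) ∅
    Set.countable_empty ?_ ?_ ?_
  · refine Eq.trans ?_ (key.trans ?_)
    · refine integral_congr_ae (Eventually.of_forall fun x => ?_)
      simp only
      rw [Finset.sum_eq_single i]
      · simp only [if_true, ContinuousLinearMap.comp_apply, hL]
        rfl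
      · intro j _ hj; simp [hj]
      · simp
    · refine Finset.sum_eq_zero fun j _ => ?_
      by_cases hj : j = i
      · subst hj
        simp only [if_true]
        rw [sub_eq_zero]
        refine integral_congr_ae (Eventually.of_forall fun x => ?_)
        simp only
        rw [← hp (WithLp.toLp 2 (Fin.insertNth j (-(1 / 2 : ℝ)) x))]
        congr 1
        ext l
        rcases Fin.eq_self_or_eq_succAbove j l with h | ⟨m, h⟩
        · subst h; simp; norm_num
        · subst h; simp [Fin.succAbove_ne]
      · simp [hj]
  · intro j
    by_cases hj : j = i
    · simp only [hj, if_true]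
      exact (hd.continuous.comp (L.continuous)).continuousOn
    · simp only [hj, if_false]; exact continuousOn_const
  · intro x _ j
    by_cases hj : j = i
    · simp only [hj, if_true]
      exact (hd (WithLp.toLp 2 x)).hasFDerivAt.comp x L.hasFDerivAt
    · simp only [hj, if_false]; exact hasFDerivAt_const _ _
  · refine ContinuousOn.integrableOn_Icc (Continuous.continuousOn ?_)
    refine continuous_finsetSum _ fun j _ => ?_
    by_cases hj : j = i
    · simp only [hj, if_true]
      exact (((hG.continuous_fderiv (by norm_num)).comp L.continuous).clm_comp
        continuous_const).clm_apply continuous_const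
    · simp only [hj, if_false]; exact continuous_const

theorem exists_bound_muY {V : Type} [NormedAddCommGroup V] {φ : E3 → V} (hφ : Continuous φ) :
    ∃ C, ∀ᵐ y ∂muY, ‖φ y‖ ≤ C := by
  obtain ⟨C, hC⟩ := isBounded_cellY.isCompact_closure.exists_bound_of_continuousOn hφ.continuousOn
  exact ⟨C, ae_muY_mem.mono fun y hy => hC y (subset_closure hy)⟩

theorem integrable_of_continuous {V : Type} [NormedAddCommGroup V] {φ : E3 → V}
    (hφ : Continuous φ) : Integrable φ muY := by
  obtain ⟨C, hC⟩ := exists_bound_muY hφ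
  exact Integrable.of_bound hφ.aestronglyMeasurable C hC

section

variable {F : Type} [NormedAddCommGroup F] [InnerProductSpace ℂ F] [NormedSpace ℝ F]
  [IsScalarTower ℝ ℂ F] [CompleteSpace F]

theorem memLp_smul {φ : E3 → ℂ} (hφ : Continuous φ) (u : L2 F) :
    MemLp (fun y => φ y • u y) 2 muY := by
  obtain ⟨C, hC⟩ := exists_bound_muY hφ
  exact (Lp.memLp u).of_le_mul (c := C) (hφ.aestronglyMeasurable.smul (Lp.aestronglyMeasurable u))
    (hC.mono fun y hy => by rw [norm_smul]; gcongr)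

theorem integrable_smul {φ : E3 → ℂ} (hφ : Continuous φ) (u : L2 F) :
    Integrable (fun y => φ y • u y) muY :=
  (memLp_smul hφ u).integrable (by norm_num)

/-- The integral against a continuous function, as a continuous functional on `L²(Y; F)`. -/
def integralL (φ : E3 → ℂ) (hφ : Continuous φ) : L2 F →L[ℂ] F :=
  LinearMap.mkContinuousOfExistsBound
    { toFun := fun u => ∫ y, φ y • u y ∂muY
      map_add' := fun u v => by
        rw [← integral_add (integrable_smul hφ u) (integrable_smul hφ v)]
        refine integral_congr_ae ?_
        filter_upwards [Lp.coeFn_add u v] with y hy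
        rw [hy, Pi.add_apply, smul_add]
      map_smul' := fun c u => by
        rw [RingHom.id_apply, ← integral_smul]
        refine integral_congr_ae ?_
        filter_upwards [Lp.coeFn_smul c u] with y hy
        rw [hy, Pi.smul_apply, smul_comm] }
    (by
      obtain ⟨C, hC⟩ := exists_bound_muY hφ
      refine ⟨C, fun u => ?_⟩
      have hC0 : 0 ≤ C := by
        obtain ⟨y, hy⟩ := hC.exists
        exact (norm_nonneg _).trans hy
      have h1 : ∫ y, ‖u y‖ ∂muY ≤ ‖u‖ := by
        have h2 : eLpNorm u 1 muY ≤ eLpNorm u 2 muY :=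
          eLpNorm_le_eLpNorm_of_exponent_le (by norm_num) (Lp.aestronglyMeasurable u)
        rw [integral_norm_eq_lintegral_enorm (Lp.aestronglyMeasurable u), Lp.norm_def]
        rw [eLpNorm_one_eq_lintegral_enorm] at h2
        exact ENNReal.toReal_mono (Lp.eLpNorm_ne_top u) h2
      calc ‖∫ y, φ y • u y ∂muY‖ ≤ ∫ y, C * ‖u y‖ ∂muY := by
            refine norm_integral_le_of_norm_le ((integrable_L2 u).norm.const_mul C) ?_
            filter_upwards [hC] with y hy
            rw [norm_smul]; gcongr
        _ = C * ∫ y, ‖u y‖ ∂muY := integral_const_mul _ _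
        _ ≤ C * ‖u‖ := by gcongr)

theorem integralL_apply (φ : E3 → ℂ) (hφ : Continuous φ) (u : L2 F) :
    integralL φ hφ u = ∫ y, φ y • u y ∂muY := rfl

theorem integralL_charField (φ : E3 → ℂ) (hφ : Continuous φ) (k : Fin 3 → ℤ) (a : F) :
    integralL φ hφ (charField k a) = (∫ y, φ y * char k y ∂muY) • a := by
  rw [integralL_apply, ← integral_smul_const]
  refine integral_congr_ae ?_
  filter_upwards [coeFn_charField k a] with y hy
  rw [hy, smul_smul]

end

/-! ### Periodic test functions and derivatives of characters. -/

theorem IsPeriodicSmooth.continuous {φ : E3 → ℝ} (hφ : IsPeriodicSmooth φ) : Continuous φ :=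
  hφ.1.continuous

theorem IsPeriodicSmooth.ofReal_continuous {φ : E3 → ℝ} (hφ : IsPeriodicSmooth φ) :
    Continuous fun y => (φ y : ℂ) := Complex.continuous_ofReal.comp hφ.continuous

theorem IsPeriodicSmooth.differentiable {φ : E3 → ℝ} (hφ : IsPeriodicSmooth φ) :
    Differentiable ℝ φ := hφ.1.differentiable (by simp)

theorem IsPeriodicSmooth.pd {φ : E3 → ℝ} (hφ : IsPeriodicSmooth φ) (i : Fin 3) :
    IsPeriodicSmooth (pd i φ) := by
  refine ⟨?_, fun j y => ?_⟩
  · unfold MagneticCell.pd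
    exact (hφ.1.fderiv_right (m := ∞) (by simp)).clm_apply contDiff_const
  · unfold MagneticCell.pd
    rw [← fderiv_comp_add_right]
    congr 2
    exact funext (hφ.2 j)

theorem IsPeriodicSmooth.mul {φ χ : E3 → ℝ} (hφ : IsPeriodicSmooth φ) (hχ : IsPeriodicSmooth χ) :
    IsPeriodicSmooth fun y => φ y * χ y :=
  ⟨hφ.1.mul hχ.1, fun i y => by simp only [hφ.2, hχ.2]⟩

theorem pd_mul {φ χ : E3 → ℝ} {y : E3} (hφ : DifferentiableAt ℝ φ y)
    (hχ : DifferentiableAt ℝ χ y) (i : Fin 3) :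
    pd i (fun y => φ y * χ y) y = φ y * pd i χ y + χ y * pd i φ y := by
  unfold pd
  rw [fderiv_fun_mul hφ hχ]
  simp

theorem char_add_single (k : Fin 3 → ℤ) (i : Fin 3) (y : E3) : char k (y + ee i) = char k y := by
  unfold char
  congr 1
  funext j
  by_cases h : j = i
  · subst h; simp [toTorus]
  · simp [toTorus, h]

/-- The Fourier symbol of `∂ᵢ`. -/
def sym (k : Fin 3 → ℤ) (i : Fin 3) : ℂ := 2 * Real.pi * Complex.I * k i

theorem fderiv_char (k : Fin 3 → ℤ) (i : Fin 3) (y : E3) :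
    fderiv ℝ (char k) y (ee i) = sym k i * char k y := by
  have hd : DifferentiableAt ℝ (char k) y := (contDiff_char k).differentiable (by simp) y
  have h1 : HasDerivAt (fun t : ℝ => char k (y + t • ee i)) (fderiv ℝ (char k) y (ee i)) 0 :=
    hd.hasFDerivAt.hasLineDerivAt (ee i)
  have h2 : ∀ t : ℝ, char k (y + t • ee i) = char k y * Complex.exp (sym k i * (t : ℂ)) := by
    intro t
    rw [char_add_right, char_eq k (t • ee i)]
    congr 2
    rw [Finset.sum_eq_single i]
    · simp [sym, mul_assoc]
    · intro j _ hj; simp [hj]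
    · simp
  have h3 : HasDerivAt (fun t : ℝ => char k (y + t • ee i)) (char k y * (1 * (sym k i * 1))) 0 := by
    simp_rw [h2]
    have h4 : HasDerivAt (fun t : ℝ => sym k i * (t : ℂ)) (sym k i * 1) 0 :=
      (HasDerivAt.ofReal_comp (hasDerivAt_id (0 : ℝ))).const_mul _
    have h5 := h4.cexp.const_mul (char k y)
    simpa using h5
  rw [h1.unique h3]; ring

theorem integral_pd_mul_char {φ : E3 → ℝ} (hφ : IsPeriodicSmooth φ) (k : Fin 3 → ℤ) (i : Fin 3) :
    ∫ y, (pd i φ y : ℂ) * char k y ∂muY = -(sym k i * ∫ y, (φ y : ℂ) * char k y ∂muY) := by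
  have hφC : ContDiff ℝ ∞ fun y => (φ y : ℂ) := Complex.ofRealCLM.contDiff.comp hφ.1
  have h := integral_fderiv_eq_zero (G := fun y => (φ y : ℂ) * char k y)
    ((hφC.mul (contDiff_char k)).of_le (by simp)) i
    (fun y => by rw [hφ.2 i, char_add_single])
  have h2 : ∀ y, fderiv ℝ (fun y => (φ y : ℂ) * char k y) y (ee i) =
      (pd i φ y : ℂ) * char k y + sym k i * ((φ y : ℂ) * char k y) := by
    intro y
    have hd1 : HasFDerivAt (fun y => (φ y : ℂ)) (Complex.ofRealCLM.comp (fderiv ℝ φ y)) y :=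
      Complex.ofRealCLM.hasFDerivAt.comp y (hφ.differentiable y).hasFDerivAt
    have hd2 := ((contDiff_char k).differentiable (by simp) y).hasFDerivAt
    have := (hd1.mul hd2).fderiv
    erw [this]
    simp [fderiv_char, pd]
    ring
  simp_rw [h2] at h
  rw [integral_add, integral_const_mul] at h
  · exact eq_neg_of_add_eq_zero_left h
  · exact integrable_of_continuous ((hφ.pd i).ofReal_continuous.mul (continuous_char k))
  · exact (integrable_of_continuous (hφ.ofReal_continuous.mul (continuous_char k))).const_mul _

theorem isPeriodicSmooth_re_char (k : Fin 3 → ℤ) : IsPeriodicSmooth fun y => (char k y).re :=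
  ⟨Complex.reCLM.contDiff.comp (contDiff_char k), fun i y => by simp only [char_add_single]⟩

theorem isPeriodicSmooth_im_char (k : Fin 3 → ℤ) : IsPeriodicSmooth fun y => (char k y).im :=
  ⟨Complex.imCLM.contDiff.comp (contDiff_char k), fun i y => by simp only [char_add_single]⟩

theorem pd_re_char (k : Fin 3 → ℤ) (i : Fin 3) (y : E3) :
    pd i (fun y => (char k y).re) y = (sym k i * char k y).re := by
  have hd := ((contDiff_char k).differentiable (by simp) y).hasFDerivAt
  have := (Complex.reCLM.hasFDerivAt.comp y hd).fderiv
  unfold pd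
  rw [← fderiv_char]
  erw [this]; rfl

theorem pd_im_char (k : Fin 3 → ℤ) (i : Fin 3) (y : E3) :
    pd i (fun y => (char k y).im) y = (sym k i * char k y).im := by
  have hd := ((contDiff_char k).differentiable (by simp) y).hasFDerivAt
  have := (Complex.imCLM.hasFDerivAt.comp y hd).fderiv
  unfold pd
  rw [← fderiv_char]
  erw [this]; rfl

theorem sym_neg (k : Fin 3 → ℤ) (i : Fin 3) : sym (-k) i = -sym k i := by simp [sym]

/-! ### Weak derivatives and Fourier coefficients -/

section

variable {F : Type} [NormedAddCommGroup F] [InnerProductSpace ℂ F] [NormedSpace ℝ F]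
  [IsScalarTower ℝ ℂ F] [FiniteDimensional ℂ F] [CompleteSpace F]

theorem isWeakPartial_iff_complex {i : Fin 3} {u g : L2 F} : IsWeakPartial i u g ↔
    ∀ φ : E3 → ℝ, IsPeriodicSmooth φ →
      ∫ y, (pd i φ y : ℂ) • u y ∂muY = -∫ y, (φ y : ℂ) • g y ∂muY := by
  unfold IsWeakPartial
  have : ∀ (r : ℝ) (x : F), (r : ℂ) • x = r • x := fun r x => by
    rw [← algebraMap_smul ℂ r x]; rfl
  simp_rw [this]

/-- The distributional identity `div h = f`, in terms of Fourier coefficients. -/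
theorem weak_divergence_iff {h : Fin 3 → L2 F} {f : L2 F} :
    (∀ φ : E3 → ℝ, IsPeriodicSmooth φ →
      ∑ i, ∫ y, (pd i φ y : ℂ) • h i y ∂muY = -∫ y, (φ y : ℂ) • f y ∂muY) ↔
    ∀ k, ∑ i, sym k i • fc k (h i) = fc k f := by
  constructor
  · intro h0 k
    -- Test functions are real valued, so `char (-k)` is inserted through its real and imaginary
    -- parts, recombined below as `re + i im`.
    have hre := h0 _ (isPeriodicSmooth_re_char (-k))
    have him := h0 _ (isPeriodicSmooth_im_char (-k))
    have c1 : ∀ (φ ψ : E3 → ℝ) (v : L2 F), Continuous φ → Continuous ψ →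
        ∫ y, ((φ y : ℂ) + Complex.I * (ψ y : ℂ)) • v y ∂muY =
        (∫ y, (φ y : ℂ) • v y ∂muY) + Complex.I • ∫ y, (ψ y : ℂ) • v y ∂muY := by
      intro φ ψ v h1 h2
      rw [← integral_smul, ← integral_add]
      · simp only [add_smul, mul_smul]
      · exact integrable_smul (Complex.continuous_ofReal.comp h1) v
      · exact (integrable_smul (Complex.continuous_ofReal.comp h2) v).smul Complex.I
    have c2 : ∀ z : ℂ, (z.re : ℂ) + Complex.I * (z.im : ℂ) = z := fun z => by
      rw [mul_comm]; exact Complex.re_add_im z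
    have hu := fun i => c1 _ _ (h i) ((isPeriodicSmooth_re_char (-k)).pd i).continuous
      ((isPeriodicSmooth_im_char (-k)).pd i).continuous
    have hg := c1 _ _ f (isPeriodicSmooth_re_char (-k)).continuous
      (isPeriodicSmooth_im_char (-k)).continuous
    have hs := Finset.sum_congr (rfl : (Finset.univ : Finset (Fin 3)) = _) fun i _ => hu i
    rw [Finset.sum_add_distrib, ← Finset.smul_sum, hre, him] at hs
    simp only [pd_re_char, pd_im_char, c2] at hs hg
    have h3 : ∀ i, ∫ y, (sym (-k) i * char (-k) y) • h i y ∂muY = -(sym k i • fc k (h i)) := by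
      intro i
      rw [fc_eq_integral, ← integral_smul, ← integral_neg]
      simp only [mul_smul, sym_neg, neg_smul]
    rw [smul_neg, ← neg_add, ← hg, ← fc_eq_integral, Finset.sum_congr rfl fun i _ => h3 i,
      Finset.sum_neg_distrib, neg_inj] at hs
    exact hs
  · intro h0 φ hφ
    -- Both sides are continuous in the `L²` fields, so each is expanded in its Fourier series and
    -- compared character by character.
    have h1 := hasSum_sum (s := Finset.univ) fun i _ => (hasSum_charField (h i)).mapL
      (integralL (F := F) (fun y => (pd i φ y : ℂ)) (hφ.pd i).ofReal_continuous)
    have h2 := ((hasSum_charField f).mapL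
      (integralL (F := F) (fun y => (φ y : ℂ)) hφ.ofReal_continuous)).neg
    simp only [integralL_apply] at h1
    rw [integralL_apply] at h2
    refine h1.unique (h2.congr_fun ?_)
    intro k
    have h4 : ∀ i, ∫ y, (pd i φ y : ℂ) • (charField k (fc k (h i)) : E3 → F) y ∂muY =
        -((∫ y, (φ y : ℂ) * char k y ∂muY) • (sym k i • fc k (h i))) := by
      intro i
      rw [← integralL_apply _ (hφ.pd i).ofReal_continuous, integralL_charField,
        integral_pd_mul_char hφ, smul_smul, neg_smul, mul_comm]
    rw [integralL_charField, ← h0, Finset.sum_congr rfl fun i _ => h4 i, Finset.sum_neg_distrib,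
      Finset.smul_sum]

theorem isWeakPartial_iff {i : Fin 3} {u g : L2 F} :
    IsWeakPartial i u g ↔ ∀ k, fc k g = sym k i • fc k u := by
  classical
  have h := weak_divergence_iff (h := fun j => if j = i then u else 0) (f := g)
  have h1 : ∀ (φ : E3 → ℂ),  ∫ y, φ y • ((0 : L2 F) : E3 → F) y ∂muY = 0 := by
    intro φ
    refine integral_eq_zero_of_ae ?_
    filter_upwards [Lp.coeFn_zero F 2 muY] with y hy
    rw [hy]; simp
  rw [isWeakPartial_iff_complex]
  have e1 : ∀ φ : E3 → ℝ, ∑ j, ∫ y, (pd j φ y : ℂ) • ((if j = i then u else 0 : L2 F) : E3 → F) y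
      ∂muY = ∫ y, (pd i φ y : ℂ) • u y ∂muY := by
    intro φ
    rw [Finset.sum_eq_single i]
    · simp
    · intro j _ hj; simp only [hj, if_false]; exact h1 _
    · simp
  have e2 : ∀ k, ∑ j, sym k j • fc k (if j = i then u else 0) = sym k i • fc k u := by
    intro k
    rw [Finset.sum_eq_single i]
    · simp
    · intro j _ hj; simp [hj]
    · simp
  simp only [e1, e2] at h
  rw [h]
  exact forall_congr' fun k => eq_comm

theorem IsWeakPartial.unique {i : Fin 3} {u g g' : L2 F} (h : IsWeakPartial i u g)
    (h' : IsWeakPartial i u g') : g = g' := by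
  rw [isWeakPartial_iff] at h h'
  exact fc_ext fun k => by rw [h, h']

theorem IsWeakPartial.wpd_eq {i : Fin 3} {u g : L2 F} (h : IsWeakPartial i u g) : wpd i u = g := by
  have hex : ∃ g, IsWeakPartial i u g := ⟨g, h⟩
  rw [wpd, dif_pos hex]
  exact hex.choose_spec.unique h

theorem MemW12.isWeakPartial {u : L2 F} (h : MemW12 u) (i : Fin 3) :
    IsWeakPartial i u (wpd i u) := by
  obtain ⟨g, hg⟩ := h i
  rwa [hg.wpd_eq]

theorem MemW12.fc_wpd {u : L2 F} (h : MemW12 u) (i : Fin 3) (k : Fin 3 → ℤ) :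
    fc k (wpd i u) = sym k i • fc k u :=
  isWeakPartial_iff.1 (h.isWeakPartial i) k

theorem memW12_of_fc {u : L2 F} {g : Fin 3 → L2 F}
    (h : ∀ i k, fc k (g i) = sym k i • fc k u) : MemW12 u :=
  fun i => ⟨g i, isWeakPartial_iff.2 (h i)⟩

theorem IsWeakPartial.add {i : Fin 3} {u v g h : L2 F} (hu : IsWeakPartial i u g)
    (hv : IsWeakPartial i v h) : IsWeakPartial i (u + v) (g + h) := by
  rw [isWeakPartial_iff] at *
  intro k; rw [map_add, map_add, hu, hv, smul_add]

theorem IsWeakPartial.smul {i : Fin 3} {u g : L2 F} (c : ℂ) (hu : IsWeakPartial i u g) :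
    IsWeakPartial i (c • u) (c • g) := by
  rw [isWeakPartial_iff] at *
  intro k; rw [map_smul, map_smul, hu, smul_comm]

theorem IsWeakPartial.sub {i : Fin 3} {u v g h : L2 F} (hu : IsWeakPartial i u g)
    (hv : IsWeakPartial i v h) : IsWeakPartial i (u - v) (g - h) := by
  rw [isWeakPartial_iff] at *
  intro k; rw [map_sub, map_sub, hu, hv, smul_sub]

theorem MemW12.add {u v : L2 F} (hu : MemW12 u) (hv : MemW12 v) : MemW12 (u + v) :=
  fun i => ⟨_, (hu.isWeakPartial i).add (hv.isWeakPartial i)⟩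

theorem MemW12.sub {u v : L2 F} (hu : MemW12 u) (hv : MemW12 v) : MemW12 (u - v) :=
  fun i => ⟨_, (hu.isWeakPartial i).sub (hv.isWeakPartial i)⟩

end

/-! ### Curl, divergence and potentials in terms of Fourier coefficients -/

theorem fc_compLp {F G : Type} [NormedAddCommGroup F] [InnerProductSpace ℂ F]
    [CompleteSpace F] [FiniteDimensional ℂ F] [NormedAddCommGroup G]
    [InnerProductSpace ℂ G] [CompleteSpace G]
    [FiniteDimensional ℂ G] (L : F →L[ℂ] G) (u : L2 F) (k : Fin 3 → ℤ) :
    fc k (L.compLp u) = L (fc k u) := by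
  rw [fc_eq_integral, fc_eq_integral, ← L.integral_comp_comm (integrable_smul (continuous_char _) u)]
  refine integral_congr_ae ?_
  filter_upwards [L.coeFn_compLp u] with y hy
  rw [hy, map_smul]

theorem fc_zero_eq {F : Type} [NormedAddCommGroup F] [InnerProductSpace ℂ F] [NormedSpace ℝ F]
    [IsScalarTower ℝ ℂ F] [CompleteSpace F] [FiniteDimensional ℂ F] (u : L2 F) :
    fc 0 u = ∫ y, u y ∂muY := by
  rw [fc_eq_integral]; simp [char_zero]

/-- The coordinates on `ℂ³` as continuous linear forms. -/
abbrev prC (i : Fin 3) : C3 →L[ℂ] ℂ := EuclideanSpace.proj i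

/-- The wave vector `2 i π k`. -/
def wave (k : Fin 3 → ℤ) : C3 := WithLp.toLp 2 (sym k)

theorem wave_apply (k : Fin 3 → ℤ) (i : Fin 3) : wave k i = sym k i := rfl

/-- The bilinear dot product on `ℂ³`. -/
def dotC (a b : C3) : ℂ := ∑ i, a i * b i

theorem crossL_apply (a b : C3) : crossL a b = WithLp.toLp 2
    ![a 1 * b 2 - a 2 * b 1, a 2 * b 0 - a 0 * b 2, a 0 * b 1 - a 1 * b 0] := by
  simp [crossL, crossProduct]

theorem crossL_eq_sum (a : C3) : crossL a = ∑ i, a i • crossL (basisC i) := by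
  ext b j
  simp only [Fin.sum_univ_three, _root_.add_apply, _root_.smul_apply, crossL_apply]
  fin_cases j <;> simp [basisC] <;> ring

/-- The sum of the norms of the maps `crossL (basisC i)`. -/
def crossBound : ℝ := ∑ i, ‖crossL (basisC i)‖

theorem norm_crossL_le (a : C3) : ‖crossL a‖ ≤ crossBound * ‖a‖ := by
  rw [crossL_eq_sum, crossBound, Finset.sum_mul]
  refine (norm_sum_le _ _).trans (Finset.sum_le_sum fun i _ => ?_)
  rw [norm_smul, mul_comm]
  gcongr
  exact PiLp.norm_apply_le a i

theorem crossL_crossL (a b : C3) : crossL a (crossL a b) = dotC a b • a - dotC a a • b := by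
  ext j
  simp only [crossL_apply, dotC, Fin.sum_univ_three]
  fin_cases j <;> simp <;> ring

theorem dotC_crossL (a b : C3) : dotC a (crossL a b) = 0 := by
  simp [crossL_apply, dotC, Fin.sum_univ_three]; ring

theorem crossL_self (a : C3) : crossL a a = 0 := by
  ext j
  simp only [crossL_apply]
  fin_cases j <;> simp <;> ring

theorem dotC_smul (a b : C3) (c : ℂ) : dotC a (c • b) = c * dotC a b := by
  simp [dotC, Fin.sum_univ_three]; ring

/-- The Fourier symbol of `-Δ`. -/
def symLap (k : Fin 3 → ℤ) : ℝ := 4 * Real.pi ^ 2 * ∑ i, (k i : ℝ) ^ 2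

theorem sum_sym_sq (k : Fin 3 → ℤ) : ∑ i, sym k i * sym k i = -(symLap k : ℂ) := by
  simp only [sym, symLap, Fin.sum_univ_three]
  push_cast
  linear_combination (4 * (Real.pi : ℂ) ^ 2 * ((k 0 : ℂ) ^ 2 + (k 1 : ℂ) ^ 2 + (k 2 : ℂ) ^ 2)) *
    Complex.I_sq

/-- The dot product is bilinear and the wave vector purely imaginary, hence the minus sign; with
`crossL_crossL` this is `curl curl = ∇ div - Δ` in Fourier variables. -/
theorem dotC_wave (k : Fin 3 → ℤ) : dotC (wave k) (wave k) = -(symLap k : ℂ) := sum_sym_sq k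

theorem norm_wave_sq (k : Fin 3 → ℤ) : ‖wave k‖ ^ 2 = symLap k := by
  rw [EuclideanSpace.norm_sq_eq, symLap, Finset.mul_sum]
  refine Finset.sum_congr rfl fun i _ => ?_
  rw [wave_apply, sym]
  simp only [norm_mul, Complex.norm_I, Complex.norm_real, Complex.norm_intCast, Complex.norm_ofNat,
    Real.norm_eq_abs, mul_pow, sq_abs]
  norm_num

theorem norm_sym_le (k : Fin 3 → ℤ) (i : Fin 3) : ‖sym k i‖ ≤ ‖wave k‖ :=
  PiLp.norm_apply_le (wave k) i

theorem one_le_symLap {k : Fin 3 → ℤ} (hk : k ≠ 0) : 1 ≤ symLap k := by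
  obtain ⟨j, hj⟩ := Function.ne_iff.1 hk
  have h1 : (1 : ℝ) ≤ (k j : ℝ) ^ 2 := by
    have : (1 : ℤ) ≤ k j ^ 2 := by
      have := sq_pos_of_ne_zero (a := k j) (by simpa using hj)
      omega
    exact_mod_cast this
  have h2 : (k j : ℝ) ^ 2 ≤ ∑ i, (k i : ℝ) ^ 2 :=
    Finset.single_le_sum (f := fun i => (k i : ℝ) ^ 2) (fun i _ => sq_nonneg _) (Finset.mem_univ j)
  have h3 := Real.pi_gt_three
  have h4 : (1 : ℝ) ≤ 4 * Real.pi ^ 2 := by nlinarith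
  unfold symLap
  nlinarith

theorem symLap_ne_zero {k : Fin 3 → ℤ} (hk : k ≠ 0) : (symLap k : ℂ) ≠ 0 := by
  have := one_le_symLap hk
  exact_mod_cast (by linarith : symLap k ≠ 0)

theorem symLap_zero : symLap 0 = 0 := by simp [symLap]

theorem wave_zero : wave 0 = 0 := by ext i; simp [wave, sym]

theorem sym_zero (i : Fin 3) : sym 0 i = 0 := by simp [sym]

theorem MemW12.fc_curl {u : L2 C3} (h : MemW12 u) (k : Fin 3 → ℤ) :
    fc k (curl u) = crossL (wave k) (fc k u) := by
  rw [curl, map_sum, crossL_eq_sum, _root_.sum_apply]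
  refine Finset.sum_congr rfl fun i _ => ?_
  rw [fc_compLp, h.fc_wpd, map_smul]
  rfl

theorem coeFn_sum {F : Type} [NormedAddCommGroup F] (u : Fin 3 → L2 F) :
    ((∑ i, u i : L2 F) : E3 → F) =ᵐ[muY] fun y => ∑ i, u i y := by
  simp only [Fin.sum_univ_three]
  filter_upwards [Lp.coeFn_add (u 0 + u 1) (u 2), Lp.coeFn_add (u 0) (u 1)] with y h1 h2
  rw [h1, Pi.add_apply, h2, Pi.add_apply]

theorem MemW12.dvg_eq_zero_iff {u : L2 C3} (h : MemW12 u) :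
    (∀ᵐ y ∂muY, dvg u y = 0) ↔ ∀ k, dotC (wave k) (fc k u) = 0 := by
  set D : L2 ℂ := ∑ i, (prC i).compLp (wpd i u) with hD
  have h1 : (D : E3 → ℂ) =ᵐ[muY] dvg u := by
    have h2 : ∀ᵐ y ∂muY, ∀ i, ((prC i).compLp (wpd i u) : E3 → ℂ) y = wpd i u y i :=
      ae_all_iff.2 fun i => (prC i).coeFn_compLp _
    filter_upwards [coeFn_sum fun i => (prC i).compLp (wpd i u), h2] with y h3 h4
    rw [h3, dvg]
    exact Finset.sum_congr rfl fun i _ => h4 i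
  have h2 : ∀ k, fc k D = dotC (wave k) (fc k u) := by
    intro k
    rw [hD, map_sum, dotC]
    refine Finset.sum_congr rfl fun i _ => ?_
    rw [fc_compLp, h.fc_wpd]
    simp [wave_apply]
  simp_rw [← h2]
  constructor
  · intro h3 k
    have : D = 0 := by
      refine Lp.ext ?_
      filter_upwards [h1, h3, Lp.coeFn_zero ℂ 2 muY] with y h4 h5 h6
      rw [h4, h5, h6]; rfl
    rw [this, map_zero]
  · intro h3
    have : D = 0 := fc_ext fun k => by rw [h3, map_zero]
    filter_upwards [h1, Lp.coeFn_zero ℂ 2 muY] with y h4 h6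
    rw [← h4, this, h6]; rfl

theorem isDivFree_iff {f : L2 C3} :
    (∀ φ : E3 → ℝ, IsPeriodicSmooth φ → ∫ y, ∑ i, (pd i φ y : ℂ) * f y i ∂muY = 0) ↔
    ∀ k, dotC (wave k) (fc k f) = 0 := by
  have h := weak_divergence_iff (h := fun i => (prC i).compLp f) (f := 0)
  have hc : ∀ i, ∀ᵐ y ∂muY, ((prC i).compLp f : E3 → ℂ) y = f y i :=
    fun i => (prC i).coeFn_compLp _
  have e0 : ∀ φ : E3 → ℝ, IsPeriodicSmooth φ → ∀ i,
      Integrable (fun y => (pd i φ y : ℂ) * f y i) muY := by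
    intro φ hφ i
    refine (integrable_smul (hφ.pd i).ofReal_continuous ((prC i).compLp f)).congr ?_
    filter_upwards [hc i] with y hy
    rw [hy, smul_eq_mul]
  have e1 : ∀ φ : E3 → ℝ, IsPeriodicSmooth φ →
      ∑ i, ∫ y, (pd i φ y : ℂ) • ((prC i).compLp f : E3 → ℂ) y ∂muY =
      ∫ y, ∑ i, (pd i φ y : ℂ) * f y i ∂muY := by
    intro φ hφ
    rw [integral_finsetSum _ fun i _ => e0 φ hφ i]
    refine Finset.sum_congr rfl fun i _ => integral_congr_ae ?_
    filter_upwards [hc i] with y hy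
    rw [hy, smul_eq_mul]
  have e2 : ∀ φ : E3 → ℝ, ∫ y, (φ y : ℂ) • ((0 : L2 ℂ) : E3 → ℂ) y ∂muY = 0 := by
    intro φ
    refine integral_eq_zero_of_ae ?_
    filter_upwards [Lp.coeFn_zero ℂ 2 muY] with y hy
    rw [hy]; simp
  have e3 : ∀ k, ∑ i, sym k i • fc k ((prC i).compLp f) = dotC (wave k) (fc k f) := by
    intro k
    simp only [fc_compLp]; rfl
  simp only [e2, e3, map_zero, neg_zero] at h
  rw [← h]
  exact forall₂_congr fun φ hφ => by rw [e1 φ hφ]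

theorem constField_eq (c : C3) : constField c = charField 0 c := by
  refine Lp.ext ?_
  filter_upwards [coeFn_charField 0 c, Lp.coeFn_const (μ := muY) (p := 2) c] with y h1 h2
  rw [h1, char_zero, one_smul]
  exact h2

theorem fc_constField (k : Fin 3 → ℤ) (c : C3) : fc k (constField c) = if k = 0 then c else 0 := by
  rw [constField_eq, fc_charField]

theorem isWeakPartial_constField (i : Fin 3) (c : C3) : IsWeakPartial i (constField c) 0 := by
  rw [isWeakPartial_iff]
  intro k
  rw [fc_constField, map_zero]
  split_ifs with h
  · rw [h, sym_zero, zero_smul]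
  · rw [smul_zero]

theorem isPotential_iff {f ψ : L2 C3} : IsPotential f ψ ↔
    MemW12 ψ ∧ fc 0 ψ = 0 ∧ ∀ k, (symLap k : ℂ) • fc k ψ = fc k f := by
  unfold IsPotential
  refine and_congr_right fun hψ => ?_
  rw [fc_zero_eq]
  refine and_congr_right fun _ => ?_
  have h := weak_divergence_iff (h := fun i => wpd i ψ) (f := -f)
  have r : ∀ (r : ℝ) (x : C3), (r : ℂ) • x = r • x := fun r x => by
    rw [← algebraMap_smul ℂ r x]; rfl
  have e1 : ∀ φ : E3 → ℝ, IsPeriodicSmooth φ →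
      ∑ i, ∫ y, (pd i φ y : ℂ) • wpd i ψ y ∂muY = ∫ y, ∑ i, pd i φ y • wpd i ψ y ∂muY := by
    intro φ hφ
    rw [← integral_finsetSum _ fun i _ => integrable_smul (hφ.pd i).ofReal_continuous (wpd i ψ)]
    simp only [r]
  have e2 : ∀ φ : E3 → ℝ,
      -∫ y, (φ y : ℂ) • ((-f : L2 C3) : E3 → C3) y ∂muY = ∫ y, φ y • f y ∂muY := by
    intro φ
    rw [← integral_neg]
    refine integral_congr_ae ?_
    filter_upwards [Lp.coeFn_neg f] with y hy
    rw [hy, Pi.neg_apply, smul_neg, neg_neg, r]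
  have e3 : ∀ k, ∑ i, sym k i • fc k (wpd i ψ) = -((symLap k : ℂ) • fc k ψ) := by
    intro k
    simp only [hψ.fc_wpd, smul_smul]
    rw [← Finset.sum_smul, sum_sym_sq, neg_smul]
  simp only [e3, map_neg, neg_inj] at h
  rw [← h]
  exact forall₂_congr fun φ hφ => by rw [e1 φ hφ, e2]

/-- The symbols `|2πk|⁻²` and `2iπkᵢ|2πk|⁻²` are bounded by `1` because `|2πk|² ≥ 1` for `k ≠ 0`. At
`k = 0` the inverse is `0` by convention; this gives the zero mean of `ψ` and is compatible with the
equation since `f` has zero mean. -/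
theorem exists_isPotential {f : L2 C3} (hf : fc 0 f = 0) : ∃ ψ, IsPotential f ψ := by
  have hb : ∀ k, |symLap k|⁻¹ ≤ 1 := by
    intro k
    by_cases hk : k = 0
    · simp [hk, symLap_zero]
    · exact inv_le_one_of_one_le₀ ((one_le_symLap hk).trans (le_abs_self _))
  have hw : ∀ k i, ‖sym k i‖ * |symLap k|⁻¹ ≤ 1 := by
    intro k i
    by_cases hk : k = 0
    · simp [hk, symLap_zero]
    · have h1 := one_le_symLap hk
      rw [abs_of_nonneg (by linarith), ← div_eq_mul_inv, div_le_one (by linarith)]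
      refine (norm_sym_le k i).trans ?_
      rw [← norm_wave_sq] at h1 ⊢
      nlinarith [norm_nonneg (wave k)]
  have hn : ∀ k, ‖(symLap k : ℂ)⁻¹ • ContinuousLinearMap.id ℂ C3‖ ≤ 1 := by
    intro k
    rw [norm_smul, norm_inv, Complex.norm_real, Real.norm_eq_abs]
    exact mul_le_one₀ (hb k) (norm_nonneg _) ContinuousLinearMap.norm_id_le
  obtain ⟨T, hT⟩ := exists_multiplier (F := C3) (G := C3)
    (fun k => (symLap k : ℂ)⁻¹ • ContinuousLinearMap.id ℂ C3) hn
  have hn' : ∀ i k, ‖sym k i • (symLap k : ℂ)⁻¹ • ContinuousLinearMap.id ℂ C3‖ ≤ 1 := by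
    intro i k
    rw [norm_smul, norm_smul, norm_inv, Complex.norm_real, Real.norm_eq_abs, ← mul_assoc]
    exact mul_le_one₀ (hw k i) (norm_nonneg _) ContinuousLinearMap.norm_id_le
  choose D hD using fun i => exists_multiplier (F := C3) (G := C3)
    (fun k => sym k i • (symLap k : ℂ)⁻¹ • ContinuousLinearMap.id ℂ C3) (hn' i)
  refine ⟨T f, isPotential_iff.2 ⟨memW12_of_fc (g := fun i => D i f) fun i k => ?_, ?_, ?_⟩⟩
  · simp [hT, hD]
  · simp [hT, hf]
  · intro k
    by_cases hk : k = 0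
    · simp [hk, hT, hf]
    · simp [hT, smul_smul, symLap_ne_zero hk]

theorem isPotential_potential {f : L2 C3} (hf : fc 0 f = 0) : IsPotential f (potential f) := by
  have h := exists_isPotential hf
  rw [potential, dif_pos h]
  exact h.choose_spec

/-! ### The operator `Γ` -/

/-- The symbol has order `-1`, so it stays bounded after one differentiation. The operators `D i`
make `f ↦ curl ψ_f` continuous into `W^{1,2}`, which is used for the convergence of the derivative
series. -/
theorem exists_biotSavart : ∃ (T : L2 C3 →L[ℂ] L2 C3) (D : Fin 3 → L2 C3 →L[ℂ] L2 C3),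
    (∀ f k, fc k (T f) = (symLap k : ℂ)⁻¹ • crossL (wave k) (fc k f)) ∧
    ∀ i f, IsWeakPartial i (T f) (D i f) := by
  have hc : 0 ≤ crossBound := Finset.sum_nonneg fun i _ => norm_nonneg _
  have hb : ∀ k, ‖(symLap k : ℂ)⁻¹ • crossL (wave k)‖ ≤ crossBound := by
    intro k
    rw [norm_smul, norm_inv, Complex.norm_real, Real.norm_eq_abs]
    by_cases hk : k = 0
    · simpa [hk, symLap_zero] using hc
    · have h1 := one_le_symLap hk
      rw [abs_of_nonneg (by linarith), inv_mul_le_iff₀ (by linarith)]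
      refine (norm_crossL_le _).trans ?_
      rw [mul_comm]
      gcongr
      rw [← norm_wave_sq] at h1 ⊢
      nlinarith [norm_nonneg (wave k)]
  have hb' : ∀ i k, ‖sym k i • (symLap k : ℂ)⁻¹ • crossL (wave k)‖ ≤ crossBound := by
    intro i k
    rw [norm_smul, norm_smul, norm_inv, Complex.norm_real, Real.norm_eq_abs]
    by_cases hk : k = 0
    · simpa [hk, symLap_zero] using hc
    · have h1 := one_le_symLap hk
      rw [abs_of_nonneg (by linarith), ← mul_assoc, mul_comm ‖sym k i‖, mul_assoc,
        inv_mul_le_iff₀ (by linarith)]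
      calc ‖sym k i‖ * ‖crossL (wave k)‖ ≤ ‖wave k‖ * (crossBound * ‖wave k‖) := by
            gcongr
            · exact norm_sym_le k i
            · exact norm_crossL_le _
        _ = symLap k * crossBound := by rw [← norm_wave_sq]; ring
  obtain ⟨T, hT⟩ := exists_multiplier (F := C3) (G := C3) _ hb
  choose D hD using fun i => exists_multiplier (F := C3) (G := C3) _ (hb' i)
  refine ⟨T, D, fun f k => by rw [hT]; rfl, fun i f => isWeakPartial_iff.2 fun k => ?_⟩
  rw [hD, hT]; rfl

/-- The solution operator `f ↦ curl ψ_f`. -/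
def biotSavart : L2 C3 →L[ℂ] L2 C3 := exists_biotSavart.choose

/-- The partial derivatives of `biotSavart`. -/
def biotSavartD : Fin 3 → L2 C3 →L[ℂ] L2 C3 := exists_biotSavart.choose_spec.choose

theorem fc_biotSavart (f : L2 C3) (k : Fin 3 → ℤ) :
    fc k (biotSavart f) = (symLap k : ℂ)⁻¹ • crossL (wave k) (fc k f) :=
  exists_biotSavart.choose_spec.choose_spec.1 f k

theorem isWeakPartial_biotSavart (i : Fin 3) (f : L2 C3) :
    IsWeakPartial i (biotSavart f) (biotSavartD i f) :=
  exists_biotSavart.choose_spec.choose_spec.2 i f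

theorem continuous_coord (i : Fin 3) : Continuous fun y : E3 => ((y i : ℝ) : ℂ) :=
  Complex.continuous_ofReal.comp (by fun_prop)

/-- The moment `∫_Y y ∧ f`, as a continuous linear map. -/
def momentL : L2 C3 →L[ℂ] C3 :=
  ∑ i, (crossL (basisC i)) ∘L (integralL (fun y : E3 => ((y i : ℝ) : ℂ)) (continuous_coord i))

theorem crossL_toC3 (y : E3) (v : C3) :
    crossL (toC3 y) v = ∑ i, crossL (basisC i) (((y i : ℝ) : ℂ) • v) := by
  rw [crossL_eq_sum, _root_.sum_apply]
  refine Finset.sum_congr rfl fun i _ => ?_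
  rw [map_smul]; rfl

theorem momentL_apply (f : L2 C3) : momentL f = ∫ y, crossL (toC3 y) (f y) ∂muY := by
  simp_rw [crossL_toC3]
  rw [integral_finsetSum]
  · rw [momentL, _root_.sum_apply]
    refine Finset.sum_congr rfl fun i _ => ?_
    rw [ContinuousLinearMap.integral_comp_comm _ (integrable_smul (continuous_coord i) f)]
    rfl
  · intro i _
    exact (crossL (basisC i)).integrable_comp (integrable_smul (continuous_coord i) f)

theorem setIntegral_eq_muY {S : Set E3} (hS : S ⊆ cellY) (hm : MeasurableSet S) {V : Type}
    [NormedAddCommGroup V] [NormedSpace ℝ V] {g : E3 → V}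
    (hg : ∀ᵐ y ∂volume.restrict (cellY \ S), g y = 0) : ∫ y in S, g y = ∫ y, g y ∂muY := by
  rw [muY]
  have h1 : volume.restrict S = (volume.restrict cellY).restrict S := by
    rw [Measure.restrict_restrict hm, Set.inter_eq_left.2 hS]
  rw [h1]
  refine setIntegral_eq_integral_of_ae_compl_eq_zero ?_
  rw [ae_restrict_iff' (measurableSet_cellY.diff hm)] at hg
  rw [ae_restrict_iff' measurableSet_cellY]
  filter_upwards [hg] with y h2 h3 h4 using h2 ⟨h3, h4⟩

theorem moment_eq {S : Set E3} (hS : S ⊆ cellY) (hm : MeasurableSet S) {f : L2 C3}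
    (hf : ∀ᵐ y ∂volume.restrict (cellY \ S), f y = 0) : moment S f = momentL f := by
  rw [momentL_apply, moment]
  exact setIntegral_eq_muY hS hm (hf.mono fun y hy => by rw [hy, map_zero])

/-- The operator `f ↦ curl ψ_f + (1/2) ∫_Y y ∧ f`. -/
def GamL : L2 C3 →L[ℂ] L2 C3 :=
  biotSavart + (charField (F := C3) 0).toContinuousLinearMap ∘L ((1 / 2 : ℂ) • momentL)

theorem GamL_apply (f : L2 C3) :
    GamL f = biotSavart f + constField ((1 / 2 : ℂ) • momentL f) := by
  rw [constField_eq]; rfl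

theorem isWeakPartial_GamL (i : Fin 3) (f : L2 C3) :
    IsWeakPartial i (GamL f) (biotSavartD i f) := by
  rw [GamL_apply, ← add_zero (biotSavartD i f)]
  exact (isWeakPartial_biotSavart i f).add (isWeakPartial_constField i _)

theorem memW12_GamL (f : L2 C3) : MemW12 (GamL f) := fun i => ⟨_, isWeakPartial_GamL i f⟩

theorem fc_zero_GamL (f : L2 C3) : fc 0 (GamL f) = (1 / 2 : ℂ) • momentL f := by
  rw [GamL_apply, map_add, fc_biotSavart, fc_constField]
  simp [symLap_zero]

theorem fc_GamL_of_ne (f : L2 C3) {k : Fin 3 → ℤ} (hk : k ≠ 0) :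
    fc k (GamL f) = (symLap k : ℂ)⁻¹ • crossL (wave k) (fc k f) := by
  rw [GamL_apply, map_add, fc_biotSavart, fc_constField, if_neg hk, add_zero]

theorem curl_potential {f : L2 C3} (hf : fc 0 f = 0) : curl (potential f) = biotSavart f := by
  have h := isPotential_iff.1 (isPotential_potential hf)
  refine fc_ext fun k => ?_
  rw [h.1.fc_curl, fc_biotSavart, ← map_smul]
  congr 1
  by_cases hk : k = 0
  · rw [hk, h.2.1, hf, smul_zero]
  · rw [← h.2.2 k, smul_smul, inv_mul_cancel₀ (symLap_ne_zero hk), one_smul]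

theorem Gam_eq {S : Set E3} (hS : S ⊆ cellY) (hm : MeasurableSet S) {f : L2 C3}
    (hf : ∀ᵐ y ∂volume.restrict (cellY \ S), f y = 0) (h0 : fc 0 f = 0) :
    Gam S f = GamL f := by
  rw [Gam, curl_potential h0, moment_eq hS hm hf, GamL_apply]

/-- For `k ≠ 0` the double cross product with the wave vector is multiplication by `|2πk|²` on
coefficients orthogonal to it; the mode `k = 0` is lost, hence the zero mean hypothesis. -/
theorem curl_GamL {f : L2 C3} (h0 : fc 0 f = 0) (hd : ∀ k, dotC (wave k) (fc k f) = 0) :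
    curl (GamL f) = f := by
  refine fc_ext fun k => ?_
  rw [(memW12_GamL f).fc_curl]
  by_cases hk : k = 0
  · rw [hk, wave_zero, h0, crossL_eq_sum]; simp
  · rw [fc_GamL_of_ne f hk, map_smul, crossL_crossL, hd, dotC_wave, zero_smul, zero_sub, neg_smul,
      neg_neg, smul_smul, inv_mul_cancel₀ (symLap_ne_zero hk), one_smul]

theorem dvg_GamL (f : L2 C3) : ∀ᵐ y ∂muY, dvg (GamL f) y = 0 := by
  rw [(memW12_GamL f).dvg_eq_zero_iff]
  intro k
  by_cases hk : k = 0
  · rw [hk, wave_zero]; simp [dotC]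
  · rw [fc_GamL_of_ne f hk, dotC_smul, dotC_crossL, mul_zero]

/-- A curl-free and divergence-free periodic field is constant. -/
theorem eq_constField_of_curl_of_dvg {v : L2 C3}
    (hc : ∀ k, crossL (wave k) (fc k v) = 0) (hd : ∀ k, dotC (wave k) (fc k v) = 0) :
    v = constField (fc 0 v) := by
  refine fc_ext fun k => ?_
  rw [fc_constField]
  split_ifs with hk
  · rw [hk]
  · have h := crossL_crossL (wave k) (fc k v)
    rw [hc, hd, dotC_wave, map_zero, zero_smul, zero_sub, neg_smul, neg_neg] at h
    exact (smul_eq_zero.1 h.symm).resolve_left (symLap_ne_zero hk)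

/-- A curl-free periodic field is the sum of its mean and of a gradient. -/
theorem exists_gradient_of_curl_free {v : L2 C3} (hc : ∀ k, crossL (wave k) (fc k v) = 0) :
    ∃ ψ : L2 ℂ, MemW12 ψ ∧ ∀ᵐ y ∂muY, ∀ j, v y j = wpd j ψ y + fc 0 v j := by
  -- Symbol of `Δ⁻¹ div`. If `κ × v̂ = 0` for the wave vector `κ`, the double cross product identity
  -- gives `v̂ = -|2πk|⁻² (κ · v̂) κ`.
  let m : (Fin 3 → ℤ) → C3 →L[ℂ] ℂ := fun k => (-(symLap k : ℂ)⁻¹) • ∑ i, sym k i • prC i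
  have hm : ∀ k v, m k v = -(symLap k : ℂ)⁻¹ * dotC (wave k) v := by
    intro k v
    simp only [m, _root_.smul_apply, _root_.sum_apply]
    rfl
  have hb : ∀ k, ‖m k‖ ≤ ∑ i, ‖prC i‖ := by
    intro k
    rw [norm_smul, norm_neg, norm_inv, Complex.norm_real, Real.norm_eq_abs]
    by_cases hk : k = 0
    · rw [hk, symLap_zero, abs_zero, inv_zero, zero_mul]
      exact Finset.sum_nonneg fun i _ => norm_nonneg _
    · have h1 := one_le_symLap hk
      rw [abs_of_nonneg (by linarith), inv_mul_le_iff₀ (by linarith), Finset.mul_sum]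
      refine (norm_sum_le _ _).trans (Finset.sum_le_sum fun i _ => ?_)
      rw [norm_smul]
      gcongr
      refine (norm_sym_le k i).trans ?_
      rw [← norm_wave_sq] at h1 ⊢
      nlinarith [norm_nonneg (wave k)]
  obtain ⟨T, hT⟩ := exists_multiplier (F := C3) (G := ℂ) m hb
  have hD : ∀ i, IsWeakPartial i (T v) ((prC i).compLp (v - constField (fc 0 v))) := by
    intro i
    rw [isWeakPartial_iff]
    intro k
    rw [fc_compLp, map_sub, fc_constField]
    split_ifs with hk
    · rw [hk, sub_self, map_zero, sym_zero, zero_smul]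
    · have h := crossL_crossL (wave k) (fc k v)
      rw [hc, dotC_wave, map_zero, neg_smul, sub_neg_eq_add] at h
      have h2 := congrArg (fun x : C3 => x i) h
      simp only [PiLp.add_apply, PiLp.smul_apply, PiLp.zero_apply, wave_apply, smul_eq_mul] at h2
      rw [sub_zero, hT, hm, smul_eq_mul]
      change fc k v i = _
      field_simp [symLap_ne_zero hk]
      linear_combination -h2
  refine ⟨T v, fun i => ⟨_, hD i⟩, ?_⟩
  have h1 : ∀ᵐ y ∂muY, ∀ i, wpd i (T v) y = (v - constField (fc 0 v) : L2 C3) y i := by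
    refine ae_all_iff.2 fun i => ?_
    rw [(hD i).wpd_eq]
    exact (prC i).coeFn_compLp _
  filter_upwards [h1, Lp.coeFn_sub v (constField (fc 0 v)),
    Lp.coeFn_const (μ := muY) (p := 2) (fc 0 v)] with y h2 h3 h4 j
  rw [h2, h3, Pi.sub_apply]
  erw [h4]
  simp

/-! ### Periodization of functions supported in the cell -/

theorem toTorus_sub (x y : E3) : toTorus (x - y) = toTorus x - toTorus y := by
  funext i; simp [toTorus]

theorem continuous_toTorus : Continuous toTorus := by
  refine continuous_pi fun i => ?_
  exact (AddCircle.continuous_mk' 1).comp (by fun_prop)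

theorem toTorus_ofTorus (x : UnitAddTorus (Fin 3)) : toTorus (ofTorus x) = x :=
  (UnitAddTorus.measurableEquivPiIoc (fun _ : Fin 3 => -(1 / 2 : ℝ))).symm_apply_apply x

theorem toTorus_add_single (y : E3) (i : Fin 3) : toTorus (y + ee i) = toTorus y := by
  funext j
  by_cases h : j = i
  · subst h; simp [toTorus]
  · simp [toTorus, h]

theorem isCompact_of_subset_cellY {K : Set E3} (hK : IsClosed K) (h : K ⊆ cellY) : IsCompact K :=
  Metric.isCompact_of_isClosed_isBounded hK (isBounded_cellY.subset h)

/-- The periodic extension of the restriction of `η` to the half-open cell. -/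
def periodize {V : Type} (η : E3 → V) (y : E3) : V := η (ofTorus (toTorus y))

theorem periodize_eq {V : Type} (η : E3 → V) {y : E3} (hy : y ∈ cellY) :
    periodize η y = η y := by rw [periodize, ofTorus_toTorus hy]

theorem periodize_add_single {V : Type} (η : E3 → V) (i : Fin 3) (y : E3) :
    periodize η (y + ee i) = periodize η y := by rw [periodize, periodize, toTorus_add_single]

/-- Near a point congruent to some `w` in the support, the periodization is the translate of `η` by
`y - w`, a vector of `ℤ³`. Elsewhere it vanishes locally, since the image of the support in the
torus is compact, hence closed. -/
theorem contDiff_periodize {V : Type} [NormedAddCommGroup V] [NormedSpace ℝ V] {n : WithTop ℕ∞}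
    {η : E3 → V} (hη : ContDiff ℝ n η) (hs : tsupport η ⊆ cellY) :
    ContDiff ℝ n (periodize η) := by
  have hK := isCompact_of_subset_cellY (isClosed_tsupport η) hs
  rw [contDiff_iff_contDiffAt]
  intro y
  by_cases hy : toTorus y ∈ toTorus '' tsupport η
  · obtain ⟨w, hw, hwy⟩ := hy
    have h1 : periodize η =ᶠ[𝓝 y] fun y' => η (y' - (y - w)) := by
      have h2 : ∀ᶠ y' in 𝓝 y, y' - (y - w) ∈ cellY := by
        refine (ContinuousAt.eventually_mem (f := fun y' => y' - (y - w)) (by fun_prop)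
          (isOpen_cellY.mem_nhds ?_))
        rw [sub_sub_cancel]; exact hs hw
      filter_upwards [h2] with y' h3
      rw [← periodize_eq η h3, periodize, periodize, toTorus_sub, toTorus_sub, hwy, sub_self,
        sub_zero]
    refine ContDiffAt.congr_of_eventuallyEq ?_ h1
    exact (hη.comp (contDiff_id.sub contDiff_const)).contDiffAt
  · have h1 : periodize η =ᶠ[𝓝 y] fun _ => 0 := by
      have h2 : ∀ᶠ y' in 𝓝 y, toTorus y' ∉ toTorus '' tsupport η :=
        continuous_toTorus.continuousAt.eventually_mem
          ((hK.image continuous_toTorus).isClosed.isOpen_compl.mem_nhds hy)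
      filter_upwards [h2] with y' h3
      by_contra h4
      exact h3 ⟨_, subset_tsupport _ h4, toTorus_ofTorus _⟩
    exact contDiffAt_const.congr_of_eventuallyEq h1

theorem isPeriodicSmooth_periodize {η : E3 → ℝ} (hη : ContDiff ℝ ∞ η) (hs : tsupport η ⊆ cellY) :
    IsPeriodicSmooth (periodize η) :=
  ⟨contDiff_periodize hη hs, periodize_add_single η⟩

theorem fderiv_periodize {V : Type} [NormedAddCommGroup V] [NormedSpace ℝ V] (η : E3 → V) {y : E3}
    (hy : y ∈ cellY) : fderiv ℝ (periodize η) y = fderiv ℝ η y :=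
  Filter.EventuallyEq.fderiv_eq <|
    (isOpen_cellY.eventually_mem hy).mono fun _ hz => periodize_eq η hz

theorem pd_periodize (η : E3 → ℝ) {y : E3} (hy : y ∈ cellY) (i : Fin 3) :
    pd i (periodize η) y = pd i η y := by rw [pd, pd, fderiv_periodize η hy]

theorem integral_fderiv_eq_zero_of_tsupport {V : Type} [NormedAddCommGroup V] [NormedSpace ℝ V]
    [CompleteSpace V] {G : E3 → V} (hG : ContDiff ℝ 1 G) (hs : tsupport G ⊆ cellY) (i : Fin 3) :
    ∫ y, fderiv ℝ G y (ee i) ∂muY = 0 := by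
  rw [← integral_fderiv_eq_zero (contDiff_periodize hG hs) i (periodize_add_single G i)]
  refine integral_congr_ae ?_
  filter_upwards [ae_muY_mem] with y hy
  rw [fderiv_periodize G hy]

/-- A smooth cutoff function between a compact set and an open neighbourhood of it. -/
theorem exists_cutoff {K W : Set E3} (hK : IsCompact K) (hW : IsOpen W) (h : K ⊆ W) :
    ∃ χ : E3 → ℝ, ContDiff ℝ ∞ χ ∧ tsupport χ ⊆ W ∧ HasCompactSupport χ ∧
      ∃ V, IsOpen V ∧ K ⊆ V ∧ ∀ y ∈ V, χ y = 1 := by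
  obtain ⟨K', hK', hKK', hK'W⟩ := exists_compact_between hK hW h
  obtain ⟨K'', hK'', hKK'', hK''W⟩ := exists_compact_between hK' hW hK'W
  obtain ⟨χ, h1, -, h3⟩ := exists_contMDiff_support_eq_eq_one_iff (modelWithCornersSelf ℝ E3)
    (n := ⊤) (isOpen_interior (s := K'')) hK'.isClosed hKK''
  have h4 : tsupport χ ⊆ K'' := by
    rw [tsupport, h3.1]
    exact closure_minimal interior_subset hK''.isClosed
  exact ⟨χ, h1.contDiff, h4.trans hK''W, hK''.of_isClosed_subset (isClosed_tsupport _) h4,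
    interior K', isOpen_interior, hKK', fun y hy => (h3.2 y).1 (interior_subset hy)⟩

/-! ### Weyl's lemma -/

/-- A smooth function which is equal to `-s^{-1/2}` for `s > 1/2`. -/
def profile (s : ℝ) : ℝ := -(Real.smoothTransition (4 * s - 1) * (Real.sqrt s)⁻¹)

theorem contDiff_profile : ContDiff ℝ ∞ profile := by
  rw [contDiff_iff_contDiffAt]
  intro s
  -- The transition factor vanishes for `s ≤ 1/4`, which removes the singularity of `s^{-1/2}` at
  -- the origin.
  by_cases hs : s < 1 / 4
  · have : profile =ᶠ[𝓝 s] fun _ => 0 := by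
      filter_upwards [Iio_mem_nhds hs] with t ht
      rw [profile, Real.smoothTransition.zero_of_nonpos (by linarith [Set.mem_Iio.1 ht])]
      simp
    exact contDiffAt_const.congr_of_eventuallyEq this
  · have hs0 : 0 < s := by linarith
    have h1 : ContDiffAt ℝ ∞ (fun s : ℝ => Real.smoothTransition (4 * s - 1)) s :=
      (Real.smoothTransition.contDiff (n := ⊤)).contDiffAt.comp s (by fun_prop)
    exact (h1.mul ((Real.contDiffAt_sqrt hs0.ne').inv (Real.sqrt_pos.2 hs0).ne')).neg

theorem profile_eq {s : ℝ} (hs : 1 / 2 ≤ s) : profile s = -(Real.sqrt s)⁻¹ := by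
  rw [profile, Real.smoothTransition.one_of_one_le (by linarith), one_mul]

/-- The first derivative of the profile. -/
def profile₁ : ℝ → ℝ := deriv profile

/-- The second derivative of the profile. -/
def profile₂ : ℝ → ℝ := deriv profile₁

theorem contDiff_profile₁ : ContDiff ℝ ∞ profile₁ :=
  ((contDiff_succ_iff_deriv (n := ∞)).1 contDiff_profile).2.2

theorem contDiff_profile₂ : ContDiff ℝ ∞ profile₂ :=
  ((contDiff_succ_iff_deriv (n := ∞)).1 contDiff_profile₁).2.2

theorem hasDerivAt_profile (s : ℝ) : HasDerivAt profile (profile₁ s) s :=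
  (contDiff_profile.differentiable (by simp) s).hasDerivAt

theorem hasDerivAt_profile₁ (s : ℝ) : HasDerivAt profile₁ (profile₂ s) s :=
  (contDiff_profile₁.differentiable (by simp) s).hasDerivAt

theorem profile₁_eq {s : ℝ} (hs : 1 / 2 < s) : profile₁ s = 1 / 2 * (s * Real.sqrt s)⁻¹ := by
  have h0 : 0 < s := by linarith
  have h1 : profile =ᶠ[𝓝 s] fun s => -(Real.sqrt s)⁻¹ := by
    filter_upwards [Ioi_mem_nhds hs] with t ht using profile_eq (Set.mem_Ioi.1 ht).le
  have h2 := ((Real.hasDerivAt_sqrt h0.ne').inv (Real.sqrt_pos.2 h0).ne').neg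
  have h3 := (h2.congr_of_eventuallyEq h1).unique (hasDerivAt_profile s)
  have hq := Real.sqrt_pos.2 h0
  have hsq := Real.sq_sqrt h0.le
  rw [← h3]
  field_simp
  linear_combination -hsq

/-- The radial profile of the Laplacian of `z ↦ profile ‖z‖²`. -/
def kerProfile (s : ℝ) : ℝ := 6 * profile₁ s + 4 * s * profile₂ s

theorem contDiff_kerProfile : ContDiff ℝ ∞ kerProfile :=
  (contDiff_const.mul contDiff_profile₁).add
    ((contDiff_const.mul contDiff_id).mul contDiff_profile₂)

/-- In this range `profile ‖z‖²` is `-1/‖z‖`, which is harmonic in dimension three. -/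
theorem kerProfile_eq_zero {s : ℝ} (hs : 1 / 2 < s) : kerProfile s = 0 := by
  have h0 : 0 < s := by linarith
  have hq := Real.sqrt_pos.2 h0
  have hsq := Real.sq_sqrt h0.le
  have h1 : profile₁ =ᶠ[𝓝 s] fun s => 1 / 2 * (s * Real.sqrt s)⁻¹ := by
    filter_upwards [Ioi_mem_nhds hs] with t ht using profile₁_eq ht
  have h2 := (((hasDerivAt_id s).mul (Real.hasDerivAt_sqrt h0.ne')).inv
    (mul_pos h0 hq).ne').const_mul (1 / 2)
  have h3 := (h2.congr_of_eventuallyEq h1).unique (hasDerivAt_profile₁ s)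
  rw [kerProfile, ← h3, profile₁_eq hs]
  simp only [Pi.mul_apply, id]
  field_simp
  linear_combination 4 * hsq

/-- The regularized Newton potential. -/
def newt (ε : ℝ) (z : E3) : ℝ := ε⁻¹ * profile (‖z‖ ^ 2 / ε ^ 2)

/-- The Laplacian of the regularized Newton potential. -/
def ker (ε : ℝ) (z : E3) : ℝ := ε⁻¹ ^ 3 * kerProfile (‖z‖ ^ 2 / ε ^ 2)

theorem contDiff_newt (ε : ℝ) : ContDiff ℝ ∞ (newt ε) :=
  contDiff_const.mul (contDiff_profile.comp ((contDiff_norm_sq ℝ).div_const _))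

theorem contDiff_ker (ε : ℝ) : ContDiff ℝ ∞ (ker ε) :=
  contDiff_const.mul (contDiff_kerProfile.comp ((contDiff_norm_sq ℝ).div_const _))

theorem newt_eq {ε : ℝ} (hε : 0 < ε) {z : E3} (hz : ε ≤ ‖z‖) : newt ε z = -‖z‖⁻¹ := by
  have h1 : 1 ≤ ‖z‖ ^ 2 / ε ^ 2 := by
    rw [one_le_div (by positivity)]; gcongr
  rw [newt, profile_eq (by linarith), Real.sqrt_div (by positivity), Real.sqrt_sq (norm_nonneg _),
    Real.sqrt_sq hε.le]
  have : 0 < ‖z‖ := by linarith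
  field_simp

theorem ker_eq_zero {ε : ℝ} (hε : 0 < ε) {z : E3} (hz : ε ≤ ‖z‖) : ker ε z = 0 := by
  have h1 : 1 ≤ ‖z‖ ^ 2 / ε ^ 2 := by
    rw [one_le_div (by positivity)]; gcongr
  rw [ker, kerProfile_eq_zero (by linarith), mul_zero]

theorem pd_eq_of_hasDerivAt {φ : E3 → ℝ} {y : E3} {i : Fin 3} {d : ℝ}
    (hφ : DifferentiableAt ℝ φ y) (h : HasDerivAt (fun t : ℝ => φ (y + t • ee i)) d 0) :
    pd i φ y = d :=
  HasDerivAt.unique (hφ.hasFDerivAt.hasLineDerivAt (ee i)) h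

theorem hasDerivAt_norm_sq_line (z : E3) (i : Fin 3) (c : ℝ) :
    HasDerivAt (fun t : ℝ => ‖z + t • ee i‖ ^ 2 / c) (2 * z i / c) 0 := by
  have h1 : ∀ t : ℝ, ‖z + t • ee i‖ ^ 2 = ‖z‖ ^ 2 + 2 * z i * t + t ^ 2 := by
    intro t
    rw [norm_add_sq_real, inner_smul_right, EuclideanSpace.inner_single_right, norm_smul]
    simp
    ring
  simp_rw [h1]
  have h2 : HasDerivAt (fun t : ℝ => ‖z‖ ^ 2 + 2 * z i * t + t ^ 2) (2 * z i) 0 := by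
    have := (((hasDerivAt_id (0 : ℝ)).const_mul (2 * z i)).const_add (‖z‖ ^ 2)).add
      ((hasDerivAt_id (0 : ℝ)).pow 2)
    refine (this.congr_deriv (by simp)).congr_of_eventuallyEq (Eventually.of_forall fun t => ?_)
    simp
  exact h2.div_const c

theorem pd_newt (ε : ℝ) (x : E3) (i : Fin 3) : pd i (fun y => newt ε (y - x)) =
    fun y => ε⁻¹ ^ 3 * (2 * (y - x) i * profile₁ (‖y - x‖ ^ 2 / ε ^ 2)) := by
  funext y
  refine pd_eq_of_hasDerivAt ?_ ?_
  · exact ((contDiff_newt ε).comp (contDiff_id.sub contDiff_const)).differentiable (by simp) y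
  · have h1 := hasDerivAt_norm_sq_line (y - x) i (ε ^ 2)
    have h2 := (HasDerivAt.comp (0 : ℝ) (h₂ := profile) (by simpa using hasDerivAt_profile _) h1
      ).const_mul ε⁻¹
    have h3 : (fun t : ℝ => newt ε (y + t • ee i - x)) =
        fun t => ε⁻¹ * (profile ∘ fun t : ℝ => ‖y - x + t • ee i‖ ^ 2 / ε ^ 2) t := by
      funext t; rw [add_sub_right_comm]; rfl
    rw [h3]
    refine h2.congr_deriv ?_
    simp only [div_eq_mul_inv]
    ring

theorem pd_pd_newt (ε : ℝ) (x : E3) (i : Fin 3) (y : E3) :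
    pd i (pd i (fun y => newt ε (y - x))) y =
    ε⁻¹ ^ 3 * (2 * profile₁ (‖y - x‖ ^ 2 / ε ^ 2) +
      4 * ((y - x) i ^ 2 / ε ^ 2) * profile₂ (‖y - x‖ ^ 2 / ε ^ 2)) := by
  rw [pd_newt]
  refine pd_eq_of_hasDerivAt ?_ ?_
  · have h1 : ContDiff ℝ ∞ fun y : E3 => profile₁ (‖y - x‖ ^ 2 / ε ^ 2) :=
      contDiff_profile₁.comp (((contDiff_norm_sq ℝ).comp (contDiff_id.sub contDiff_const)).div_const _)
    have h2 : ContDiff ℝ ∞ fun y : E3 => (y - x) i := by fun_prop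
    exact (contDiff_const.mul ((contDiff_const.mul h2).mul h1)).differentiable (by simp) y
  · have h1 := hasDerivAt_norm_sq_line (y - x) i (ε ^ 2)
    have h2 := (HasDerivAt.comp (0 : ℝ) (h₂ := profile₁) (by simpa using hasDerivAt_profile₁ _) h1)
    have h4 : HasDerivAt (fun t : ℝ => 2 * ((y - x) i + t)) (2 * 1) 0 :=
      ((hasDerivAt_id (0 : ℝ)).const_add _).const_mul 2
    have h5 := (h4.mul h2).const_mul (ε⁻¹ ^ 3)
    have h3 : (fun t : ℝ => ε⁻¹ ^ 3 * (2 * (y + t • ee i - x) i *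
          profile₁ (‖y + t • ee i - x‖ ^ 2 / ε ^ 2))) =
        fun t => ε⁻¹ ^ 3 * ((fun t : ℝ => 2 * ((y - x) i + t)) *
          (profile₁ ∘ fun t : ℝ => ‖y - x + t • ee i‖ ^ 2 / ε ^ 2)) t := by
      funext t
      rw [add_sub_right_comm]
      simp [mul_assoc]
    rw [h3]
    refine h5.congr_deriv ?_
    simp only [Function.comp_apply, zero_smul, add_zero, div_eq_mul_inv]
    ring

theorem sum_pd_pd_newt (ε : ℝ) (x y : E3) :
    ∑ i, pd i (pd i (fun y => newt ε (y - x))) y = ker ε (y - x) := by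
  simp_rw [pd_pd_newt]
  rw [← Finset.mul_sum, Finset.sum_add_distrib, ← Finset.sum_mul, ← Finset.sum_mul,
    ← Finset.mul_sum, ← Finset.sum_div, ← EuclideanSpace.real_norm_sq_eq, ker, kerProfile]
  simp only [Finset.sum_const, Finset.card_univ, Fintype.card_fin, nsmul_eq_mul]
  push_cast
  ring

/-- In polar coordinates the integrand `r² kerProfile (r²)` is the derivative of `2 r³ profile₁
(r²)`, which is `0` at `r = 0` and `1` at `r = 1`; beyond `1` the kernel vanishes. -/
theorem integral_ker_one_ne_zero : ∫ z, ker 1 z ≠ 0 := by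
  have h0 : ∀ z : E3, ker 1 z = (fun r : ℝ => kerProfile (r ^ 2)) ‖z‖ := fun z => by simp [ker]
  simp_rw [h0]
  rw [integral_fun_norm_addHaar (volume : Measure E3) (fun r : ℝ => kerProfile (r ^ 2))]
  have h1 : ∫ y in Set.Ioi (0 : ℝ), y ^ (Module.finrank ℝ E3 - 1) • kerProfile (y ^ 2) = 1 := by
    have hd : ∀ r : ℝ, HasDerivAt (fun r : ℝ => 2 * r ^ 3 * profile₁ (r ^ 2))
        (r ^ 2 * kerProfile (r ^ 2)) r := by
      intro r
      have h2 := HasDerivAt.comp r (hasDerivAt_profile₁ (r ^ 2)) (hasDerivAt_pow 2 r)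
      have h3 := ((hasDerivAt_pow 3 r).const_mul 2).mul h2
      refine h3.congr_deriv ?_
      simp [kerProfile]
      ring
    have hc : Continuous fun r : ℝ => r ^ 2 * kerProfile (r ^ 2) := by
      have := contDiff_kerProfile.continuous
      fun_prop
    have h4 : ∫ r in (0 : ℝ)..1, r ^ 2 * kerProfile (r ^ 2) = 1 := by
      rw [intervalIntegral.integral_eq_sub_of_hasDerivAt (fun r _ => hd r)
        (hc.intervalIntegrable _ _), profile₁_eq (by norm_num)]
      norm_num
    rw [← h4, intervalIntegral.integral_of_le zero_le_one]
    have hfr : Module.finrank ℝ E3 - 1 = 2 := by simp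
    rw [hfr]
    simp only [smul_eq_mul]
    refine setIntegral_eq_of_subset_of_forall_sdiff_eq_zero measurableSet_Ioi
      Set.Ioc_subset_Ioi_self fun r hr => ?_
    have : 1 < r := by
      by_contra hh
      exact hr.2 ⟨hr.1, not_lt.1 hh⟩
    rw [kerProfile_eq_zero (by nlinarith), mul_zero]
  rw [h1]
  have h2 : 0 < volume.real (Metric.ball (0 : E3) 1) :=
    ENNReal.toReal_pos (Metric.measure_ball_pos _ _ one_pos).ne' measure_ball_lt_top.ne
  simp
  exact h2.ne'

/-- `v` is harmonic in `Ω` in the sense of distributions. -/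
def IsWeakHarmonic (Ω : Set E3) (v : L2 ℂ) : Prop :=
  ∀ η : E3 → ℝ, ContDiff ℝ ∞ η → tsupport η ⊆ Ω →
    ∫ y, ((∑ i, pd i (pd i η) y : ℝ) : ℂ) • v y ∂muY = 0

/-- The regularization of `v` by `ker ε`. -/
def regular (v : L2 ℂ) (ε : ℝ) (x : E3) : ℂ := ∫ y, (ker ε (y - x) : ℂ) • v y ∂muY

theorem continuous_ker_ofReal (ε : ℝ) (x : E3) : Continuous fun y => (ker ε (y - x) : ℂ) :=
  Complex.continuous_ofReal.comp ((contDiff_ker ε).continuous.comp (continuous_id.sub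
    continuous_const))

theorem pd_sub {φ χ : E3 → ℝ} {y : E3} (hφ : DifferentiableAt ℝ φ y)
    (hχ : DifferentiableAt ℝ χ y) (i : Fin 3) :
    pd i (fun y => φ y - χ y) y = pd i φ y - pd i χ y := by
  unfold pd
  rw [fderiv_fun_sub hφ hχ]
  rfl

theorem contDiff_pd {φ : E3 → ℝ} (hφ : ContDiff ℝ ∞ φ) (i : Fin 3) : ContDiff ℝ ∞ (pd i φ) :=
  (hφ.fderiv_right (m := ∞) (by simp)).clm_apply contDiff_const

/-- Both regularized potentials equal `-1/‖y - x‖` off the ball of radius `δ`, so their difference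
is an admissible test function, and its Laplacian is the difference of the two kernels. This
replaces the mean value property. -/
theorem IsWeakHarmonic.regular_eq_of_le {Ω : Set E3} {v : L2 ℂ} (hv : IsWeakHarmonic Ω v) {x : E3}
    {ε δ : ℝ} (hε : 0 < ε) (hεδ : ε ≤ δ) (hx : Metric.closedBall x δ ⊆ Ω) :
    regular v δ x = regular v ε x := by
  have hs : ∀ ε, ContDiff ℝ ∞ fun y => newt ε (y - x) := fun ε =>
    (contDiff_newt ε).comp (contDiff_id.sub contDiff_const)
  have h1 := hv (fun y => newt δ (y - x) - newt ε (y - x)) ((hs δ).sub (hs ε)) (by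
    refine (closure_minimal ?_ Metric.isClosed_closedBall).trans hx
    intro y hy
    by_contra h
    rw [Metric.mem_closedBall, not_le, dist_eq_norm] at h
    refine hy ?_
    simp only
    rw [newt_eq (hε.trans_le hεδ) h.le, newt_eq hε (hεδ.trans h.le), sub_self])
  have h2 : ∀ y, ∑ i, pd i (pd i (fun y => newt δ (y - x) - newt ε (y - x))) y =
      ker δ (y - x) - ker ε (y - x) := by
    intro y
    rw [← sum_pd_pd_newt, ← sum_pd_pd_newt, ← Finset.sum_sub_distrib]
    refine Finset.sum_congr rfl fun i _ => ?_
    have : pd i (fun y => newt δ (y - x) - newt ε (y - x)) = fun y =>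
        pd i (fun y => newt δ (y - x)) y - pd i (fun y => newt ε (y - x)) y :=
      funext fun y => pd_sub ((hs δ).differentiable (by simp) y)
        ((hs ε).differentiable (by simp) y) i
    rw [this]
    exact pd_sub ((contDiff_pd (hs δ) i).differentiable (by simp) y)
      ((contDiff_pd (hs ε) i).differentiable (by simp) y) i
  simp_rw [h2, Complex.ofReal_sub, sub_smul] at h1
  rw [integral_sub (integrable_smul (continuous_ker_ofReal δ x) v)
    (integrable_smul (continuous_ker_ofReal ε x) v), sub_eq_zero] at h1
  exact h1

theorem IsWeakHarmonic.regular_eq {Ω : Set E3} {v : L2 ℂ} (hv : IsWeakHarmonic Ω v) {x : E3}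
    {ε δ : ℝ} (hε : 0 < ε) (hδ : 0 < δ) (hxε : Metric.closedBall x ε ⊆ Ω)
    (hxδ : Metric.closedBall x δ ⊆ Ω) : regular v δ x = regular v ε x := by
  rcases le_total ε δ with h | h
  · exact hv.regular_eq_of_le hε h hxδ
  · exact (hv.regular_eq_of_le hδ h hxε).symm

theorem hasCompactSupport_ker {ε : ℝ} (hε : 0 < ε) : HasCompactSupport (ker ε) := by
  refine HasCompactSupport.intro (isCompact_closedBall (0 : E3) ε) fun z hz => ?_
  rw [Metric.mem_closedBall, dist_zero_right, not_le] at hz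
  exact ker_eq_zero hε hz.le

/-- The kernel is even, so this is a convolution with a smooth compactly supported function. -/
theorem contDiff_regular (v : L2 ℂ) {ε : ℝ} (hε : 0 < ε) : ContDiff ℝ ∞ (regular v ε) := by
  have h := HasCompactSupport.contDiff_convolution_right (n := ⊤) (μ := muY)
    (ContinuousLinearMap.lsmul ℝ ℝ).flip (hasCompactSupport_ker hε)
    (integrable_L2 v).locallyIntegrable (contDiff_ker ε)
  convert h using 1
  funext x
  rw [convolution, regular]
  refine integral_congr_ae (Eventually.of_forall fun y => ?_)
  simp only [ContinuousLinearMap.flip_apply, ContinuousLinearMap.lsmul_apply]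
  rw [ker, ker, norm_sub_rev]
  simp

theorem integral_ker {ε : ℝ} (hε : 0 < ε) (x : E3) : ∫ y, ker ε (y - x) = ∫ z, ker 1 z := by
  rw [integral_sub_right_eq_self (ker ε) x]
  have h1 : ker ε = fun z => ε⁻¹ ^ 3 * ker 1 (ε⁻¹ • z) := by
    funext z
    rw [ker, ker, norm_smul, norm_inv, Real.norm_of_nonneg hε.le]
    congr 2
    simp only [inv_one, one_pow, one_mul, div_one]
    congr 1
    field_simp
  rw [h1, integral_const_mul, Measure.integral_comp_smul]
  simp
  rw [abs_of_pos hε]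
  field_simp

/-- Lebesgue differentiation: divided by its integral, the kernel has mass one, lives in a ball of
radius `ε` and is bounded by a constant over the volume of that ball. Its sign plays no role. -/
theorem ae_tendsto_regular (v : L2 ℂ) : ∀ᵐ x ∂muY,
    Tendsto (fun n : ℕ => ((∫ z, ker 1 z : ℝ) : ℂ)⁻¹ • regular v (1 / ((n : ℝ) + 1)) x) atTop
      (𝓝 (v x)) := by
  set c := ∫ z, ker 1 z with hc
  set f : E3 → ℂ := cellY.indicator v with hf
  have hfi : Integrable f := by
    rw [hf, integrable_indicator_iff measurableSet_cellY]; exact integrable_L2 v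
  have hreg : ∀ ε x, regular v ε x = ∫ y, ker ε (y - x) • f y := by
    intro ε x
    rw [regular]
    unfold muY
    rw [← integral_indicator measurableSet_cellY]
    refine integral_congr_ae (Eventually.of_forall fun y => ?_)
    by_cases hy : y ∈ cellY
    · simp only [hf, Set.indicator_of_mem hy]; exact Complex.coe_smul _ _
    · simp [hf, hy]
  obtain ⟨M, hM⟩ : ∃ M, ∀ z, |ker 1 z| ≤ M := by
    obtain ⟨M, hM⟩ := (contDiff_ker 1).continuous.bounded_above_of_compact_support
      (hasCompactSupport_ker one_pos)
    exact ⟨M, hM⟩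
  have hbd : ∀ ε : ℝ, 0 < ε → ∀ z, |ker ε z| ≤ ε⁻¹ ^ 3 * M := by
    intro ε hε z
    have h1 : ker ε z = ε⁻¹ ^ 3 * ker 1 (ε⁻¹ • z) := by
      rw [ker, ker, norm_smul, norm_inv, Real.norm_of_nonneg hε.le]
      congr 2
      simp only [inv_one, one_pow, one_mul, div_one]
      congr 1
      field_simp
    rw [h1, abs_mul, abs_of_pos (by positivity)]
    gcongr
    exact hM _
  have hae := (Besicovitch.vitaliFamily (volume : Measure E3)).ae_tendsto_average_norm_sub
    hfi.locallyIntegrable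
  filter_upwards [ae_restrict_of_ae hae, ae_muY_mem] with x h₀ hx
  have hfx : f x = v x := by simp [hf, hx]
  rw [← hfx]
  have hr : Tendsto (fun n : ℕ => 1 / ((n : ℝ) + 1)) atTop (𝓝[>] 0) :=
    tendsto_nhdsWithin_iff.2 ⟨tendsto_one_div_add_atTop_nhds_zero_nat,
      Eventually.of_forall fun n => by simp only [Set.mem_Ioi]; positivity⟩
  have h1 := (h₀.comp (Besicovitch.tendsto_filterAt volume x)).comp hr
  have h2 := tendsto_integral_smul_of_tendsto_average_norm_sub
    (g := fun (n : ℕ) y => c⁻¹ * ker (1 / ((n : ℝ) + 1)) (y - x))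
    (|c⁻¹| * M * volume.real (Metric.closedBall (0 : E3) 1)) h1
    (Eventually.of_forall fun n => hfi.integrableOn) ?_ ?_ ?_
  · refine h2.congr fun n => ?_
    rw [hreg, ← integral_smul]
    refine integral_congr_ae (Eventually.of_forall fun y => ?_)
    simp [mul_assoc]
  · refine tendsto_const_nhds.congr fun n => ?_
    rw [integral_const_mul, integral_ker (by positivity), inv_mul_cancel₀ integral_ker_one_ne_zero]
  · refine Eventually.of_forall fun n y hy => ?_
    by_contra h
    simp only [Metric.mem_closedBall, not_le, dist_eq_norm] at h
    refine hy ?_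
    simp only
    rw [ker_eq_zero (by positivity) h.le, mul_zero]
  · refine Eventually.of_forall fun n y => ?_
    have hn : (0 : ℝ) < 1 / ((n : ℝ) + 1) := by positivity
    have hb1 : 0 < volume.real (Metric.closedBall (0 : E3) 1) :=
      ENNReal.toReal_pos (Metric.measure_closedBall_pos _ _ one_pos).ne'
        measure_closedBall_lt_top.ne
    have hvol := Measure.addHaar_real_closedBall (volume : Measure E3) x hn.le
    have hvol1 := Measure.addHaar_real_closedBall (volume : Measure E3) 0 (zero_le_one' ℝ)
    rw [one_pow, one_mul] at hvol1
    have hfr : Module.finrank ℝ E3 = 3 := by simp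
    rw [hvol, ← hvol1, hfr, abs_mul]
    refine (mul_le_mul_of_nonneg_left (hbd _ hn (y - x)) (abs_nonneg _)).trans (le_of_eq ?_)
    field_simp

/-- Weyl's lemma. -/
theorem IsWeakHarmonic.exists_contDiffOn {Ω : Set E3} (hΩ : IsOpen Ω)
    {v : L2 ℂ} (hv : IsWeakHarmonic Ω v) :
    ∃ U : E3 → ℂ, ContDiffOn ℝ ∞ U Ω ∧ ∀ᵐ x ∂muY, x ∈ Ω → v x = U x := by
  set c := ∫ z, ker 1 z with hc
  have hball : ∀ x ∈ Ω, ∃ δ > 0, Metric.closedBall x δ ⊆ Ω := fun x hx =>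
    Metric.nhds_basis_closedBall.mem_iff.1 (hΩ.mem_nhds hx)
  classical
  -- The radius may depend on `x`, since the regularization is the same for all admissible radii;
  -- near a given point one fixed radius serves, which gives smoothness.
  let U : E3 → ℂ := fun x => if hx : x ∈ Ω then (c : ℂ)⁻¹ • regular v (hball x hx).choose x else 0
  have hU : ∀ x δ, 0 < δ → Metric.closedBall x δ ⊆ Ω → U x = (c : ℂ)⁻¹ • regular v δ x := by
    intro x δ hδ h
    have hx : x ∈ Ω := h (Metric.mem_closedBall_self hδ.le)
    simp only [U, dif_pos hx]
    rw [hv.regular_eq (hball x hx).choose_spec.1 hδ (hball x hx).choose_spec.2 h]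
  refine ⟨U, fun x hx => ?_, ?_⟩
  · obtain ⟨δ, hδ, hb⟩ := hball x hx
    have h1 : U =ᶠ[𝓝 x] fun x' => (c : ℂ)⁻¹ • regular v (δ / 2) x' := by
      filter_upwards [Metric.ball_mem_nhds x (half_pos hδ)] with x' hx'
      refine hU x' (δ / 2) (half_pos hδ) (Set.Subset.trans ?_ hb)
      refine Metric.closedBall_subset_closedBall' ?_
      linarith [Metric.mem_ball.1 hx']
    have h2 : ContDiff ℝ ∞ fun x' => (c : ℂ)⁻¹ • regular v (δ / 2) x' :=
      (contDiff_regular v (half_pos hδ)).const_smul _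
    exact (h2.contDiffAt.congr_of_eventuallyEq h1).contDiffWithinAt
  · filter_upwards [ae_tendsto_regular v] with x h hx
    obtain ⟨δ, hδ, hb⟩ := hball x hx
    refine tendsto_nhds_unique h (tendsto_const_nhds.congr' ?_)
    have h2 : ∀ᶠ n : ℕ in atTop, 1 / ((n : ℝ) + 1) < δ :=
      tendsto_one_div_add_atTop_nhds_zero_nat.eventually_lt_const hδ
    filter_upwards [h2] with n hn
    exact hU x _ (by positivity) ((Metric.closedBall_subset_closedBall hn.le).trans hb)

/-! ### Primitives of closed forms on simply connected open sets -/

/-- The complex numbers with the discrete topology. -/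
def DiscreteC : Type := ℂ

/-- The identity map from `DiscreteC` to `ℂ`. -/
def DiscreteC.toC (v : DiscreteC) : ℂ := v

/-- The identity map from `ℂ` to `DiscreteC`. -/
def DiscreteC.of (z : ℂ) : DiscreteC := z

theorem DiscreteC.of_injective : Function.Injective DiscreteC.of := fun _ _ h => h

instance : TopologicalSpace DiscreteC := ⊥

instance : DiscreteTopology DiscreteC := ⟨rfl⟩

section Primitive

variable {E : Type} [NormedAddCommGroup E] [NormedSpace ℝ E] {Ω : Set E} {θ : E → E →L[ℝ] ℂ}
  {r : Ω → ℝ} {p : Ω → E → ℂ}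

theorem sub_eq_const_of_hasFDerivAt
    (hp : ∀ x : Ω, ∀ a ∈ Metric.ball (x : E) (r x), HasFDerivAt (p x) (θ a) a) (i j : Ω) :
    ∃ c : ℂ, ∀ y ∈ Metric.ball (i : E) (r i) ∩ Metric.ball (j : E) (r j), p i y - p j y = c := by
  have hcv : Convex ℝ (Metric.ball (i : E) (r i) ∩ Metric.ball (j : E) (r j)) :=
    (convex_ball _ _).inter (convex_ball _ _)
  have ho : IsOpen (Metric.ball (i : E) (r i) ∩ Metric.ball (j : E) (r j)) :=
    Metric.isOpen_ball.inter Metric.isOpen_ball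
  have hd : ∀ a ∈ Metric.ball (i : E) (r i) ∩ Metric.ball (j : E) (r j),
      HasFDerivAt (fun y => p i y - p j y) (0 : E →L[ℝ] ℂ) a := fun a ha => by
    simpa using (hp i a ha.1).fun_sub (hp j a ha.2)
  rcases (Metric.ball (i : E) (r i) ∩ Metric.ball (j : E) (r j)).eq_empty_or_nonempty with h | ⟨z, hz⟩
  · exact ⟨0, by simp [h]⟩
  · refine ⟨p i z - p j z, fun y hy => ?_⟩
    exact ho.is_const_of_fderiv_eq_zero (𝕜 := ℝ) hcv.isPreconnected
      (fun a ha => (hd a ha).differentiableAt.differentiableWithinAt)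
      (fun a ha => (hd a ha).fderiv) hy hz

/-- The bundle of the local primitives of a closed form. -/
def primitiveCore (hr : ∀ x, 0 < r x)
    (hp : ∀ x : Ω, ∀ a ∈ Metric.ball (x : E) (r x), HasFDerivAt (p x) (θ a) a) :
    FiberBundleCore Ω Ω DiscreteC where
  baseSet x := Subtype.val ⁻¹' Metric.ball (x : E) (r x)
  isOpen_baseSet x := Metric.isOpen_ball.preimage continuous_subtype_val
  indexAt x := x
  mem_baseSet_at x := Metric.mem_ball_self (hr x)
  -- The fibre coordinate `v` in chart `i` stands for the primitive `p i + v`; the change of chart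
  -- expresses the same value as `p j` plus a constant.
  coordChange i j x v := .of (v.toC + (p i x - p j x))
  coordChange_self i x _ v := by
    rw [sub_self, add_zero]; rfl
  continuousOn_coordChange i j := by
    obtain ⟨c, hc⟩ := sub_eq_const_of_hasFDerivAt hp i j
    have h1 : Continuous fun q : Ω × DiscreteC => DiscreteC.of (q.2.toC + c) :=
      (continuous_of_discreteTopology (f := fun v : DiscreteC => DiscreteC.of (v.toC + c))).comp
        continuous_snd
    refine h1.continuousOn.congr fun q hq => ?_
    simp only
    rw [hc q.1 hq.1]
  coordChange_comp i j k x _ v := by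
    rw [DiscreteC.toC, DiscreteC.of, DiscreteC.of, DiscreteC.of, add_assoc, sub_add_sub_cancel]

/-- On balls the Poincaré lemma gives primitives, and two of them differ by a constant on the convex
overlap. Gluing yields a bundle with discrete fibre, that is a covering of `Ω`. Over a simply
connected base the identity lifts to a section, which is a coherent choice of constants. -/
theorem exists_primitive [LocallyPathConnectedSpace E] (hΩ : IsOpen Ω) (hsc : IsSimplyConnected Ω)
    (hθ : DifferentiableOn ℝ θ Ω)
    (hsymm : ∀ a ∈ Ω, ∀ x y, fderiv ℝ θ a x y = fderiv ℝ θ a y x) :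
    ∃ w : E → ℂ, ∀ a ∈ Ω, HasFDerivAt w (θ a) a := by
  classical
  have hloc : ∀ x : Ω, ∃ r > 0, Metric.ball (x : E) r ⊆ Ω ∧
      ∃ p : E → ℂ, ∀ a ∈ Metric.ball (x : E) r, HasFDerivAt p (θ a) a := by
    intro x
    obtain ⟨r, hr, h⟩ := Metric.isOpen_iff.1 hΩ x x.2
    exact ⟨r, hr, h, (convex_ball (x : E) r).exists_forall_hasFDerivAt_of_fderiv_symmetric
      Metric.isOpen_ball (hθ.mono h) fun a ha => hsymm a (h ha)⟩
  choose r hr hrΩ p hp using hloc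
  let Z := primitiveCore hr hp
  have := hsc.simplyConnectedSpace
  have := hΩ.locallyPathConnectedSpace
  obtain ⟨a₀, ha₀⟩ := hsc.nonempty
  have hcov : IsCoveringMap (Bundle.TotalSpace.proj : Z.TotalSpace → Ω) :=
    FiberBundle.isCoveringMap (F := DiscreteC) (E := Z.Fiber)
  obtain ⟨σ, ⟨-, hσ⟩, -⟩ := hcov.existsUnique_continuousMap_lifts (ContinuousMap.id Ω) ⟨a₀, ha₀⟩
    ⟨⟨a₀, ha₀⟩, DiscreteC.of 0⟩ rfl
  have hσ1 : ∀ y, (σ y).1 = y := fun y => congrFun hσ y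
  let val : Ω → ℂ := fun y => p y y + DiscreteC.toC (σ y).2
  refine ⟨fun y => if hy : y ∈ Ω then val ⟨y, hy⟩ else 0, fun a ha => ?_⟩
  let x : Ω := ⟨a, ha⟩
  have h2 : ∀ y : Ω, ((Z.localTriv x) (σ y)).2 = DiscreteC.of (val y - p x y) := by
    intro y
    rw [FiberBundleCore.localTriv_apply]
    change DiscreteC.of (DiscreteC.toC (σ y).2 + (p (σ y).1 (σ y).1 - p x (σ y).1)) = _
    rw [hσ1]
    simp only [val]
    congr 1
    ring
  -- In a chart the section is a continuous map into a discrete space, hence locally constant: near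
  -- `x` the global function is `p x` plus a constant.
  have hcont : ContinuousAt (fun y : Ω => ((Z.localTriv x) (σ y)).2) x := by
    refine continuous_snd.continuousAt.comp ?_
    refine ContinuousAt.comp (f := σ) ?_ σ.continuous.continuousAt
    refine (Z.localTriv x).continuousAt ?_
    rw [FiberBundleCore.mem_localTriv_source, hσ1]
    exact Z.mem_baseSet_at x
  have hconst : ∀ᶠ y : Ω in 𝓝 x, val y - p x y = val x - p x x := by
    have h3 := hcont.eventually_mem ((isOpen_discrete {((Z.localTriv x) (σ x)).2}).mem_nhds rfl)
    filter_upwards [h3] with y hy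
    have h4 : ((Z.localTriv x) (σ y)).2 = ((Z.localTriv x) (σ x)).2 := hy
    rw [h2, h2] at h4
    exact DiscreteC.of_injective h4
  have h5 : (fun y => if hy : y ∈ Ω then val ⟨y, hy⟩ else 0) =ᶠ[𝓝 a]
      fun y => p x y + (val x - p x x) := by
    rw [show x = ⟨a, ha⟩ from rfl, nhds_subtype_eq_comap] at hconst
    rw [eventually_comap] at hconst
    filter_upwards [hconst, hΩ.mem_nhds ha] with y h6 hy
    rw [dif_pos hy, ← h6 ⟨y, hy⟩ rfl]
    ring
  exact ((hp x a (Metric.mem_ball_self (hr x))).add_const _).congr_of_eventuallyEq h5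

end Primitive

/-! ### Local properties of weak derivatives -/

theorem ae_eq_of_forall_integral_eq {O : Set E3} (hO : IsOpen O) {f : L2 ℂ}
    {g : E3 → ℂ} (hg : ContinuousOn g O)
    (h : ∀ η : E3 → ℝ, ContDiff ℝ ∞ η → tsupport η ⊆ O →
      ∫ y, (η y : ℂ) • f y ∂muY = ∫ y, (η y : ℂ) • g y ∂muY) :
    ∀ᵐ y ∂muY, y ∈ O → f y = g y := by
  have hgl : LocallyIntegrableOn g O muY := hg.locallyIntegrableOn hO.measurableSet
  have hfl : LocallyIntegrableOn f O muY := (integrable_L2 f).locallyIntegrable.locallyIntegrableOn O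
  have h1 := hO.ae_eq_zero_of_integral_contDiff_smul_eq_zero (hfl.sub hgl) (fun η hη hc hs => by
    have e1 : ∀ (η : E3 → ℝ) (f : E3 → ℂ) y, η y • f y = (η y : ℂ) • f y := fun η f y =>
      (Complex.coe_smul _ _).symm
    simp only [e1, Pi.sub_apply, smul_sub]
    rw [integral_sub, h η hη hs, sub_self]
    · exact integrable_smul (Complex.continuous_ofReal.comp hη.continuous) f
    · have hcont : Continuous fun y => (η y : ℂ) • g y := by
        refine continuous_of_tsupport fun y hy => ?_
        have hy' : y ∈ tsupport η := by
          refine closure_mono ?_ hy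
          intro z hz h0
          exact hz (by simp [h0])
        exact ((Complex.continuous_ofReal.comp hη.continuous).continuousAt).smul
          (hg.continuousAt (hO.mem_nhds (hs hy')))
      exact integrable_of_continuous hcont)
  filter_upwards [h1] with y hy hyO
  exact sub_eq_zero.1 (hy hyO)

theorem contDiff_of_forall_mem_tsupport {V W : Type*} [NormedAddCommGroup V] [NormedSpace ℝ V]
    [NormedAddCommGroup W] [NormedSpace ℝ W] {n : WithTop ℕ∞} {G : V → W}
    (h : ∀ y ∈ tsupport G, ContDiffAt ℝ n G y) : ContDiff ℝ n G := by
  refine contDiff_iff_contDiffAt.2 fun y => ?_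
  by_cases hy : y ∈ tsupport G
  · exact h y hy
  · refine (contDiffAt_const (c := (0 : W))).congr_of_eventuallyEq ?_
    filter_upwards [(isClosed_tsupport G).isOpen_compl.mem_nhds hy] with z hz
    exact image_eq_zero_of_notMem_tsupport hz

theorem tsupport_subset_of_eq_zero {X V W : Type*} [TopologicalSpace X] [Zero V] [Zero W]
    {f : X → V} {g : X → W} (h : ∀ z, g z = 0 → f z = 0) : tsupport f ⊆ tsupport g :=
  closure_mono fun z hz h0 => hz (h z h0)

theorem integral_pd_smul_eq {O : Set E3} (hO : IsOpen O) (hOY : O ⊆ cellY) {G : E3 → ℂ}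
    (hG : ContDiffOn ℝ 1 G O) {η : E3 → ℝ} (hη : ContDiff ℝ ∞ η) (hs : tsupport η ⊆ O)
    (i : Fin 3) : ∫ y, (pd i η y : ℂ) • G y ∂muY =
      -∫ y, (η y : ℂ) • fderiv ℝ G y (ee i) ∂muY := by
  have hsub : ∀ f : E3 → ℂ, tsupport (fun y => (η y : ℂ) * f y) ⊆ tsupport η := by
    intro f
    exact tsupport_subset_of_eq_zero fun z h0 => by simp [h0]
  have hGat : ∀ y ∈ tsupport η, ContDiffAt ℝ 1 G y := fun y hy =>
    hG.contDiffAt (hO.mem_nhds (hs hy))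
  have hηC : ContDiff ℝ ∞ fun y => (η y : ℂ) := Complex.ofRealCLM.contDiff.comp hη
  have hP : ContDiff ℝ 1 fun y => (η y : ℂ) * G y := by
    refine contDiff_of_forall_mem_tsupport fun y hy => ?_
    exact (hηC.contDiffAt.of_le (by simp)).mul (hGat y (hsub G hy))
  have h0 := integral_fderiv_eq_zero_of_tsupport hP ((hsub G).trans (hs.trans hOY)) i
  have h1 : ∀ y, fderiv ℝ (fun y => (η y : ℂ) * G y) y (ee i) =
      (pd i η y : ℂ) • G y + (η y : ℂ) • fderiv ℝ G y (ee i) := by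
    intro y
    by_cases hy : y ∈ tsupport η
    · have hd1 : HasFDerivAt (fun y => (η y : ℂ)) (Complex.ofRealCLM.comp (fderiv ℝ η y)) y :=
        Complex.ofRealCLM.hasFDerivAt.comp y (hη.differentiable (by simp) y).hasFDerivAt
      have hd2 := ((hGat y hy).differentiableAt (by simp)).hasFDerivAt
      have := (hd1.mul hd2).fderiv
      erw [this]
      simp [pd]
      ring
    · have e1 : (fun y => (η y : ℂ) * G y) =ᶠ[𝓝 y] fun _ => 0 := by
        filter_upwards [(isClosed_tsupport η).isOpen_compl.mem_nhds hy] with z hz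
        rw [image_eq_zero_of_notMem_tsupport hz]; simp
      have e2 : η =ᶠ[𝓝 y] fun _ => 0 := by
        filter_upwards [(isClosed_tsupport η).isOpen_compl.mem_nhds hy] with z hz
        rw [image_eq_zero_of_notMem_tsupport hz]
      rw [e1.fderiv_eq, pd, e2.fderiv_eq, image_eq_zero_of_notMem_tsupport hy]
      simp
  simp_rw [h1] at h0
  have hpd : tsupport (pd i η) ⊆ tsupport η := tsupport_fderiv_apply_subset ℝ (ee i)
  rw [integral_add] at h0
  · exact eq_neg_of_add_eq_zero_left h0
  · refine integrable_of_continuous (continuous_of_tsupport fun y hy => ?_)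
    have hy' : y ∈ tsupport η := hpd (tsupport_subset_of_eq_zero (fun z h0 => by simp [h0]) hy)
    exact (Complex.continuous_ofReal.comp (contDiff_pd hη i).continuous).continuousAt.smul
      (hGat y hy').continuousAt
  · refine integrable_of_continuous (continuous_of_tsupport fun y hy => ?_)
    have hy' : y ∈ tsupport η := tsupport_subset_of_eq_zero (fun z h0 => by simp [h0]) hy
    exact (Complex.continuous_ofReal.comp hη.continuous).continuousAt.smul
      (((hGat y hy').continuousAt_fderiv (by simp)).clm_apply continuousAt_const)

theorem IsWeakPartial.integral_eq {i : Fin 3} {v g : L2 ℂ} (h : IsWeakPartial i v g)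
    {η : E3 → ℝ} (hη : ContDiff ℝ ∞ η) (hs : tsupport η ⊆ cellY) :
    ∫ y, (pd i η y : ℂ) • v y ∂muY = -∫ y, (η y : ℂ) • g y ∂muY := by
  have h1 := isWeakPartial_iff_complex.1 h _ (isPeriodicSmooth_periodize hη hs)
  refine Eq.trans (integral_congr_ae ?_) (h1.trans (congrArg _ (integral_congr_ae ?_)))
  · filter_upwards [ae_muY_mem] with y hy
    rw [pd_periodize η hy]
  · filter_upwards [ae_muY_mem] with y hy
    rw [periodize_eq η hy]

/-- Weak derivatives are local: periodized test functions supported in `O` see only the values of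
`v` there, where classical integration by parts applies. -/
theorem IsWeakPartial.ae_eq_fderiv {i : Fin 3} {v g : L2 ℂ} (h : IsWeakPartial i v g) {O : Set E3}
    (hO : IsOpen O) (hOY : O ⊆ cellY) {G : E3 → ℂ} (hG : ContDiffOn ℝ 1 G O)
    (hv : ∀ᵐ y ∂muY, y ∈ O → v y = G y) :
    ∀ᵐ y ∂muY, y ∈ O → g y = fderiv ℝ G y (ee i) := by
  refine ae_eq_of_forall_integral_eq hO ?_ fun η hη hs => ?_
  · exact (hG.continuousOn_fderiv_of_isOpen hO le_rfl).clm_apply continuousOn_const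
  · have h1 := h.integral_eq hη (hs.trans hOY)
    have h2 := integral_pd_smul_eq hO hOY hG hη hs i
    have hpd : tsupport (pd i η) ⊆ tsupport η := tsupport_fderiv_apply_subset ℝ (ee i)
    have h3 : ∫ y, (pd i η y : ℂ) • v y ∂muY = ∫ y, (pd i η y : ℂ) • G y ∂muY := by
      refine integral_congr_ae ?_
      filter_upwards [hv] with y hy
      by_cases hyO : y ∈ O
      · rw [hy hyO]
      · rw [image_eq_zero_of_notMem_tsupport (f := pd i η) fun h => hyO (hs (hpd h))]; simp
    rw [h1, h2, neg_inj] at h3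
    exact h3

theorem memLp_of_continuous {G : E3 → ℂ} (hG : Continuous G) : MemLp G 2 muY := by
  obtain ⟨C, hC⟩ := exists_bound_muY hG
  exact MemLp.of_bound hG.aestronglyMeasurable C hC

theorem isWeakPartial_toLp {G : E3 → ℂ} (hG : ContDiff ℝ 1 G) (hs : tsupport G ⊆ cellY)
    (i : Fin 3) : IsWeakPartial i ((memLp_of_continuous hG.continuous).toLp G)
      ((memLp_of_continuous ((hG.continuous_fderiv (by simp)).clm_apply
        (continuous_const (y := ee i)))).toLp fun y => fderiv ℝ G y (ee i)) := by
  rw [isWeakPartial_iff_complex]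
  intro φ hφ
  have hφC : ContDiff ℝ ∞ fun y => (φ y : ℂ) := Complex.ofRealCLM.contDiff.comp hφ.1
  have h0 := integral_fderiv_eq_zero_of_tsupport (G := fun y => (φ y : ℂ) * G y)
    ((hφC.of_le (by simp)).mul hG) ((tsupport_subset_of_eq_zero fun z h0 => by simp [h0]).trans hs) i
  have h1 : ∀ y, fderiv ℝ (fun y => (φ y : ℂ) * G y) y (ee i) =
      (pd i φ y : ℂ) • G y + (φ y : ℂ) • fderiv ℝ G y (ee i) := by
    intro y
    have hd1 : HasFDerivAt (fun y => (φ y : ℂ)) (Complex.ofRealCLM.comp (fderiv ℝ φ y)) y :=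
      Complex.ofRealCLM.hasFDerivAt.comp y (hφ.differentiable y).hasFDerivAt
    have hd2 := (hG.differentiable (by simp) y).hasFDerivAt
    have := (hd1.mul hd2).fderiv
    erw [this]
    simp [pd]
    ring
  simp_rw [h1] at h0
  rw [integral_add] at h0
  · refine Eq.trans (integral_congr_ae ?_) ((eq_neg_of_add_eq_zero_left h0).trans
      (congrArg _ (integral_congr_ae ?_)))
    · filter_upwards [(memLp_of_continuous hG.continuous).coeFn_toLp] with y hy
      rw [hy]
    · filter_upwards [(memLp_of_continuous ((hG.continuous_fderiv (by simp)).clm_apply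
        (continuous_const (y := ee i)))).coeFn_toLp] with y hy
      rw [hy]
  · exact integrable_of_continuous ((hφ.pd i).ofReal_continuous.smul hG.continuous)
  · exact integrable_of_continuous (hφ.ofReal_continuous.smul
      ((hG.continuous_fderiv (by simp)).clm_apply continuous_const))

theorem memW12_toLp {G : E3 → ℂ} (hG : ContDiff ℝ 1 G) (hs : tsupport G ⊆ cellY) :
    MemW12 ((memLp_of_continuous hG.continuous).toLp G) :=
  fun i => ⟨_, isWeakPartial_toLp hG hs i⟩

/-! ### Averages along a direction -/

/-- The average of `η` over the segment `[y - h n, y]`. -/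
def segAvg (n : E3) (h : ℝ) (η : E3 → ℝ) (y : E3) : ℝ := ∫ s in (0 : ℝ)..h, η (y - s • n)

theorem continuous_segAvg (n : E3) (h : ℝ) {η : E3 → ℝ} (hη : Continuous η) :
    Continuous (segAvg n h η) :=
  intervalIntegral.continuous_parametric_intervalIntegral_of_continuous' (by fun_prop) _ _

/-- Fubini together with the measure preserving shear `(s, z) ↦ (s, z + s n)`: averaging backwards
on the test function is averaging forwards on `g`. -/
theorem integral_segAvg_smul (n : E3) {h : ℝ} (hh : 0 ≤ h) {η : E3 → ℝ} (hη : Continuous η)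
    {C : ℝ} (hC : ∀ y, ‖η y‖ ≤ C) {g : E3 → ℂ} (hg : Integrable g) :
    ∫ y, (segAvg n h η y : ℂ) • g y = ∫ z, (η z : ℂ) • ∫ s in (0 : ℝ)..h, g (z + s • n) := by
  set ν : Measure ℝ := volume.restrict (Set.Ioc 0 h) with hν
  let F : ℝ × E3 → ℂ := fun p => (η (p.2 - p.1 • n) : ℂ) * g p.2
  have hgp : Integrable (fun p : ℝ × E3 => g p.2) (ν.prod volume) := by
    have := (integrable_const (1 : ℂ) (μ := ν)).mul_prod hg
    simpa using this
  have hF : Integrable F (ν.prod volume) := by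
    refine hgp.bdd_mul (c := C) ?_ (Eventually.of_forall fun p => ?_)
    · exact (Complex.continuous_ofReal.comp (by fun_prop)).aestronglyMeasurable
    · rw [Complex.norm_real]; exact hC _
  have hskew : MeasurePreserving (fun p : ℝ × E3 => (p.1, p.2 + p.1 • n)) (ν.prod volume)
      (ν.prod volume) := by
    refine MeasurePreserving.skew_product (g := fun (s : ℝ) (z : E3) => z + s • n)
      (MeasurePreserving.id ν) ?_ (Eventually.of_forall fun s => ?_)
    · exact (by fun_prop : Continuous fun p : ℝ × E3 => p.2 + p.1 • n).measurable
    · exact (measurePreserving_add_right volume (s • n)).map_eq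
  have hF' : Integrable (F ∘ fun p : ℝ × E3 => (p.1, p.2 + p.1 • n)) (ν.prod volume) :=
    hskew.integrable_comp_of_integrable hF
  have e1 : ∫ y, (segAvg n h η y : ℂ) • g y = ∫ p, F p ∂(ν.prod volume) := by
    rw [integral_prod_symm _ hF]
    refine integral_congr_ae (Eventually.of_forall fun y => ?_)
    simp only [F]
    rw [integral_mul_const, segAvg, intervalIntegral.integral_of_le hh, ← hν, smul_eq_mul,
      ← integral_complex_ofReal]
  have e2 : ∫ p, F p ∂(ν.prod volume) =
      ∫ p, (F ∘ fun p : ℝ × E3 => (p.1, p.2 + p.1 • n)) p ∂(ν.prod volume) := by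
    have := integral_map (μ := ν.prod volume) hskew.measurable.aemeasurable (f := F)
      (by rw [hskew.map_eq]; exact hF.aestronglyMeasurable)
    rw [hskew.map_eq] at this
    exact this
  rw [e1, e2, integral_prod_symm _ hF']
  refine integral_congr_ae (Eventually.of_forall fun z => ?_)
  simp only [F, Function.comp_apply, add_sub_cancel_right]
  rw [integral_const_mul, intervalIntegral.integral_of_le hh, smul_eq_mul]

/-- The operator `v ↦ ∫₀ʰ v(· + s n) ds` on periodic functions. -/
theorem exists_segAvgL (n : E3) {h : ℝ} (hh : 0 ≤ h) : ∃ A : L2 ℂ →L[ℂ] L2 ℂ,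
    (∀ v, MemW12 v → MemW12 (A v)) ∧
    ∀ η : E3 → ℝ, Continuous η → tsupport η ⊆ cellY →
      (∀ y ∈ tsupport η, ∀ s ∈ Set.Icc 0 h, y + s • n ∈ cellY) → ∀ v : L2 ℂ,
      ∫ y, (η y : ℂ) • A v y ∂muY = ∫ y, (segAvg n h η y : ℂ) • v y ∂muY := by
  -- Translation by `s n` multiplies the `k`-th mode by `char k (s • n)`. Being a multiplier, the
  -- operator commutes with the derivatives and so preserves `W^{1,2}`.
  let m : (Fin 3 → ℤ) → ℂ := fun k => ∫ s in (0 : ℝ)..h, char k (s • n)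
  have hm : ∀ k, ‖m k • ContinuousLinearMap.id ℂ ℂ‖ ≤ h := by
    intro k
    rw [norm_smul]
    have h1 : ‖m k‖ ≤ 1 * |h - 0| :=
      intervalIntegral.norm_integral_le_of_norm_le_const fun s _ => (norm_char _ _).le
    rw [sub_zero, abs_of_nonneg hh, one_mul] at h1
    calc ‖m k‖ * ‖ContinuousLinearMap.id ℂ ℂ‖ ≤ h * 1 := by
          gcongr
          exact ContinuousLinearMap.norm_id_le
      _ = h := mul_one h
  obtain ⟨A, hA⟩ := exists_multiplier (F := ℂ) (G := ℂ) _ hm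
  have hA' : ∀ u k, fc k (A u) = m k * fc k u := fun u k => by rw [hA]; rfl
  refine ⟨A, fun v hv i => ⟨A (wpd i v), isWeakPartial_iff.2 fun k => ?_⟩, ?_⟩
  · rw [hA', hA', hv.fc_wpd, smul_eq_mul, smul_eq_mul]; ring
  intro η hη hs hsn v
  have hηc : HasCompactSupport η := isCompact_of_subset_cellY (isClosed_tsupport η) hs
  obtain ⟨C, hC⟩ := hη.bounded_above_of_compact_support hηc
  have hηC : Continuous fun y => (η y : ℂ) := Complex.continuous_ofReal.comp hη
  have hBC : Continuous fun y => (segAvg n h η y : ℂ) :=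
    Complex.continuous_ofReal.comp (continuous_segAvg n h hη)
  have h1 := (hasSum_charField v).mapL ((integralL (F := ℂ) _ hηC) ∘L A)
  have h2 := (hasSum_charField v).mapL (integralL (F := ℂ) _ hBC)
  rw [ContinuousLinearMap.comp_apply, integralL_apply] at h1
  rw [integralL_apply] at h2
  refine h1.unique (h2.congr_fun fun k => ?_)
  have hAc : ∀ a : ℂ, A (charField k a) = m k • charField k a := by
    intro a
    refine fc_ext fun l => ?_
    rw [hA', map_smul, fc_charField, smul_eq_mul]
    split_ifs with hl
    · rw [hl]
    · simp
  rw [ContinuousLinearMap.comp_apply, hAc, map_smul, integralL_charField, integralL_charField,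
    smul_smul]
  congr 1
  -- A character is not integrable on `ℝ³`. Cutting it off to the cell is harmless, because the
  -- segments issued from the support of `η` stay in the cell.
  have hgi : Integrable (cellY.indicator (char k)) := by
    rw [integrable_indicator_iff measurableSet_cellY]
    exact integrable_of_continuous (continuous_char k)
  have h3 := integral_segAvg_smul n hh hη hC hgi
  have h4 : ∫ y, (segAvg n h η y : ℂ) * char k y ∂muY =
      ∫ y, (segAvg n h η y : ℂ) • cellY.indicator (char k) y := by
    unfold muY
    rw [← integral_indicator measurableSet_cellY]
    refine integral_congr_ae (Eventually.of_forall fun y => ?_)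
    by_cases hy : y ∈ cellY <;> simp [hy]
  have h5 : ∫ y, (η y : ℂ) * char k y ∂muY = ∫ y, (η y : ℂ) * char k y := by
    unfold muY
    refine setIntegral_eq_integral_of_forall_compl_eq_zero fun y hy => ?_
    rw [image_eq_zero_of_notMem_tsupport fun h => hy (hs h)]; simp
  rw [h4, h3, h5, ← integral_const_mul]
  refine integral_congr_ae (Eventually.of_forall fun z => ?_)
  by_cases hz : z ∈ tsupport η
  · have h6 : ∫ s in (0 : ℝ)..h, cellY.indicator (char k) (z + s • n) = char k z * m k := by
      rw [← intervalIntegral.integral_const_mul]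
      refine intervalIntegral.integral_congr fun s hs' => ?_
      rw [Set.uIcc_of_le hh] at hs'
      rw [Set.indicator_of_mem (hsn z hz s hs'), char_add_right]
    simp only
    rw [h6, smul_eq_mul]; ring
  · simp [image_eq_zero_of_notMem_tsupport hz]

/-! ### Regularity of curl-free and divergence-free fields -/

/-- The `j`-th component of a field. -/
def cmp (j : Fin 3) (u : L2 C3) : L2 ℂ := (prC j).compLp u

theorem coeFn_cmp (j : Fin 3) (u : L2 C3) : ∀ᵐ y ∂muY, cmp j u y = u y j :=
  ContinuousLinearMap.coeFn_compLp _ _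

theorem fc_cmp (j : Fin 3) (u : L2 C3) (k : Fin 3 → ℤ) : fc k (cmp j u) = fc k u j :=
  fc_compLp _ _ _

theorem MemW12.isWeakPartial_cmp {u : L2 C3} (hu : MemW12 u) (i j : Fin 3) :
    IsWeakPartial i (cmp j u) (cmp j (wpd i u)) :=
  isWeakPartial_iff.2 fun k => by rw [fc_cmp, fc_cmp, hu.fc_wpd]; rfl

theorem wpd_symm_of_curl_eq_zero (u : L2 C3) : ∀ᵐ y ∂muY, curl u y = 0 →
    ∀ i j, wpd i u y j = wpd j u y i := by
  filter_upwards [curl_ae u] with y hy h0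
  rw [h0] at hy
  obtain ⟨h1, h2, h3⟩ := hy
  have h1 := (sub_eq_zero.1 h1.symm)
  have h2 := (sub_eq_zero.1 h2.symm)
  have h3 := (sub_eq_zero.1 h3.symm)
  intro i j
  fin_cases i <;> fin_cases j <;> first | rfl | assumption | (symm; assumption)

theorem pd_pd_comm {η : E3 → ℝ} (hη : ContDiff ℝ ∞ η) (i j : Fin 3) (y : E3) :
    pd i (pd j η) y = pd j (pd i η) y := by
  have hs : IsSymmSndFDerivAt ℝ η y :=
    (hη.contDiffAt).isSymmSndFDerivAt (by simp; exact WithTop.coe_le_coe.2 (OrderTop.le_top (2 : ℕ∞)))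
  have hd : DifferentiableAt ℝ (fderiv ℝ η) y :=
    ((hη.fderiv_right (m := ∞) (by simp)).differentiable (by simp)) y
  have e : ∀ i j, pd i (pd j η) y = fderiv ℝ (fderiv ℝ η) y (ee i) (ee j) := by
    intro i j
    have : pd j η = fun z => fderiv ℝ η z (ee j) := rfl
    rw [pd, this, fderiv_clm_apply hd (differentiableAt_const _)]
    simp [ee]
  rw [e, e, hs.eq]

/-- Weak form of `Δuⱼ = Σₘ ∂ₘ∂ₘuⱼ = Σₘ ∂ₘ∂ⱼuₘ = ∂ⱼ div u = 0`, the second equality being the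
vanishing of the curl. Every derivative beyond the first falls on `η`. -/
theorem isWeakHarmonic_cmp {u : L2 C3} (hu : MemW12 u) {Ω : Set E3} (hΩY : Ω ⊆ cellY)
    (hc : ∀ᵐ y ∂muY, y ∈ Ω → curl u y = 0) (hd : ∀ᵐ y ∂muY, dvg u y = 0) (j : Fin 3) :
    IsWeakHarmonic Ω (cmp j u) := by
  intro η hη hs
  have hpd : ∀ m, tsupport (pd m η) ⊆ Ω := fun m =>
    (tsupport_fderiv_apply_subset ℝ (ee m)).trans hs
  have hpc : ∀ (φ : E3 → ℝ), ContDiff ℝ ∞ φ → Continuous fun y => (φ y : ℂ) :=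
    fun φ hφ => Complex.continuous_ofReal.comp hφ.continuous
  have hpp : ∀ a b, ContDiff ℝ ∞ (pd a (pd b η)) := fun a b => contDiff_pd (contDiff_pd hη b) a
  have e1 : ∫ y, ((∑ i, pd i (pd i η) y : ℝ) : ℂ) • cmp j u y ∂muY =
      ∑ m, ∫ y, (pd m (pd m η) y : ℂ) • cmp j u y ∂muY := by
    rw [← integral_finsetSum _ fun m _ => integrable_smul (hpc _ (hpp m m)) (cmp j u)]
    refine integral_congr_ae (Eventually.of_forall fun y => ?_)
    simp only
    rw [Complex.ofReal_sum, Finset.sum_smul]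
  have e2 : ∀ m, ∫ y, (pd m (pd m η) y : ℂ) • cmp j u y ∂muY =
      ∫ y, (pd m (pd j η) y : ℂ) • cmp m u y ∂muY := by
    intro m
    simp_rw [pd_pd_comm hη m j]
    rw [(hu.isWeakPartial_cmp m j).integral_eq (contDiff_pd hη m) ((hpd m).trans hΩY),
      (hu.isWeakPartial_cmp j m).integral_eq (contDiff_pd hη m) ((hpd m).trans hΩY), neg_inj]
    refine integral_congr_ae ?_
    filter_upwards [coeFn_cmp j (wpd m u), coeFn_cmp m (wpd j u), hc, wpd_symm_of_curl_eq_zero u]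
      with y h1 h2 h3 h4
    by_cases hy : y ∈ tsupport (pd m η)
    · rw [h1, h2, h4 (h3 (hpd m hy))]
    · rw [image_eq_zero_of_notMem_tsupport (f := pd m η) hy]; simp
  rw [e1, Finset.sum_congr rfl fun m _ => e2 m, Finset.sum_congr rfl fun m _ =>
    (hu.isWeakPartial_cmp m m).integral_eq (contDiff_pd hη j) ((hpd j).trans hΩY),
    Finset.sum_neg_distrib, neg_eq_zero, ← integral_finsetSum _ fun m _ =>
      integrable_smul (hpc _ (contDiff_pd hη j)) (cmp m (wpd m u))]
  refine integral_eq_zero_of_ae ?_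
  filter_upwards [hd, coeFn_cmp 0 (wpd 0 u), coeFn_cmp 1 (wpd 1 u), coeFn_cmp 2 (wpd 2 u)]
    with y h h0 h1 h2
  rw [← Finset.smul_sum, Fin.sum_univ_three, h0, h1, h2]
  rw [dvg, Fin.sum_univ_three] at h
  rw [h]; simp

theorem exists_smooth_representative {u : L2 C3} (hu : MemW12 u) {Ω : Set E3} (hΩ : IsOpen Ω)
    (hΩY : Ω ⊆ cellY) (hc : ∀ᵐ y ∂muY, y ∈ Ω → curl u y = 0) (hd : ∀ᵐ y ∂muY, dvg u y = 0) :
    ∃ U : Fin 3 → E3 → ℂ, (∀ j, ContDiffOn ℝ ∞ (U j) Ω) ∧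
      (∀ j, ∀ᵐ y ∂muY, y ∈ Ω → u y j = U j y) ∧
      ∀ a ∈ Ω, ∀ i j, fderiv ℝ (U j) a (ee i) = fderiv ℝ (U i) a (ee j) := by
  choose U hU hUe using fun j => (isWeakHarmonic_cmp hu hΩY hc hd j).exists_contDiffOn hΩ
  have hU1 : ∀ j, ContDiffOn ℝ 1 (U j) Ω := fun j => (hU j).of_le (by simp)
  have hcont : ∀ i j, ContinuousOn (fun a => fderiv ℝ (U j) a (ee i)) Ω := fun i j =>
    ((hU1 j).continuousOn_fderiv_of_isOpen hΩ le_rfl).clm_apply continuousOn_const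
  refine ⟨U, hU, fun j => ?_, fun a ha i j => ?_⟩
  · filter_upwards [hUe j, coeFn_cmp j u] with y h1 h2 hy
    rw [← h2, h1 hy]
  · have h : ∀ i j, ∀ᵐ y ∂muY, y ∈ Ω → wpd i u y j = fderiv ℝ (U j) y (ee i) := fun i j => by
      filter_upwards [(hu.isWeakPartial_cmp i j).ae_eq_fderiv hΩ hΩY (hU1 j) (hUe j),
        coeFn_cmp j (wpd i u)] with y h1 h2 hy
      rw [← h2, h1 hy]
    have h' : (fun a => fderiv ℝ (U j) a (ee i)) =ᵐ[volume.restrict Ω]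
        fun a => fderiv ℝ (U i) a (ee j) := by
      have : ∀ᵐ y ∂muY, y ∈ Ω → fderiv ℝ (U j) y (ee i) = fderiv ℝ (U i) y (ee j) := by
        filter_upwards [h i j, h j i, hc, wpd_symm_of_curl_eq_zero u] with y h1 h2 h3 h4 hy
        rw [← h1 hy, ← h2 hy, h4 (h3 hy)]
      have := (ae_restrict_iff' hΩ.measurableSet).2 this
      rwa [muY, Measure.restrict_restrict_of_subset hΩY] at this
    -- The symmetry of the Jacobian is known almost everywhere; both sides are continuous, so it
    -- holds at every point.
    exact Measure.eqOn_open_of_ae_eq h' hΩ (hcont i j) (hcont j i) ha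

theorem ee_sum (x : E3) : x = ∑ i, x i • ee i := by
  ext j
  rw [Fin.sum_univ_three]
  fin_cases j <;> simp [ee]

/-- A curl-free smooth field on a simply connected open set is a gradient. -/
theorem exists_primitive_of_symm {Ω : Set E3} (hΩ : IsOpen Ω) (hsc : IsSimplyConnected Ω)
    {U : Fin 3 → E3 → ℂ} (hU : ∀ j, ContDiffOn ℝ ∞ (U j) Ω)
    (hsymm : ∀ a ∈ Ω, ∀ i j, fderiv ℝ (U j) a (ee i) = fderiv ℝ (U i) a (ee j)) :
    ∃ w : E3 → ℂ, ContDiffOn ℝ 1 w Ω ∧ (∀ a ∈ Ω, DifferentiableAt ℝ w a) ∧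
      ∀ a ∈ Ω, ∀ x : E3, fderiv ℝ w a x = ∑ j, (x j : ℂ) * U j a := by
  let P : Fin 3 → ℂ →L[ℝ] E3 →L[ℝ] ℂ := fun j =>
    (ContinuousLinearMap.smulRightL ℝ E3 ℂ (EuclideanSpace.proj j))
  have hP : ∀ j c x, P j c x = (x j : ℂ) * c := fun j c x => by
    simp [P, ContinuousLinearMap.smulRightL]
  let θ : E3 → E3 →L[ℝ] ℂ := fun a => ∑ j, P j (U j a)
  have hUd : ∀ j, ∀ a ∈ Ω, DifferentiableAt ℝ (U j) a := fun j a ha =>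
    ((hU j).contDiffAt (hΩ.mem_nhds ha)).differentiableAt (by simp)
  have hθ' : ∀ a ∈ Ω, HasFDerivAt θ (∑ j, (P j).comp (fderiv ℝ (U j) a)) a := fun a ha =>
    HasFDerivAt.fun_sum fun j _ => (P j).hasFDerivAt.comp a (hUd j a ha).hasFDerivAt
  have hθx : ∀ a x, θ a x = ∑ j, (x j : ℂ) * U j a := fun a x => by
    simp only [θ, _root_.sum_apply, hP]
  obtain ⟨w, hw⟩ := exists_primitive hΩ hsc (θ := θ)
    (fun a ha => (hθ' a ha).differentiableAt.differentiableWithinAt) (fun a ha x y => by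
      have e : ∀ x y : E3, fderiv ℝ θ a x y =
          ∑ j, ∑ i, ((y j : ℂ) * (x i : ℂ)) * fderiv ℝ (U j) a (ee i) := by
        intro x y
        rw [(hθ' a ha).fderiv]
        simp only [_root_.sum_apply, ContinuousLinearMap.comp_apply, hP]
        refine Finset.sum_congr rfl fun j _ => ?_
        conv_lhs => rw [ee_sum x, map_sum]
        rw [Finset.mul_sum]
        refine Finset.sum_congr rfl fun i _ => ?_
        rw [map_smul, Complex.real_smul, mul_assoc]
      rw [e, e, Finset.sum_comm]
      refine Finset.sum_congr rfl fun i _ => Finset.sum_congr rfl fun j _ => ?_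
      rw [hsymm a ha i j]; ring)
  refine ⟨w, ?_, fun a ha => (hw a ha).differentiableAt, fun a ha x => ?_⟩
  · rw [show (1 : WithTop ℕ∞) = 0 + 1 from rfl, contDiffOn_succ_iff_fderiv_of_isOpen hΩ]
    refine ⟨fun a ha => (hw a ha).differentiableAt.differentiableWithinAt, by simp, ?_⟩
    rw [contDiffOn_zero]
    exact ContinuousOn.congr (f := θ) (fun a ha => (hθ' a ha).continuousAt.continuousWithinAt)
      fun a ha => (hw a ha).fderiv
  · rw [(hw a ha).fderiv, hθx]

/-! ### Products with smooth periodic functions -/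

/-- The product of a field with a continuous function. -/
def mulL2 {φ : E3 → ℝ} (hφ : Continuous φ) (v : L2 ℂ) : L2 ℂ :=
  (memLp_smul (Complex.continuous_ofReal.comp hφ) v).toLp _

theorem coeFn_mulL2 {φ : E3 → ℝ} (hφ : Continuous φ) (v : L2 ℂ) :
    ∀ᵐ y ∂muY, mulL2 hφ v y = φ y * v y :=
  (memLp_smul (Complex.continuous_ofReal.comp hφ) v).coeFn_toLp

theorem IsWeakPartial.mulL2 {i : Fin 3} {v g : L2 ℂ} (h : IsWeakPartial i v g) {φ : E3 → ℝ}
    (hφ : IsPeriodicSmooth φ) : IsWeakPartial i (mulL2 hφ.continuous v)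
      (mulL2 hφ.continuous g + MagneticCell.mulL2 (hφ.pd i).continuous v) := by
  rw [isWeakPartial_iff_complex] at h ⊢
  intro χ hχ
  have h1 := h _ (hχ.mul hφ)
  simp_rw [pd_mul (hχ.differentiable _) (hφ.differentiable _)] at h1
  have i1 := integrable_smul (φ := fun y => (χ y : ℂ) * (pd i φ y : ℂ))
    (hχ.ofReal_continuous.mul (hφ.pd i).ofReal_continuous) v
  have i2 := integrable_smul (φ := fun y => (φ y : ℂ) * (pd i χ y : ℂ))
    (hφ.ofReal_continuous.mul (hχ.pd i).ofReal_continuous) v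
  have i3 := integrable_smul (φ := fun y => (χ y : ℂ) * (φ y : ℂ))
    (hχ.ofReal_continuous.mul hφ.ofReal_continuous) g
  have e1 : ∫ y, ((χ y * pd i φ y + φ y * pd i χ y : ℝ) : ℂ) • v y ∂muY =
      ∫ y, ((χ y : ℂ) * (pd i φ y : ℂ)) • v y ∂muY + ∫ y, ((φ y : ℂ) * (pd i χ y : ℂ)) • v y ∂muY := by
    rw [← integral_add i1 i2]
    refine integral_congr_ae (Eventually.of_forall fun y => ?_)
    simp only; push_cast; rw [add_smul]
  have e2 : ∫ y, (pd i χ y : ℂ) • MagneticCell.mulL2 hφ.continuous v y ∂muY =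
      ∫ y, ((φ y : ℂ) * (pd i χ y : ℂ)) • v y ∂muY := by
    refine integral_congr_ae ?_
    filter_upwards [coeFn_mulL2 hφ.continuous v] with y hy
    rw [hy]; simp only [smul_eq_mul]; ring
  have e3 : ∫ y, (χ y : ℂ) • (MagneticCell.mulL2 hφ.continuous g +
      MagneticCell.mulL2 (hφ.pd i).continuous v : L2 ℂ) y ∂muY =
      ∫ y, ((χ y : ℂ) * (φ y : ℂ)) • g y ∂muY + ∫ y, ((χ y : ℂ) * (pd i φ y : ℂ)) • v y ∂muY := by
    rw [← integral_add i3 i1]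
    refine integral_congr_ae ?_
    filter_upwards [coeFn_mulL2 hφ.continuous g, coeFn_mulL2 (hφ.pd i).continuous v,
      Lp.coeFn_add (MagneticCell.mulL2 hφ.continuous g)
        (MagneticCell.mulL2 (hφ.pd i).continuous v)] with y h1 h2 h3
    rw [h3, Pi.add_apply, h1, h2]; simp only [smul_eq_mul]; ring
  rw [e1] at h1
  push_cast at h1
  rw [e2, e3]
  linear_combination h1

theorem MemW12.mulL2 {v : L2 ℂ} (h : MemW12 v) {φ : E3 → ℝ} (hφ : IsPeriodicSmooth φ) :
    MemW12 (mulL2 hφ.continuous v) :=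
  fun i => ⟨_, (h.isWeakPartial i).mulL2 hφ⟩

/-! ### Extension of primitives across the Lipschitz boundary -/

theorem memW12_zero : MemW12 (0 : L2 ℂ) :=
  memW12_of_fc (g := fun _ => 0) fun i k => by simp

/-- The average along `n` of a directional derivative is a difference. -/
theorem integral_segAvg_smul_eq_sub {Ω : Set E3} (hΩ : IsOpen Ω) (hΩY : Ω ⊆ cellY) {w : E3 → ℂ}
    (hw : ContDiffOn ℝ 1 w Ω) {n : E3} {v : L2 ℂ}
    (hv : ∀ᵐ y ∂muY, y ∈ Ω → v y = fderiv ℝ w y n) {h : ℝ} (hh : 0 ≤ h) {η : E3 → ℝ}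
    (hη : Continuous η) (hs : ∀ y ∈ tsupport η, ∀ s ∈ Set.Icc 0 h, y + s • n ∈ Ω) :
    ∫ y, (segAvg n h η y : ℂ) • v y ∂muY =
      ∫ z, (η z : ℂ) • (w (z + h • n) - w z) ∂muY := by
  have hs0 : tsupport η ⊆ cellY := fun y hy =>
    hΩY (by simpa using hs y hy 0 ⟨le_rfl, hh⟩)
  have hηc : HasCompactSupport η := isCompact_of_subset_cellY (isClosed_tsupport η) hs0
  obtain ⟨C, hC⟩ := hη.bounded_above_of_compact_support hηc
  have hcont : ContinuousOn (fun y => fderiv ℝ w y n) Ω :=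
    (hw.continuousOn_fderiv_of_isOpen hΩ le_rfl).clm_apply continuousOn_const
  -- The compact set swept by the segments. The derivative of `w` need not be integrable on all of
  -- `Ω`, but it is on `K`, and the segment average of `η` vanishes off `K`.
  set K : Set E3 := (fun p : E3 × ℝ => p.1 + p.2 • n) '' (tsupport η ×ˢ Set.Icc 0 h) with hK
  have hKc : IsCompact K := (hηc.prod isCompact_Icc).image (by fun_prop)
  have hKΩ : K ⊆ Ω := by
    rintro _ ⟨⟨y, s⟩, ⟨hy, hs'⟩, rfl⟩
    exact hs y hy s hs'
  have hgi : Integrable (K.indicator fun y => fderiv ℝ w y n) := by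
    rw [integrable_indicator_iff hKc.measurableSet]
    exact (hcont.mono hKΩ).integrableOn_compact hKc
  have hseg : ∀ y ∉ K, segAvg n h η y = 0 := by
    intro y hy
    rw [segAvg]
    refine intervalIntegral.integral_zero_ae (Eventually.of_forall fun s hs' => ?_)
    rw [Set.uIoc_of_le hh] at hs'
    refine image_eq_zero_of_notMem_tsupport fun hmem => hy ?_
    exact ⟨(y - s • n, s), ⟨hmem, hs'.1.le, hs'.2⟩, by simp⟩
  have e1 : ∫ y, (segAvg n h η y : ℂ) • v y ∂muY =
      ∫ y, (segAvg n h η y : ℂ) • K.indicator (fun y => fderiv ℝ w y n) y := by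
    have e2 : ∫ y, (segAvg n h η y : ℂ) • K.indicator (fun y => fderiv ℝ w y n) y =
        ∫ y, (segAvg n h η y : ℂ) • K.indicator (fun y => fderiv ℝ w y n) y ∂muY := by
      unfold muY
      refine (setIntegral_eq_integral_of_forall_compl_eq_zero fun y hy => ?_).symm
      rw [hseg y fun h => hy (hΩY (hKΩ h))]; simp
    rw [e2]
    refine integral_congr_ae ?_
    filter_upwards [hv] with y hy
    by_cases hyK : y ∈ K
    · rw [hy (hKΩ hyK), Set.indicator_of_mem hyK]
    · rw [hseg y hyK]; simp
  have e3 : ∫ z, (η z : ℂ) • (w (z + h • n) - w z) ∂muY =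
      ∫ z, (η z : ℂ) • (w (z + h • n) - w z) := by
    unfold muY
    refine setIntegral_eq_integral_of_forall_compl_eq_zero fun y hy => ?_
    rw [image_eq_zero_of_notMem_tsupport fun h => hy (hs0 h)]; simp
  rw [e1, e3, integral_segAvg_smul n hh hη hC hgi]
  refine integral_congr_ae (Eventually.of_forall fun z => ?_)
  by_cases hz : z ∈ tsupport η
  swap
  · simp [image_eq_zero_of_notMem_tsupport hz]
  simp only
  congr 1
  have e4 : ∫ s in (0 : ℝ)..h, K.indicator (fun y => fderiv ℝ w y n) (z + s • n) =
      ∫ s in (0 : ℝ)..h, fderiv ℝ w (z + s • n) n := by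
    refine intervalIntegral.integral_congr fun s hs' => ?_
    rw [Set.uIcc_of_le hh] at hs'
    exact Set.indicator_of_mem (s := K) ⟨(z, s), ⟨hz, hs'⟩, rfl⟩ _
  have hmaps : Set.MapsTo (fun s : ℝ => z + s • n) (Set.uIcc 0 h) Ω := by
    intro s hs'
    rw [Set.uIcc_of_le hh] at hs'
    exact hs z hz s hs'
  rw [e4, intervalIntegral.integral_eq_sub_of_hasDerivAt (f := fun s : ℝ => w (z + s • n))]
  · simp
  · intro s hs'
    have h1 : HasDerivAt (fun s : ℝ => z + s • n) n s := by
      simpa using ((hasDerivAt_id s).smul_const n).const_add z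
    have h2 : HasFDerivAt w (fderiv ℝ w (z + s • n)) (z + s • n) :=
      ((hw.contDiffAt (hΩ.mem_nhds (hmaps hs'))).differentiableAt (by simp)).hasFDerivAt
    exact h2.comp_hasDerivAt s h1
  · exact (hcont.comp (by fun_prop) hmaps).intervalIntegrable

/-- The extension is `w(y + hn) - ∫₀ʰ v(y + sn) ds`. The first term, cut off near `x`, is `C¹`
because the endpoints lie in `Ω` for every `y` of the ball; the second is in `W^{1,2}` with `v`,
wherever the segments go. For `y` in `Ω` the segment stays in `Ω` and the fundamental theorem of
calculus returns `w(y)`. -/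
theorem exists_extension_of_transversal {Ω : Set E3} (hΩ : IsOpen Ω) (hΩY : Ω ⊆ cellY) {w : E3 → ℂ}
    (hw : ContDiffOn ℝ 1 w Ω) {n : E3} {v : L2 ℂ} (hvW : MemW12 v)
    (hv : ∀ᵐ y ∂muY, y ∈ Ω → v y = fderiv ℝ w y n) {h : ℝ} (hh : 0 ≤ h) {x : E3} {r : ℝ}
    (hr : 0 < r) (hY : Metric.ball x r ⊆ cellY)
    (hend : ∀ y ∈ Metric.ball x r, y + h • n ∈ Ω)
    (hseg : ∀ y ∈ Metric.ball x r, y ∈ Ω → ∀ s ∈ Set.Icc 0 h, y + s • n ∈ Ω) :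
    ∃ V, IsOpen V ∧ x ∈ V ∧ ∃ ψ : L2 ℂ, MemW12 ψ ∧ ∀ᵐ y ∂muY, y ∈ V ∩ Ω → ψ y = w y := by
  obtain ⟨χ, hχ, hχs, -, V, hV, hxV, hχ1⟩ := exists_cutoff (isCompact_singleton (x := x))
    Metric.isOpen_ball (Set.singleton_subset_iff.2 (Metric.mem_ball_self hr))
  obtain ⟨A, hAW, hA⟩ := exists_segAvgL n hh
  have hχC : ContDiff ℝ ∞ fun y => (χ y : ℂ) := Complex.ofRealCLM.contDiff.comp hχ
  have hGs : tsupport (fun y => (χ y : ℂ) * w (y + h • n)) ⊆ tsupport χ :=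
    tsupport_subset_of_eq_zero fun z hz => by simp [hz]
  have hG : ContDiff ℝ 1 fun y => (χ y : ℂ) * w (y + h • n) := by
    refine contDiff_of_forall_mem_tsupport fun y hy => ?_
    have hy' := hend y (hχs (hGs hy))
    refine (hχC.contDiffAt.of_le (by simp)).mul ?_
    exact (hw.contDiffAt (hΩ.mem_nhds hy')).comp y (contDiff_id.add contDiff_const).contDiffAt
  have hGY := (hGs.trans hχs).trans hY
  refine ⟨V ∩ Metric.ball x r, hV.inter Metric.isOpen_ball,
    ⟨hxV rfl, Metric.mem_ball_self hr⟩,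
    (memLp_of_continuous hG.continuous).toLp _ - A v, (memW12_toLp hG hGY).sub (hAW v hvW), ?_⟩
  refine ae_eq_of_forall_integral_eq ((hV.inter Metric.isOpen_ball).inter hΩ)
    (hw.continuousOn.mono Set.inter_subset_right) fun η hη hs => ?_
  have hηC : Continuous fun y => (η y : ℂ) := Complex.continuous_ofReal.comp hη.continuous
  have hsΩ : ∀ y ∈ tsupport η, ∀ s ∈ Set.Icc 0 h, y + s • n ∈ Ω := fun y hy =>
    hseg y (hs hy).1.2 (hs hy).2
  have h1 := hA η hη.continuous (hs.trans (Set.inter_subset_right.trans hΩY))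
    (fun y hy s hs' => hΩY (hsΩ y hy s hs')) v
  rw [integral_segAvg_smul_eq_sub hΩ hΩY hw hv hh hη.continuous hsΩ] at h1
  have i1 := integrable_smul hηC ((memLp_of_continuous hG.continuous).toLp _)
  have i2 := integrable_smul hηC (A v)
  have e1 : ∫ y, (η y : ℂ) • ((memLp_of_continuous hG.continuous).toLp _ - A v : L2 ℂ) y ∂muY =
      ∫ y, (η y : ℂ) • (memLp_of_continuous hG.continuous).toLp _ y ∂muY -
      ∫ y, (η y : ℂ) • A v y ∂muY := by
    rw [← integral_sub i1 i2]
    refine integral_congr_ae ?_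
    filter_upwards [Lp.coeFn_sub ((memLp_of_continuous hG.continuous).toLp _) (A v)] with y hy
    rw [hy, Pi.sub_apply, smul_sub]
  have hint : ∀ g : E3 → ℂ, (∀ y ∈ tsupport η, ContinuousAt g y) →
      Integrable (fun y => (η y : ℂ) • g y) muY := by
    intro g hg
    refine integrable_of_continuous (continuous_of_tsupport fun y hy => ?_)
    exact hηC.continuousAt.smul
      (hg y (tsupport_subset_of_eq_zero (fun z h0 => by simp [h0]) hy))
  have hwc : ∀ y ∈ Ω, ContinuousAt w y := fun y hy =>
    hw.continuousOn.continuousAt (hΩ.mem_nhds hy)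
  have i3 := hint (fun y => w (y + h • n)) fun y hy =>
    (hwc _ (hsΩ y hy h ⟨hh, le_rfl⟩)).comp (f := fun y => y + h • n) (by fun_prop)
  have i4 := hint w fun y hy => hwc y (hs hy).2
  have e2 : ∫ y, (η y : ℂ) • (memLp_of_continuous hG.continuous).toLp _ y ∂muY =
      ∫ y, (η y : ℂ) • w (y + h • n) ∂muY := by
    refine integral_congr_ae ?_
    filter_upwards [(memLp_of_continuous hG.continuous).coeFn_toLp] with y hy
    rw [hy]
    by_cases hyη : y ∈ tsupport η
    · rw [hχ1 y (hs hyη).1.1]; simp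
    · rw [image_eq_zero_of_notMem_tsupport hyη]; simp
  rw [e1, e2, h1]
  simp_rw [smul_sub]
  rw [integral_sub i3 i4, sub_sub_cancel]

theorem exists_local_extension {S : Set E3} (hS : IsInclusion S) {w : E3 → ℂ}
    (hw : ContDiffOn ℝ 1 w (cellY \ S))
    (hv : ∀ n : E3, ∃ v : L2 ℂ, MemW12 v ∧ ∀ᵐ y ∂muY, y ∈ cellY \ S → v y = fderiv ℝ w y n)
    {x : E3} (hx : x ∈ S) :
    ∃ V, IsOpen V ∧ x ∈ V ∧ ∃ ψ : L2 ℂ, MemW12 ψ ∧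
      ∀ᵐ y ∂muY, y ∈ V ∩ (cellY \ S) → ψ y = w y := by
  have hΩ : IsOpen (cellY \ S) := isOpen_cellY.sdiff hS.isCompact.isClosed
  by_cases hxi : x ∈ interior S
  · exact ⟨interior S, isOpen_interior, hxi, 0, memW12_zero, Eventually.of_forall fun y hy =>
      absurd (interior_subset hy.1) hy.2.2⟩
  have hxf : x ∈ frontier S := ⟨subset_closure hx, hxi⟩
  obtain ⟨U, hU, hxU, e, γ, ⟨K, hγ⟩, hUS⟩ := hS.lipschitz x hxf
  obtain ⟨R, hR, hball⟩ := Metric.isOpen_iff.1 (hU.inter isOpen_cellY) x ⟨hxU, hS.subset_cell hx⟩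
  set n : E3 := e.symm (ee 2) with hn
  have hnorm : ‖n‖ = 1 := by rw [hn, LinearIsometryEquiv.norm_map]; simp [ee]
  have he : ∀ (y : E3) (s : ℝ), e (y + s • n) = e y + s • ee 2 := by
    intro y s; rw [map_add, map_smul, hn, LinearIsometryEquiv.apply_symm_apply]
  have he2 : ∀ (y : E3) (s : ℝ), e (y + s • n) 2 = e y 2 + s := by
    intro y s; rw [he]; simp [ee]
  have he0 : ∀ (y : E3) (s : ℝ), e (y + s • n) 0 = e y 0 := by
    intro y s; rw [he]; simp [ee]
  have he1 : ∀ (y : E3) (s : ℝ), e (y + s • n) 1 = e y 1 := by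
    intro y s; rw [he]; simp [ee]
  -- Strictly below the graph, a whole neighbourhood of `x` would lie in `S`.
  have hx2 : γ (e x 0, e x 1) ≤ e x 2 := by
    by_contra! hlt
    refine hxi (mem_interior_iff_mem_nhds.2 ?_)
    have hc1 : Continuous fun y : E3 => e y 2 := by fun_prop
    have hc2 : Continuous fun y : E3 => γ (e y 0, e y 1) := hγ.continuous.comp (by fun_prop)
    filter_upwards [hU.mem_nhds hxU, hc1.continuousAt.eventually_lt hc2.continuousAt hlt]
      with y hyU hy
    exact (hUS y hyU).2 hy.le
  have hnotS : ∀ y s, 0 ≤ s → y ∈ U → y + s • n ∈ U → γ (e y 0, e y 1) < e y 2 + s →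
      y + s • n ∉ S := by
    intro y s hs hy hys hlt hmem
    have := (hUS _ hys).1 hmem
    rw [he0, he1, he2] at this
    exact absurd this (not_le.2 hlt)
  have hmem : ∀ y s r, 0 ≤ s → s ≤ R / 2 → r ≤ R / 2 → y ∈ Metric.ball x r →
      y + s • n ∈ Metric.ball x R := by
    intro y s r h0 h1 h2 hy
    rw [Metric.mem_ball, dist_eq_norm] at hy ⊢
    calc ‖y + s • n - x‖ = ‖(y - x) + s • n‖ := by congr 1; abel
      _ ≤ ‖y - x‖ + ‖s • n‖ := norm_add_le _ _
      _ < R := by rw [norm_smul, hnorm, Real.norm_of_nonneg h0]; linarith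
  have hp : x + (R / 2) • n ∈ cellY \ S := by
    have h1 := hmem x (R / 2) (R / 2) (by linarith) le_rfl le_rfl
      (Metric.mem_ball_self (by linarith))
    exact ⟨(hball h1).2, hnotS x _ (by linarith) hxU (hball h1).1 (by linarith)⟩
  obtain ⟨r0, hr0, hball0⟩ := Metric.isOpen_iff.1 hΩ _ hp
  obtain ⟨v, hvW, hve⟩ := hv n
  have hrR : min r0 (R / 2) ≤ R / 2 := min_le_right _ _
  have hsub : Metric.ball x (min r0 (R / 2)) ⊆ Metric.ball x R :=
    Metric.ball_subset_ball (by linarith)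
  -- Moving along `n` by `R/2` puts `x` strictly above the graph. The radius is small enough for all
  -- endpoints to lie in the ball found around `x + (R/2) n`, and for all segments to stay in the
  -- ball of radius `R`.
  refine exists_extension_of_transversal hΩ Set.sdiff_subset hw hvW hve (h := R / 2) (by linarith)
    (r := min r0 (R / 2)) (lt_min hr0 (by linarith)) (fun y hy => (hball (hsub hy)).2)
    (fun y hy => hball0 ?_) (fun y hy hyΩ s hs => ?_)
  · rw [Metric.mem_ball, dist_add_right]
    exact lt_of_lt_of_le hy (min_le_left _ _)
  · have h1 := hmem y s _ hs.1 hs.2 hrR hy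
    have hyU := (hball (hsub hy)).1
    refine ⟨(hball h1).2, hnotS y s hs.1 hyU (hball h1).1 ?_⟩
    have := mt (hUS y hyU).2 hyΩ.2
    linarith [not_le.1 this, hs.1]

/-- Compactness of `S` reduces the claim to gluing two local extensions. The induction property
concerns `closure A ∩ S`, a compact set, so that a cutoff equal to `1` near it exists. -/
theorem exists_extension {S : Set E3} (hS : IsInclusion S) {w : E3 → ℂ}
    (hw : ContDiffOn ℝ 1 w (cellY \ S))
    (hv : ∀ n : E3, ∃ v : L2 ℂ, MemW12 v ∧ ∀ᵐ y ∂muY, y ∈ cellY \ S → v y = fderiv ℝ w y n) :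
    ∃ ψ : L2 ℂ, MemW12 ψ ∧ ∃ W, IsOpen W ∧ S ⊆ W ∧
      ∀ᵐ y ∂muY, y ∈ W ∩ (cellY \ S) → ψ y = w y := by
  have key : ∃ ψ : L2 ℂ, MemW12 ψ ∧ ∃ W, IsOpen W ∧ closure S ∩ S ⊆ W ∧
      ∀ᵐ y ∂muY, y ∈ W ∩ (cellY \ S) → ψ y = w y := by
    refine hS.isCompact.induction_on (p := fun A => ∃ ψ : L2 ℂ, MemW12 ψ ∧ ∃ W, IsOpen W ∧
      closure A ∩ S ⊆ W ∧ ∀ᵐ y ∂muY, y ∈ W ∩ (cellY \ S) → ψ y = w y) ?_ ?_ ?_ ?_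
    · exact ⟨0, memW12_zero, ∅, isOpen_empty, by simp, Eventually.of_forall fun y hy => hy.1.elim⟩
    · rintro A B hAB ⟨ψ, hψ, W, hW, hBW, h⟩
      exact ⟨ψ, hψ, W, hW, (Set.inter_subset_inter_left _ (closure_mono hAB)).trans hBW, h⟩
    · rintro A B ⟨ψ, hψ, W, hW, hAW, h⟩ ⟨ψ', hψ', W', hW', hBW', h'⟩
      obtain ⟨χ, hχ, hχs, -, V, hV, hAV, hχ1⟩ := exists_cutoff
        (hS.isCompact.inter_left (isClosed_closure (s := A))) (hW.inter isOpen_cellY)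
        (Set.subset_inter hAW (Set.inter_subset_right.trans hS.subset_cell))
      have hχp := isPeriodicSmooth_periodize hχ (hχs.trans Set.inter_subset_right)
      -- This is `χψ + (1 - χ)ψ'`. Outside `S` it equals `w` on `V ∩ W`, where `χ = 1`, and on `W'`,
      -- where `ψ' = w` and also `ψ = w` on the support of `χ`.
      refine ⟨ψ' + mulL2 hχp.continuous (ψ - ψ'), hψ'.add ((hψ.sub hψ').mulL2 hχp),
        (V ∩ W) ∪ W', (hV.inter hW).union hW', ?_, ?_⟩
      · rw [closure_union, Set.union_inter_distrib_right]
        exact Set.union_subset_union (Set.subset_inter hAV hAW) hBW'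
      · filter_upwards [h, h', Lp.coeFn_add ψ' (mulL2 hχp.continuous (ψ - ψ')),
          coeFn_mulL2 hχp.continuous (ψ - ψ'), Lp.coeFn_sub ψ ψ', ae_muY_mem]
          with y h1 h2 h3 h4 h5 hyY
        rintro ⟨hyW, hyΩ⟩
        rw [h3, Pi.add_apply, h4, h5, Pi.sub_apply, periodize_eq χ hyY]
        rcases hyW with ⟨hyV, hyW⟩ | hyW'
        · rw [hχ1 y hyV, h1 ⟨hyW, hyΩ⟩]; push_cast; ring
        · rw [h2 ⟨hyW', hyΩ⟩]
          by_cases hyχ : y ∈ tsupport χ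
          · rw [h1 ⟨(hχs hyχ).1, hyΩ⟩]; ring
          · rw [image_eq_zero_of_notMem_tsupport hyχ]; simp
    · intro x hx
      obtain ⟨V, hV, hxV, ψ, hψ, h⟩ := exists_local_extension hS hw hv hx
      obtain ⟨ε, hε, hball⟩ := Metric.nhds_basis_closedBall.mem_iff.1 (hV.mem_nhds hxV)
      refine ⟨Metric.closedBall x ε, mem_nhdsWithin_of_mem_nhds (Metric.closedBall_mem_nhds x hε),
        ψ, hψ, V, hV, ?_, h⟩
      rw [Metric.isClosed_closedBall.closure_eq]
      exact Set.inter_subset_left.trans hball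
  obtain ⟨ψ, hψ, W, hW, hSW, h⟩ := key
  exact ⟨ψ, hψ, W, hW, fun y hy => hSW ⟨subset_closure hy, hy⟩, h⟩

/-- A curl-free and divergence-free field is near `S` the gradient of a function of `W^{1,2}_♯`. -/
theorem exists_gradient_near {S : Set E3} (hS : IsInclusion S) {u : L2 C3} (hu : MemW12 u)
    (hc : ∀ᵐ y ∂muY, y ∈ cellY \ S → curl u y = 0) (hd : ∀ᵐ y ∂muY, dvg u y = 0) :
    ∃ ψ : L2 ℂ, MemW12 ψ ∧ ∃ W, IsOpen W ∧ S ⊆ W ∧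
      ∀ᵐ y ∂muY, y ∈ W ∩ (cellY \ S) → ∀ j, u y j = wpd j ψ y := by
  have hΩ : IsOpen (cellY \ S) := isOpen_cellY.sdiff hS.isCompact.isClosed
  obtain ⟨U, hU, hue, hsymm⟩ := exists_smooth_representative hu hΩ Set.sdiff_subset hc hd
  obtain ⟨w, hw, -, hwU⟩ := exists_primitive_of_symm hΩ hS.compl_simplyConnected hU hsymm
  -- The derivative of `w` along `n` is `n · u`, whose components are globally in `W^{1,2}_♯`; this
  -- is what the averaging construction requires.
  obtain ⟨ψ, hψ, W, hW, hSW, h⟩ := exists_extension hS hw fun n => by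
    have hcW : ∀ j, MemW12 ((n j : ℂ) • cmp j u) := fun j i =>
      ⟨_, (hu.isWeakPartial_cmp i j).smul _⟩
    refine ⟨(n 0 : ℂ) • cmp 0 u + (n 1 : ℂ) • cmp 1 u + (n 2 : ℂ) • cmp 2 u,
      ((hcW 0).add (hcW 1)).add (hcW 2), ?_⟩
    filter_upwards [Lp.coeFn_add ((n 0 : ℂ) • cmp 0 u + (n 1 : ℂ) • cmp 1 u)
      ((n 2 : ℂ) • cmp 2 u), Lp.coeFn_add ((n 0 : ℂ) • cmp 0 u) ((n 1 : ℂ) • cmp 1 u),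
      Lp.coeFn_smul (n 0 : ℂ) (cmp 0 u), Lp.coeFn_smul (n 1 : ℂ) (cmp 1 u),
      Lp.coeFn_smul (n 2 : ℂ) (cmp 2 u), coeFn_cmp 0 u, coeFn_cmp 1 u, coeFn_cmp 2 u,
      hue 0, hue 1, hue 2] with y h1 h2 h3 h4 h5 h6 h7 h8 h9 h10 h11 hy
    rw [hwU y hy, Fin.sum_univ_three, h1, Pi.add_apply, h2, Pi.add_apply, h3, h4, h5,
      Pi.smul_apply, Pi.smul_apply, Pi.smul_apply, h6, h7, h8, h9 hy, h10 hy, h11 hy]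
    rfl
  refine ⟨ψ, hψ, W, hW, hSW, ?_⟩
  have hO : W ∩ (cellY \ S) ⊆ cellY \ S := Set.inter_subset_right
  have hj : ∀ j, ∀ᵐ y ∂muY, y ∈ W ∩ (cellY \ S) → u y j = wpd j ψ y := by
    intro j
    filter_upwards [(hψ.isWeakPartial j).ae_eq_fderiv (hW.inter hΩ) (hO.trans Set.sdiff_subset)
      (hw.mono hO) h, hue j] with y h1 h2 hy
    rw [h1 hy, h2 hy.2, hwU y hy.2, Fin.sum_univ_three]
    fin_cases j <;> simp [ee]
  filter_upwards [hj 0, hj 1, hj 2] with y h0 h1 h2 hy j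
  fin_cases j
  exacts [h0 hy, h1 hy, h2 hy]

/-! ### Fields supported in the inclusion -/

theorem ae_restrict_compl_iff {S : Set E3} (hS : IsCompact S) {P : E3 → Prop} :
    (∀ᵐ y ∂volume.restrict (cellY \ S), P y) ↔ ∀ᵐ y ∂muY, y ∈ cellY \ S → P y := by
  have hm : MeasurableSet (cellY \ S) := measurableSet_cellY.diff hS.measurableSet
  rw [← ae_restrict_iff' hm, muY, Measure.restrict_restrict_of_subset Set.sdiff_subset]

theorem pd_mul_of_eq_one {χ : E3 → ℝ} (φ : E3 → ℝ) {V : Set E3} {y : E3} (hV : V ∈ 𝓝 y)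
    (hχ : ∀ z ∈ V, χ z = 1) {i : Fin 3} : pd i (fun z => χ z * φ z) y = pd i φ y := by
  have h : (fun z => χ z * φ z) =ᶠ[𝓝 y] φ := by
    filter_upwards [hV] with z hz
    rw [hχ z hz, one_mul]
  rw [pd, pd, h.fderiv_eq]

section

variable {F : Type} [NormedAddCommGroup F] [InnerProductSpace ℂ F] [NormedSpace ℝ F]
  [IsScalarTower ℝ ℂ F] [CompleteSpace F] [FiniteDimensional ℂ F]

/-- For fields supported in `S`, a periodic divergence identity may be tested with non-periodic
functions. -/
theorem sum_integral_pd_eq {S : Set E3} (hS : IsCompact S) (hSY : S ⊆ cellY) {h : Fin 3 → L2 F}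
    {f : L2 F} (hh : ∀ i, ∀ᵐ y ∂muY, y ∉ S → h i y = 0) (hf : ∀ᵐ y ∂muY, y ∉ S → f y = 0)
    (hfc : ∀ k, ∑ i, sym k i • fc k (h i) = fc k f) {η : E3 → ℝ} (hη : ContDiff ℝ ∞ η) :
    ∑ i, ∫ y, (pd i η y : ℂ) • h i y ∂muY = -∫ y, (η y : ℂ) • f y ∂muY := by
  obtain ⟨χ, hχ, hχs, -, V, hV, hSV, hχ1⟩ := exists_cutoff hS isOpen_cellY hSY
  have hp : ContDiff ℝ ∞ fun y => χ y * η y := hχ.mul hη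
  have hps : tsupport (fun y => χ y * η y) ⊆ cellY :=
    (tsupport_subset_of_eq_zero fun z hz => by simp [hz]).trans hχs
  refine Eq.trans (Finset.sum_congr rfl fun i _ => ?_)
    ((weak_divergence_iff.2 hfc _ (isPeriodicSmooth_periodize hp hps)).trans (congrArg _ ?_))
  · refine integral_congr_ae ?_
    filter_upwards [hh i, ae_muY_mem] with y h1 hy
    by_cases hyS : y ∈ S
    · rw [pd_periodize _ hy, pd_mul_of_eq_one η (hV.mem_nhds (hSV hyS)) hχ1]
    · rw [h1 hyS, smul_zero, smul_zero]
  · refine integral_congr_ae ?_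
    filter_upwards [hf, ae_muY_mem] with y h1 hy
    by_cases hyS : y ∈ S
    · rw [periodize_eq _ hy, hχ1 y (hSV hyS), one_mul]
    · rw [h1 hyS, smul_zero, smul_zero]

end

theorem contDiff_coord (l : Fin 3) : ContDiff ℝ ∞ fun y : E3 => y l := by fun_prop

theorem pd_coord (i l : Fin 3) (y : E3) : pd i (fun y : E3 => y l) y = if i = l then 1 else 0 := by
  have h : HasFDerivAt (fun y : E3 => y l) (EuclideanSpace.proj l : E3 →L[ℝ] ℝ) y :=
    (EuclideanSpace.proj l : E3 →L[ℝ] ℝ).hasFDerivAt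
  rw [pd, h.fderiv]
  simp [eq_comm]

/-- Test `Σᵢ ∂ᵢhᵢ = f` with the coordinate `y l`. It is not periodic, but the supports in `S` allow
it to be cut off away from `S`. -/
theorem fc_zero_cross {S : Set E3} (hS : IsCompact S) (hSY : S ⊆ cellY) {F : Type}
    [NormedAddCommGroup F] [InnerProductSpace ℂ F] [NormedSpace ℝ F]
    [IsScalarTower ℝ ℂ F] [CompleteSpace F] [FiniteDimensional ℂ F] {h : Fin 3 → L2 F}
    {f : L2 F} (hh : ∀ i, ∀ᵐ y ∂muY, y ∉ S → h i y = 0) (hf : ∀ᵐ y ∂muY, y ∉ S → f y = 0)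
    (hfc : ∀ k, ∑ i, sym k i • fc k (h i) = fc k f) (l : Fin 3) :
    fc 0 (h l) = -∫ y : E3, ((y l : ℝ) : ℂ) • f y ∂muY := by
  rw [← sum_integral_pd_eq hS hSY hh hf hfc (contDiff_coord l), Finset.sum_eq_single l]
  · rw [fc_zero_eq]
    refine integral_congr_ae (Eventually.of_forall fun y => ?_)
    simp [pd_coord]
  · intro i _ hi
    refine integral_eq_zero_of_ae (Eventually.of_forall fun y => ?_)
    simp [pd_coord, hi]
  · simp

theorem MemZ0.ae_eq_zero {S : Set E3} (hS : IsCompact S) {f : L2 C3} (hf : MemZ0 S f) :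
    ∀ᵐ y ∂muY, y ∉ S → f y = 0 := by
  filter_upwards [(ae_restrict_compl_iff hS).1 hf.eq_zero, ae_muY_mem] with y h1 h2 h3
  exact h1 ⟨h2, h3⟩

theorem MemZ0.dotC_eq_zero {S : Set E3} {f : L2 C3} (hf : MemZ0 S f) (k : Fin 3 → ℤ) :
    dotC (wave k) (fc k f) = 0 := isDivFree_iff.1 hf.div_eq_zero k

/-- Divergence-free with support in `S`: the case of zero right-hand side. Thus the periodic Poisson
problem defining `ψ_f` is solvable. -/
theorem MemZ0.fc_zero {S : Set E3} (hS : IsCompact S) (hSY : S ⊆ cellY) {f : L2 C3}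
    (hf : MemZ0 S f) : fc 0 f = 0 := by
  ext l
  rw [← fc_cmp, fc_zero_cross hS hSY (h := fun i => cmp i f) (f := 0)]
  · rw [integral_eq_zero_of_ae]
    · simp
    · filter_upwards [Lp.coeFn_zero ℂ 2 muY] with y hy
      rw [hy]; simp
  · intro i
    filter_upwards [hf.ae_eq_zero hS, coeFn_cmp i f] with y h1 h2 hy
    rw [h2, h1 hy]; rfl
  · filter_upwards [Lp.coeFn_zero ℂ 2 muY] with y hy _
    rw [hy]; rfl
  · intro k
    rw [map_zero, ← hf.dotC_eq_zero k]
    simp_rw [fc_cmp]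
    rfl

theorem sum_crossL_crossL (a : C3) :
    ∑ i, crossL (basisC i) (crossL (basisC i) a) = -(2 : ℂ) • a := by
  ext j
  rw [Fin.sum_univ_three]
  fin_cases j <;> simp [crossL_apply, basisC] <;> ring

/-- The mean of a field supported in `S` is half the moment of its curl. -/
theorem fc_zero_eq_momentL {S : Set E3} (hS : IsCompact S) (hSY : S ⊆ cellY) {d g : L2 C3}
    (hd : ∀ᵐ y ∂muY, y ∉ S → d y = 0) (hg : ∀ᵐ y ∂muY, y ∉ S → g y = 0)
    (hfc : ∀ k, crossL (wave k) (fc k d) = fc k g) : fc 0 d = (1 / 2 : ℂ) • momentL g := by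
  have h1 : ∀ l, crossL (basisC l) (fc 0 d) = -∫ y : E3, ((y l : ℝ) : ℂ) • g y ∂muY := by
    intro l
    rw [← fc_compLp]
    refine fc_zero_cross hS hSY (h := fun i => (crossL (basisC i)).compLp d) ?_ hg ?_ l
    · intro i
      filter_upwards [hd, (crossL (basisC i)).coeFn_compLp d] with y h1 h2 hy
      rw [h2, h1 hy, map_zero]
    · intro k
      rw [← hfc, crossL_eq_sum, _root_.sum_apply]
      simp_rw [fc_compLp]
      rfl
  -- Crossing the `l`-th relation with `eₗ` and summing, `Σ eₗ ∧ (eₗ ∧ a) = -2a` produces the factor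
  -- `1/2`.
  have h2 : momentL g = -∑ l, crossL (basisC l) (crossL (basisC l) (fc 0 d)) := by
    rw [momentL, _root_.sum_apply, ← Finset.sum_neg_distrib]
    refine Finset.sum_congr rfl fun l _ => ?_
    rw [h1 l, map_neg, neg_neg]
    rfl
  rw [h2, sum_crossL_crossL, neg_smul, neg_neg, smul_smul]
  norm_num

/-! ### Gradients -/

/-- The gradient of a function of `W^{1,2}_♯`. -/
def gradF (ψ : L2 ℂ) : L2 C3 :=
  ∑ j, (ContinuousLinearMap.toSpanSingleton ℂ (basisC j)).compLp (wpd j ψ)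

theorem fc_gradF {ψ : L2 ℂ} (hψ : MemW12 ψ) (k : Fin 3 → ℤ) :
    fc k (gradF ψ) = fc k ψ • wave k := by
  rw [gradF, map_sum]
  simp_rw [fc_compLp, hψ.fc_wpd]
  ext j
  rw [Fin.sum_univ_three]
  fin_cases j <;> simp [basisC, wave_apply, mul_comm]

theorem coeFn_gradF {ψ : L2 ℂ} (hψ : MemW12 ψ) : ∀ᵐ y ∂muY, ∀ j, gradF ψ y j = wpd j ψ y := by
  refine ae_all_iff.2 fun j => ?_
  have h : cmp j (gradF ψ) = wpd j ψ := fc_ext fun k => by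
    rw [fc_cmp, fc_gradF hψ, hψ.fc_wpd]
    simp [wave_apply, mul_comm]
  filter_upwards [coeFn_cmp j (gradF ψ)] with y hy
  rw [← hy, h]

theorem crossL_fc_gradF {ψ : L2 ℂ} (hψ : MemW12 ψ) (k : Fin 3 → ℤ) :
    crossL (wave k) (fc k (gradF ψ)) = 0 := by
  rw [fc_gradF hψ, map_smul, crossL_self, smul_zero]

/-- A curl-free and divergence-free field outside `S` can be replaced by a field supported in `S`
with the same curl. -/
theorem exists_supported_of_curl {S : Set E3} (hS : IsInclusion S) {u : L2 C3} (hu : MemW12 u)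
    (hc : ∀ᵐ y ∂muY, y ∉ S → curl u y = 0) (hd : ∀ᵐ y ∂muY, dvg u y = 0) :
    ∃ d : L2 C3, (∀ᵐ y ∂muY, y ∉ S → d y = 0) ∧
      ∀ k, crossL (wave k) (fc k d) = fc k (curl u) := by
  obtain ⟨ψ, hψ, W, hW, hSW, hW'⟩ := exists_gradient_near hS hu
    (hc.mono fun y h hy => h hy.2) hd
  set v : L2 C3 := u - gradF ψ with hv
  have hv0 : ∀ᵐ y ∂muY, y ∈ W → y ∉ S → v y = 0 := by
    filter_upwards [hW', coeFn_gradF hψ, Lp.coeFn_sub u (gradF ψ), ae_muY_mem]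
      with y h1 h2 h3 h4 hy hyS
    rw [h3, Pi.sub_apply, sub_eq_zero]
    ext j
    rw [h1 ⟨hy, h4, hyS⟩ j, h2]
  have hvc : ∀ k, ∑ i, sym k i • fc k ((crossL (basisC i)).compLp v) = fc k (curl u) := by
    intro k
    rw [hu.fc_curl]
    have h1 : crossL (wave k) (fc k v) = crossL (wave k) (fc k u) := by
      rw [hv, map_sub, map_sub, crossL_fc_gradF hψ, sub_zero]
    rw [← h1, crossL_eq_sum, _root_.sum_apply]
    simp_rw [fc_compLp]
    rfl
  have hmem : MemLp (S.indicator v) 2 muY := (Lp.memLp v).indicator hS.isCompact.measurableSet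
  set d : L2 C3 := hmem.toLp _ with hd'
  have hdv : ∀ᵐ y ∂muY, d y = S.indicator v y := hmem.coeFn_toLp
  refine ⟨d, hdv.mono fun y hy hyS => by rw [hy, Set.indicator_of_notMem hyS], ?_⟩
  have key : ∀ k, ∑ i, sym k i • fc k ((crossL (basisC i)).compLp d) = fc k (curl u) := by
    refine weak_divergence_iff.1 fun φ hφ => ?_
    -- Replacing `φ` by `χφ` changes neither side: `χ = 1` near `S`, which carries `d` and `curl u`.
    -- Against `χφ`, supported in `W`, the fields `v` and `d` are indistinguishable, since `v`
    -- vanishes on `W` outside `S`.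
    obtain ⟨χ, hχ, hχs, -, V, hV, hSV, hχ1⟩ := exists_cutoff hS.isCompact (hW.inter isOpen_cellY)
      (Set.subset_inter hSW hS.subset_cell)
    have hp : ContDiff ℝ ∞ fun y => χ y * φ y := hχ.mul hφ.1
    have hps : tsupport (fun y => χ y * φ y) ⊆ tsupport χ :=
      tsupport_subset_of_eq_zero fun z hz => by simp [hz]
    refine Eq.trans (Finset.sum_congr rfl fun i _ => ?_) ((weak_divergence_iff.2 hvc _
      (isPeriodicSmooth_periodize hp (hps.trans (hχs.trans Set.inter_subset_right)))).trans
      (congrArg _ ?_))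
    · refine integral_congr_ae ?_
      filter_upwards [hdv, hv0, (crossL (basisC i)).coeFn_compLp d,
        (crossL (basisC i)).coeFn_compLp v, ae_muY_mem] with y h1 h2 h3 h4 hy
      rw [h3, h4, h1]
      by_cases hyS : y ∈ S
      · rw [pd_periodize _ hy, Set.indicator_of_mem hyS,
          pd_mul_of_eq_one φ (hV.mem_nhds (hSV hyS)) hχ1]
      · rw [Set.indicator_of_notMem hyS, map_zero, smul_zero]
        by_cases hyχ : y ∈ tsupport χ
        · rw [h2 (hχs hyχ).1 hyS, map_zero, smul_zero]
        · have h5 : pd i (fun y => χ y * φ y) y = 0 :=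
            image_eq_zero_of_notMem_tsupport fun h =>
              hyχ (hps (tsupport_fderiv_apply_subset ℝ (ee i) h))
          rw [pd_periodize _ hy, h5, Complex.ofReal_zero, zero_smul]
    · refine integral_congr_ae ?_
      filter_upwards [hc, ae_muY_mem] with y h1 hy
      by_cases hyS : y ∈ S
      · rw [periodize_eq _ hy, hχ1 y (hSV hyS), one_mul]
      · rw [h1 hyS, smul_zero, smul_zero]
  intro k
  rw [← key k, crossL_eq_sum, _root_.sum_apply]
  simp_rw [fc_compLp]
  rfl

/-! ### The correspondence between `Z₀` and `X₀^div` -/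

theorem MemZ0.curl_GamL {S : Set E3} (hS : IsInclusion S) {f : L2 C3} (hf : MemZ0 S f) :
    curl (GamL f) = f :=
  MagneticCell.curl_GamL (hf.fc_zero hS.isCompact hS.subset_cell) hf.dotC_eq_zero

theorem MemZ0.Gam_eq {S : Set E3} (hS : IsInclusion S) {f : L2 C3} (hf : MemZ0 S f) :
    Gam S f = GamL f :=
  MagneticCell.Gam_eq hS.subset_cell hS.isCompact.measurableSet hf.eq_zero
    (hf.fc_zero hS.isCompact hS.subset_cell)

/-- Only the circulation is delicate. The field `d` supported in `S` with curl `f` makes `Γf - d`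
curl-free and equal to `Γf` outside `S`. -/
theorem MemZ0.memX0div_GamL {S : Set E3} (hS : IsInclusion S) {f : L2 C3} (hf : MemZ0 S f) :
    MemX0div S (GamL f) := by
  have hcurl := hf.curl_GamL hS
  have hf0 := hf.ae_eq_zero hS.isCompact
  refine ⟨memW12_GamL f, ?_, dvg_GamL f, ?_⟩
  · rw [hcurl]; exact hf.eq_zero
  obtain ⟨d, hd0, hd⟩ := exists_supported_of_curl hS (memW12_GamL f)
    (by rw [hcurl]; exact hf0) (dvg_GamL f)
  rw [hcurl] at hd
  obtain ⟨ψ, hψ, h⟩ := exists_gradient_of_curl_free (v := GamL f - d) fun k => by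
    rw [map_sub, map_sub, hd, ← (memW12_GamL f).fc_curl, hcurl, sub_self]
  -- This is where the constant `(1/2) ∫ y ∧ f` in `Γ` is needed: it is exactly the mean of `d`, so
  -- the constant part of `Γf - d` cancels.
  have hmean : fc 0 (GamL f - d) = 0 := by
    rw [map_sub, fc_zero_GamL, fc_zero_eq_momentL hS.isCompact hS.subset_cell hd0 hf0 hd, sub_self]
  refine ⟨ψ, hψ, (ae_restrict_compl_iff hS.isCompact).2 ?_⟩
  filter_upwards [h, hd0, Lp.coeFn_sub (GamL f) d] with y h1 h2 h3 hy j
  have := h1 j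
  rwa [h3, Pi.sub_apply, hmean, h2 hy.2, sub_zero] at this

theorem MemX0div.memZ0_curl {S : Set E3} {v : L2 C3} (hv : MemX0div S v) : MemZ0 S (curl v) :=
  ⟨isDivFree_iff.2 fun k => by rw [hv.memW12.fc_curl, dotC_crossL], hv.curl_eq_zero⟩

/-- Zero circulation makes `v - ∇ψ` vanish outside `S`, and `∇ψ` has neither mean nor curl. So `v`
and `Γ curl v` have the same mean, besides the same curl and divergence. -/
theorem MemX0div.eq_GamL {S : Set E3} (hS : IsInclusion S) {v : L2 C3} (hv : MemX0div S v) :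
    v = GamL (curl v) := by
  have hf := hv.memZ0_curl
  have hf0 := hf.ae_eq_zero hS.isCompact
  obtain ⟨ψ, hψ, h⟩ := hv.circulation_eq_zero
  have hd0 : ∀ᵐ y ∂muY, y ∉ S → (v - gradF ψ : L2 C3) y = 0 := by
    filter_upwards [(ae_restrict_compl_iff hS.isCompact).1 h, coeFn_gradF hψ,
      Lp.coeFn_sub v (gradF ψ), ae_muY_mem] with y h1 h2 h3 h4 hyS
    rw [h3, Pi.sub_apply, sub_eq_zero]
    ext j
    rw [h1 ⟨h4, hyS⟩ j, h2]
    simp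
  have hmean := fc_zero_eq_momentL hS.isCompact hS.subset_cell hd0 hf0 fun k => by
    rw [map_sub, map_sub, crossL_fc_gradF hψ, sub_zero, hv.memW12.fc_curl]
  rw [map_sub, fc_gradF hψ, wave_zero, smul_zero, sub_zero] at hmean
  have h1 := eq_constField_of_curl_of_dvg (v := v - GamL (curl v))
    (fun k => by
      rw [map_sub, map_sub, ← hv.memW12.fc_curl, ← (memW12_GamL _).fc_curl, hf.curl_GamL hS,
        sub_self])
    (fun k => by
      have h2 := hv.memW12.dvg_eq_zero_iff.1 hv.div_eq_zero k
      have h3 := (memW12_GamL (curl v)).dvg_eq_zero_iff.1 (dvg_GamL _) k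
      have h4 : ∀ a b c : C3, dotC a (b - c) = dotC a b - dotC a c := fun a b c => by
        simp [dotC, mul_sub]
      rw [map_sub, h4, h2, h3, sub_self])
  rw [map_sub, fc_zero_GamL, hmean, sub_self, constField_eq, map_zero, sub_eq_zero] at h1
  exact h1

/-! ### Real valued fields -/

theorem fc_star (w : L2 ℂ) (k : Fin 3 → ℤ) : fc k (star w) = (starRingEnd ℂ) (fc (-k) w) := by
  rw [fc_eq_integral, fc_eq_integral, ← integral_conj, neg_neg]
  refine integral_congr_ae ?_
  filter_upwards [Lp.coeFn_star w] with y hy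
  rw [hy, char_neg, smul_eq_mul, smul_eq_mul, map_mul]
  rfl

/-- Reality is the Hermitian symmetry of the coefficients, a form in which it passes through the
Fourier definition of `Γ`. -/
theorem real_valued_iff {v : L2 C3} : (∀ᵐ y ∂muY, ∀ j, (v y j).im = 0) ↔
    ∀ k j, fc (-k) v j = (starRingEnd ℂ) (fc k v j) := by
  have h1 : ∀ j, (∀ᵐ y ∂muY, (v y j).im = 0) ↔ star (cmp j v) = cmp j v := by
    intro j
    constructor
    · intro h
      refine Lp.ext ?_
      filter_upwards [h, Lp.coeFn_star (cmp j v), coeFn_cmp j v] with y h1 h2 h3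
      rw [h2, Pi.star_apply, h3]
      exact Complex.conj_eq_iff_im.2 h1
    · intro h
      have h0 := Lp.coeFn_star (cmp j v)
      rw [h] at h0
      filter_upwards [h0, coeFn_cmp j v] with y h2 h3
      rw [Pi.star_apply, h3] at h2
      exact Complex.conj_eq_iff_im.1 h2.symm
  rw [ae_all_iff, forall_comm]
  refine forall_congr' fun j => ?_
  rw [h1]
  constructor
  · intro h k
    have h2 := fc_star (cmp j v) k
    rw [h, fc_cmp, fc_cmp] at h2
    rw [h2, Complex.conj_conj]
  · intro h
    refine fc_ext fun k => ?_
    rw [fc_star, fc_cmp, fc_cmp, h, Complex.conj_conj]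

theorem sym_neg_eq_conj (k : Fin 3 → ℤ) (i : Fin 3) : sym (-k) i = (starRingEnd ℂ) (sym k i) := by
  simp [sym, Complex.conj_ofNat]

theorem symLap_neg (k : Fin 3 → ℤ) : symLap (-k) = symLap k := by
  simp [symLap]

theorem conj_crossL_apply {a b a' b' : C3} (ha : ∀ j, a' j = (starRingEnd ℂ) (a j))
    (hb : ∀ j, b' j = (starRingEnd ℂ) (b j)) (j : Fin 3) :
    crossL a' b' j = (starRingEnd ℂ) (crossL a b j) := by
  simp only [crossL_apply]
  fin_cases j <;> simp [ha, hb]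

theorem conj_momentL {f : L2 C3} (hf : ∀ᵐ y ∂muY, ∀ j, (f y j).im = 0) (j : Fin 3) :
    (starRingEnd ℂ) (momentL f j) = momentL f j := by
  have h1 : ∀ l (j : Fin 3), (starRingEnd ℂ) (integralL (F := C3) _ (continuous_coord l) f j) =
      integralL (F := C3) _ (continuous_coord l) f j := by
    intro l j
    have h2 : integralL (F := C3) _ (continuous_coord l) f j =
        ∫ y : E3, ((y l : ℝ) : ℂ) * f y j ∂muY :=
      ((prC j).integral_comp_comm (integrable_smul (continuous_coord l) f)).symm
    rw [h2, ← integral_conj]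
    refine integral_congr_ae ?_
    filter_upwards [hf] with y hy
    rw [map_mul, Complex.conj_ofReal, Complex.conj_eq_iff_im.2 (hy j)]
  have h3 : momentL f j = ∑ l, crossL (basisC l) (integralL (F := C3) _ (continuous_coord l) f) j := by
    rw [momentL, _root_.sum_apply, Fin.sum_univ_three, Fin.sum_univ_three]
    rfl
  rw [h3, map_sum]
  refine Finset.sum_congr rfl fun l _ => ?_
  refine (conj_crossL_apply (fun i => ?_) (fun i => (h1 l i).symm) j).symm
  by_cases hi : i = l <;> simp [basisC, hi]

theorem real_valued_GamL {f : L2 C3} (hf : ∀ᵐ y ∂muY, ∀ j, (f y j).im = 0) :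
    ∀ᵐ y ∂muY, ∀ j, (GamL f y j).im = 0 := by
  rw [real_valued_iff]
  intro k j
  by_cases hk : k = 0
  · rw [hk, neg_zero, fc_zero_GamL]
    rw [PiLp.smul_apply, smul_eq_mul, map_mul, conj_momentL hf j]
    simp [Complex.conj_ofNat]
  · rw [fc_GamL_of_ne f hk, fc_GamL_of_ne f (neg_ne_zero.2 hk), symLap_neg]
    rw [PiLp.smul_apply, PiLp.smul_apply, smul_eq_mul, smul_eq_mul, map_mul, map_inv₀,
      Complex.conj_ofReal, conj_crossL_apply (b := fc k f) (a := wave k) (sym_neg_eq_conj k) (real_valued_iff.1 hf k)]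

theorem inner_charField_eq (k : Fin 3 → ℤ) (a : C3) (u : L2 C3) :
    inner ℂ (charField k a) u = inner ℂ a (fc k u) := by
  rw [inner_charField, fc_eq_integral]

/-! ### The spectral system -/

section

variable {S : Set E3} {α : ℕ → ℝ} {f : ℕ → L2 C3}

/-- The integral over `S` is one over `Y` because `curl u` vanishes outside `S`. -/
theorem b0_eq_inner (hS : IsInclusion S) {u : L2 C3} (hu : MemX0div S u) (v : L2 C3) :
    b0 S u v = inner ℂ (curl v) (curl u) := by
  rw [L2.inner_def, b0]
  exact setIntegral_eq_muY hS.subset_cell hS.isCompact.measurableSet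
    (hu.curl_eq_zero.mono fun y hy => by rw [hy, inner_zero_right])

theorem MemZ0.smul {g : L2 C3} (hf : IsSpectralSystem S α f) (c : ℂ) (hg : MemZ0 S g) :
    MemZ0 S (c • g) :=
  (hf.closed_span _).2 (Submodule.smul_mem _ c ((hf.closed_span _).1 hg))

theorem MemZ0.sub {g h : L2 C3} (hf : IsSpectralSystem S α f) (hg : MemZ0 S g) (hh : MemZ0 S h) :
    MemZ0 S (g - h) :=
  (hf.closed_span _).2 (Submodule.sub_mem _ ((hf.closed_span _).1 hg) ((hf.closed_span _).1 hh))

namespace IsSpectralSystem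

theorem memZ0 (hf : IsSpectralSystem S α f) (n : ℕ) : MemZ0 S (f n) :=
  (hf.closed_span _).2 (Submodule.le_topologicalClosure _ (Submodule.subset_span ⟨n, rfl⟩))

theorem inner_eq_zero (hf : IsSpectralSystem S α f) {p : L2 C3} (hp : ∀ n, inner ℂ (f n) p = 0)
    {h : L2 C3} (hh : MemZ0 S h) : inner ℂ h p = 0 := by
  refine (Submodule.orthogonal_closure' (Submodule.span ℂ (Set.range f)) p).1 ?_ h
    ((hf.closed_span h).1 hh)
  intro y hy
  induction hy using Submodule.span_induction with
  | mem x hx => obtain ⟨n, rfl⟩ := hx; exact hp n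
  | zero => exact inner_zero_left _
  | add x y _ _ hx hy => rw [inner_add_left, hx, hy, add_zero]
  | smul c x _ hx => rw [inner_smul_left, hx, mul_zero]

theorem eq_zero_of_inner (hf : IsSpectralSystem S α f) {h : L2 C3} (hh : MemZ0 S h)
    (hp : ∀ n, inner ℂ (f n) h = 0) : h = 0 :=
  inner_self_eq_zero.1 (hf.inner_eq_zero hp hh)

theorem inner_GamL (hS : IsInclusion S) (hf : IsSpectralSystem S α f) (n : ℕ) {g : L2 C3}
    (hg : MemZ0 S g) : inner ℂ (GamL g) (GamL (f n)) = α n * inner ℂ g (f n) := by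
  have h := hf.eigen n g hg
  rwa [a0, hg.Gam_eq hS, (hf.memZ0 n).Gam_eq hS] at h

theorem inner_GamL' (hS : IsInclusion S) (hf : IsSpectralSystem S α f) (n : ℕ) {g : L2 C3}
    (hg : MemZ0 S g) : inner ℂ (GamL (f n)) (GamL g) = α n * inner ℂ (f n) g := by
  rw [← inner_conj_symm, hf.inner_GamL hS n hg, map_mul, Complex.conj_ofReal, inner_conj_symm]

theorem uField_eq (hS : IsInclusion S) (hf : IsSpectralSystem S α f) (n : ℕ) :
    uField S α f n = GamL (((1 / √(α n) : ℝ) : ℂ) • f n) := by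
  rw [uField, (hf.memZ0 n).Gam_eq hS, map_smul]

theorem memX0div_uField (hS : IsInclusion S) (hf : IsSpectralSystem S α f) (n : ℕ) :
    MemX0div S (uField S α f n) := by
  rw [hf.uField_eq hS]
  exact ((hf.memZ0 n).smul hf _).memX0div_GamL hS

theorem curl_uField (hS : IsInclusion S) (hf : IsSpectralSystem S α f) (n : ℕ) :
    curl (uField S α f n) = ((1 / √(α n) : ℝ) : ℂ) • f n := by
  rw [hf.uField_eq hS]
  exact ((hf.memZ0 n).smul hf _).curl_GamL hS

theorem one_div_sqrt_mul_self (hf : IsSpectralSystem S α f) (n : ℕ) :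
    ((1 / √(α n) : ℝ) : ℂ) * ((1 / √(α n) : ℝ) : ℂ) = (α n : ℂ)⁻¹ := by
  rw [← Complex.ofReal_mul, div_mul_div_comm, Real.mul_self_sqrt (hf.pos n).le]
  simp

theorem real_valued_uField (hS : IsInclusion S) (hf : IsSpectralSystem S α f) (n : ℕ) :
    ∀ᵐ y ∂muY, ∀ j, (uField S α f n y j).im = 0 := by
  rw [hf.uField_eq hS, map_smul]
  filter_upwards [real_valued_GamL (hf.real_valued n),
    Lp.coeFn_smul ((1 / √(α n) : ℝ) : ℂ) (GamL (f n))] with y h1 h2 j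
  rw [h2, Pi.smul_apply, PiLp.smul_apply, smul_eq_mul, Complex.im_ofReal_mul, h1 j, mul_zero]

/-- Everything is transported by `Γ`: `curl uₙ` is `αₙ^{-1/2} fₙ`, and `v = Γ curl v` brings in the
eigenvalue relation for `a₀`. A field `b₀`-orthogonal to all `uₙ` has its curl orthogonal to all
`fₙ`, hence zero curl, and so vanishes. -/
theorem isCurlEigenbasis (hS : IsInclusion S) (hf : IsSpectralSystem S α f) :
    IsCurlEigenbasis S (lam α) (uField S α f) where
  mem := hf.memX0div_uField hS
  real_valued := hf.real_valued_uField hS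
  eigen n v hv := by
    rw [b0_eq_inner hS (hf.memX0div_uField hS n), hf.curl_uField hS]
    conv_rhs => rw [hv.eq_GamL hS, hf.uField_eq hS, map_smul]
    rw [inner_smul_right, inner_smul_right, hf.inner_GamL hS n hv.memZ0_curl, lam]
    have := Complex.ofReal_ne_zero.2 (hf.pos n).ne'
    push_cast
    field_simp
  orthonormal := by
    rw [orthonormal_iff_ite]
    intro n m
    rw [hf.uField_eq hS, hf.uField_eq hS, map_smul, map_smul, inner_smul_left, inner_smul_right,
      hf.inner_GamL hS m (hf.memZ0 n), orthonormal_iff_ite.1 hf.orthonormal, Complex.conj_ofReal]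
    split_ifs with h
    · subst h
      rw [mul_one, ← mul_assoc, hf.one_div_sqrt_mul_self,
        inv_mul_cancel₀ (Complex.ofReal_ne_zero.2 (hf.pos n).ne')]
    · simp
  complete v hv h := by
    rw [hv.eq_GamL hS, hf.eq_zero_of_inner hv.memZ0_curl fun n => ?_, map_zero]
    have h1 := h n
    rw [b0_eq_inner hS hv, hf.curl_uField hS, inner_smul_left, Complex.conj_ofReal] at h1
    refine (mul_eq_zero.1 h1).resolve_left (Complex.ofReal_ne_zero.2 ?_)
    exact one_div_ne_zero (Real.sqrt_ne_zero'.2 (hf.pos n))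

end IsSpectralSystem

end

/-! ### The cell problem -/

section

variable {S : Set E3} {α : ℕ → ℝ} {f : ℕ → L2 C3}

/-- The coefficients of the curl of the solution of the cell problem in the basis `fₙ`. -/
def cellCoeff (α : ℕ → ℝ) (f : ℕ → L2 C3) (ε : ℂ) (z : C3) (n : ℕ) : ℂ :=
  ε / (1 - ε * α n) * inner ℂ (GamL (f n)) (constField z)

/-- Its imaginary part is `-a Im ε < 0`: absorption excludes resonances. -/
theorem one_sub_mul_ne_zero {ε : ℂ} (hε : 0 < ε.im) (a : ℝ) (ha : 0 < a) : 1 - ε * a ≠ 0 := by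
  intro h
  have := congrArg Complex.im h
  rw [Complex.sub_im, Complex.im_mul_ofReal, Complex.one_im, Complex.zero_im] at this
  nlinarith

namespace IsSpectralSystem

/-- The products `⟨fₙ, Γ* z⟩` are square summable by Bessel, and the factors `ε / (1 - ε αₙ)` are
bounded since they converge to `ε`. -/
theorem summable_cellCoeff (hf : IsSpectralSystem S α f) (ε : ℂ) (z : C3) :
    Summable fun n => cellCoeff α f ε z n • f n := by
  have hV := hf.orthonormal.orthogonalFamily
  refine (hV.summable_iff_norm_sq_summable (cellCoeff α f ε z)).2 ?_
  have ht : Tendsto (fun n => ε / (1 - ε * α n)) atTop (𝓝 (ε / (1 - ε * (0 : ℝ)))) := by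
    refine tendsto_const_nhds.div (tendsto_const_nhds.sub (tendsto_const_nhds.mul
      ((Complex.continuous_ofReal.tendsto 0).comp hf.tendsto_zero))) ?_
    simp
  obtain ⟨C, hC⟩ := (Metric.isBounded_range_of_tendsto _ ht).exists_norm_le
  set p : L2 C3 := ContinuousLinearMap.adjoint GamL (constField z) with hp
  have hin : ∀ n, inner ℂ (GamL (f n)) (constField z) = inner ℂ (f n) p := fun n =>
    (ContinuousLinearMap.adjoint_inner_right _ _ _).symm
  refine Summable.of_nonneg_of_le (fun n => sq_nonneg _) (fun n => ?_)
    ((hf.orthonormal.inner_products_summable p).mul_left (C ^ 2))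
  rw [cellCoeff, norm_mul, mul_pow, hin]
  gcongr
  exact hC _ ⟨n, rfl⟩

/-- The curl of the solution of the cell problem. -/
def cellCurl (_ : IsSpectralSystem S α f) (ε : ℂ) (z : C3) : L2 C3 :=
  ∑' n, cellCoeff α f ε z n • f n

theorem hasSum_cellCurl (hf : IsSpectralSystem S α f) (ε : ℂ) (z : C3) :
    HasSum (fun n => cellCoeff α f ε z n • f n) (hf.cellCurl ε z) :=
  (hf.summable_cellCoeff _ z).hasSum

theorem memZ0_cellCurl (hf : IsSpectralSystem S α f) (ε : ℂ) (z : C3) :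
    MemZ0 S (hf.cellCurl ε z) := by
  refine (hf.closed_span _).2 ?_
  refine (Submodule.isClosed_topologicalClosure _).mem_of_tendsto (hf.hasSum_cellCurl _ z)
    (Eventually.of_forall fun s => ?_)
  exact Submodule.sum_mem _ fun n _ => Submodule.smul_mem _ _ ((hf.closed_span _).1 (hf.memZ0 n))

theorem inner_cellCurl (hf : IsSpectralSystem S α f) (ε : ℂ) (z : C3) (n : ℕ) :
    inner ℂ (f n) (hf.cellCurl ε z) = cellCoeff α f ε z n := by
  have h := (hf.hasSum_cellCurl ε z).mapL (innerSL ℂ (f n))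
  refine h.unique ?_
  convert hasSum_single n ?_ using 1
  · simp [hf.orthonormal.1 n]
  · intro m hm
    simp [orthonormal_iff_ite.1 hf.orthonormal, hm.symm]

theorem isCellSolution_cellCurl (hS : IsInclusion S) (hf : IsSpectralSystem S α f) {εr : ℂ}
    {k0 : ℝ} (hε : 0 < (εr * (k0 : ℂ) ^ 2).im) (z : C3) :
    IsCellSolution S εr k0 z (GamL (hf.cellCurl (εr * (k0 : ℂ) ^ 2) z)) := by
  set ε := εr * (k0 : ℂ) ^ 2 with hεdef
  set g := hf.cellCurl ε z with hg
  have hgZ : MemZ0 S g := hf.memZ0_cellCurl _ z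
  refine ⟨hgZ.memX0div_GamL hS, fun v hv => ?_⟩
  set A := ContinuousLinearMap.adjoint GamL with hA
  -- The residual `g - ε Γ*Γg - ε Γ*z` is orthogonal to every `fₙ` by the choice of the
  -- coefficients, hence to `Z₀`. Tested with `curl v`, where `v = Γ curl v`, it is the cell
  -- problem.
  have h0 := hf.inner_eq_zero (p := g - ε • A (GamL g) - ε • A (constField z)) (fun n => by
    rw [inner_sub_right, inner_sub_right, inner_smul_right, inner_smul_right,
      ContinuousLinearMap.adjoint_inner_right, ContinuousLinearMap.adjoint_inner_right,
      hf.inner_GamL' hS n hgZ, hf.inner_cellCurl _, cellCoeff]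
    have := one_sub_mul_ne_zero hε (α n) (hf.pos n)
    field_simp
    ring) hv.memZ0_curl
  rw [inner_sub_right, inner_sub_right, inner_smul_right, inner_smul_right,
    ContinuousLinearMap.adjoint_inner_right, ContinuousLinearMap.adjoint_inner_right,
    ← hv.eq_GamL hS, sub_eq_zero] at h0
  rw [b0_eq_inner hS (hgZ.memX0div_GamL hS), hgZ.curl_GamL hS]
  exact h0

/-- Testing with `Γfₙ` determines every coefficient of `curl u` in the basis, and `u = Γ curl u`. -/
theorem eq_of_isCellSolution (hS : IsInclusion S) (hf : IsSpectralSystem S α f) {εr : ℂ}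
    {k0 : ℝ} (hε : 0 < (εr * (k0 : ℂ) ^ 2).im) {z : C3} {u : L2 C3}
    (hu : IsCellSolution S εr k0 z u) : u = GamL (hf.cellCurl (εr * (k0 : ℂ) ^ 2) z) := by
  set ε := εr * (k0 : ℂ) ^ 2 with hεdef
  have hcZ := hu.1.memZ0_curl
  have h1 : ∀ n, inner ℂ (f n) (curl u) = cellCoeff α f ε z n := by
    intro n
    have h2 := hu.2 _ ((hf.memZ0 n).memX0div_GamL hS)
    rw [b0_eq_inner hS hu.1, (hf.memZ0 n).curl_GamL hS] at h2
    have h3 := hf.inner_GamL' hS n hcZ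
    rw [← hu.1.eq_GamL hS] at h3
    rw [h3] at h2
    have := one_sub_mul_ne_zero hε (α n) (hf.pos n)
    rw [cellCoeff, div_mul_eq_mul_div, eq_div_iff this]
    linear_combination h2
  rw [hu.1.eq_GamL hS, ← sub_eq_zero, ← map_sub, hf.eq_zero_of_inner
    (hcZ.sub hf (hf.memZ0_cellCurl _ z)) fun n => ?_, map_zero]
  rw [inner_sub_right, h1, hf.inner_cellCurl _, sub_self]

theorem existsUnique_isCellSolution (hS : IsInclusion S) (hf : IsSpectralSystem S α f) {εr : ℂ}
    {k0 : ℝ} (hε : 0 < (εr * (k0 : ℂ) ^ 2).im) (z : C3) : ∃! u, IsCellSolution S εr k0 z u :=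
  ⟨_, hf.isCellSolution_cellCurl hS hε z, fun _ hu => hf.eq_of_isCellSolution hS hε hu⟩

theorem cellSolution_eq (hS : IsInclusion S) (hf : IsSpectralSystem S α f) {εr : ℂ}
    {k0 : ℝ} (hε : 0 < (εr * (k0 : ℂ) ^ 2).im) (z : C3) :
    cellSolution S εr k0 z = GamL (hf.cellCurl (εr * (k0 : ℂ) ^ 2) z) := by
  have hex : ∃ u, IsCellSolution S εr k0 z u := ⟨_, hf.isCellSolution_cellCurl hS hε z⟩
  rw [cellSolution, dif_pos hex]
  exact hf.eq_of_isCellSolution hS hε hex.choose_spec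

/-! ### Expansions -/

/-- Since `λₙ - ε = (1 - ε αₙ) / αₙ`, the two normalizing factors `αₙ^{-1/2}` supply the missing
`1/αₙ`. -/
theorem cellCoeff_eq (hS : IsInclusion S) (hf : IsSpectralSystem S α f) {ε : ℂ} (hε : 0 < ε.im)
    (z : C3) (n : ℕ) : inner ℂ (uField S α f n) (constField z) * (ε / (lam α n - ε)) *
      ((1 / √(α n) : ℝ) : ℂ) = cellCoeff α f ε z n := by
  rw [hf.uField_eq hS, map_smul, inner_smul_left, Complex.conj_ofReal, cellCoeff]
  have h1 := hf.one_div_sqrt_mul_self n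
  have h2 := one_sub_mul_ne_zero hε (α n) (hf.pos n)
  have h3 : (α n : ℂ) ≠ 0 := Complex.ofReal_ne_zero.2 (hf.pos n).ne'
  have h4 : ε / ((lam α n : ℝ) - ε) * (α n : ℂ)⁻¹ = ε / (1 - ε * α n) := by
    have h5 : ((lam α n : ℝ) - ε : ℂ) = (1 - ε * α n) / α n := by
      rw [lam]; push_cast; field_simp
    rw [h5]; field_simp
  rw [← h4, ← h1]
  ring

/-- Stated for a general `L` so as to serve both for `Γ` and for its partial derivatives. -/
theorem coeff_smul_eq (hS : IsInclusion S) (hf : IsSpectralSystem S α f) {ε : ℂ} (hε : 0 < ε.im)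
    (z : C3) (L : L2 C3 →L[ℂ] L2 C3) (n : ℕ) :
    (inner ℂ (uField S α f n) (constField z) * (ε / (lam α n - ε))) •
      L (((1 / √(α n) : ℝ) : ℂ) • f n) = L (cellCoeff α f ε z n • f n) := by
  rw [map_smul, map_smul, smul_smul, hf.cellCoeff_eq hS hε]

theorem hasSum_shapeField (hS : IsInclusion S) (hf : IsSpectralSystem S α f) {εr : ℂ}
    {k0 : ℝ} (hε : 0 < (εr * (k0 : ℂ) ^ 2).im) (k : Fin 3) :
    HasSum (fun n => (inner ℂ (uField S α f n) (constField (basisC k)) *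
        (εr * (k0 : ℂ) ^ 2 / (lam α n - εr * (k0 : ℂ) ^ 2))) • uField S α f n)
      (shapeField S εr k0 k - constField (basisC k)) := by
  rw [shapeField, add_sub_cancel_left, hf.cellSolution_eq hS hε]
  convert (hf.hasSum_cellCurl _ (basisC k)).mapL GamL using 2 with n
  rw [← hf.coeff_smul_eq hS hε, ← hf.uField_eq hS]

/-- `wpd` is defined by choice and carries no continuity, so the series is the image of that of
`cellCurl` under the bounded operator `biotSavartD i`. -/
theorem hasSum_wpd_shapeField (hS : IsInclusion S) (hf : IsSpectralSystem S α f) {εr : ℂ}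
    {k0 : ℝ} (hε : 0 < (εr * (k0 : ℂ) ^ 2).im) (k i : Fin 3) :
    HasSum (fun n => (inner ℂ (uField S α f n) (constField (basisC k)) *
        (εr * (k0 : ℂ) ^ 2 / (lam α n - εr * (k0 : ℂ) ^ 2))) • wpd i (uField S α f n))
      (wpd i (shapeField S εr k0 k)) := by
  have h1 : wpd i (shapeField S εr k0 k) =
      biotSavartD i (hf.cellCurl (εr * (k0 : ℂ) ^ 2) (basisC k)) := by
    rw [shapeField, hf.cellSolution_eq hS hε]
    refine IsWeakPartial.wpd_eq ?_
    rw [← zero_add (biotSavartD i _)]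
    exact (isWeakPartial_constField i _).add (isWeakPartial_GamL i _)
  rw [h1]
  convert (hf.hasSum_cellCurl _ (basisC k)).mapL (biotSavartD i) using 2 with n
  rw [← hf.coeff_smul_eq hS hε, hf.uField_eq hS, (isWeakPartial_GamL i _).wpd_eq]

theorem integral_apply_eq (u : L2 C3) (j : Fin 3) : ∫ y, u y j ∂muY = fc 0 u j := by
  rw [fc_zero_eq]
  exact (prC j).integral_comp_comm (integrable_L2 u)

/-- Reality of `uₙ` removes the conjugate, which makes the coefficients of the permeability bilinear
in the means. -/
theorem inner_uField_constField (hS : IsInclusion S) (hf : IsSpectralSystem S α f) (n : ℕ)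
    (i : Fin 3) : inner ℂ (uField S α f n) (constField (basisC i)) =
      ∫ y, uField S α f n y i ∂muY := by
  rw [integral_apply_eq, ← inner_conj_symm, constField_eq, inner_charField_eq, basisC,
    EuclideanSpace.inner_single_left, map_one, one_mul]
  have h := real_valued_iff.1 (hf.real_valued_uField hS n) 0 i
  rw [neg_zero] at h
  exact h.symm

theorem hasSum_muEff (hS : IsInclusion S) (hf : IsSpectralSystem S α f) {εr : ℂ}
    {k0 : ℝ} (hε : 0 < (εr * (k0 : ℂ) ^ 2).im) (i j : Fin 3) :
    HasSum (fun n => εr * (k0 : ℂ) ^ 2 / (lam α n - εr * (k0 : ℂ) ^ 2) *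
        (∫ y, uField S α f n y i ∂muY) * (∫ y, uField S α f n y j ∂muY))
      (muEff S εr k0 i j - if i = j then 1 else 0) := by
  have h := (hf.hasSum_shapeField hS hε i).mapL (prC j ∘L fc 0)
  convert h using 1
  · funext n
    rw [map_smul, hf.inner_uField_constField hS, integral_apply_eq, integral_apply_eq, smul_eq_mul]
    simp only [ContinuousLinearMap.comp_apply]
    change _ = _ * fc 0 (uField S α f n) j
    ring
  · rw [map_sub, muEff, Matrix.of_apply, integral_apply_eq]
    simp only [ContinuousLinearMap.comp_apply, fc_constField, if_true]
    change _ = fc 0 (shapeField S εr k0 i) j - basisC i j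
    congr 1
    simp [basisC, eq_comm]

theorem integral_uField (hS : IsInclusion S) (hf : IsSpectralSystem S α f) (n : ℕ)
    (j : Fin 3) : ∫ y, uField S α f n y j ∂muY =
      ((1 / √(α n) : ℝ) : ℂ) * ((1 / 2 : ℂ) * moment S (f n) j) := by
  rw [integral_apply_eq, hf.uField_eq hS, map_smul, map_smul, fc_zero_GamL,
    moment_eq hS.subset_cell hS.isCompact.measurableSet (hf.memZ0 n).eq_zero]
  rfl

theorem hasSum_muEff_moment (hS : IsInclusion S) (hf : IsSpectralSystem S α f) {εr : ℂ}
    {k0 : ℝ} (hε : 0 < (εr * (k0 : ℂ) ^ 2).im) (i j : Fin 3) :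
    HasSum (fun n => (1 / 4 : ℂ) * (εr * (k0 : ℂ) ^ 2 / (1 - εr * α n * (k0 : ℂ) ^ 2) *
        moment S (f n) i * moment S (f n) j))
      (muEff S εr k0 i j - if i = j then 1 else 0) := by
  convert hf.hasSum_muEff hS hε i j using 2 with n
  rw [hf.integral_uField hS, hf.integral_uField hS]
  set ε := εr * (k0 : ℂ) ^ 2 with hεdef
  have h1 := hf.one_div_sqrt_mul_self n
  have h2 := one_sub_mul_ne_zero hε (α n) (hf.pos n)
  have h3 : (α n : ℂ) ≠ 0 := Complex.ofReal_ne_zero.2 (hf.pos n).ne'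
  have h4 : ε / (1 - εr * α n * (k0 : ℂ) ^ 2) = ε / ((lam α n : ℝ) - ε) * (α n : ℂ)⁻¹ := by
    have h5 : ((lam α n : ℝ) - ε : ℂ) = (1 - ε * α n) / α n := by
      rw [lam]; push_cast; field_simp
    have h6 : 1 - εr * α n * (k0 : ℂ) ^ 2 = 1 - ε * α n := by rw [hεdef]; ring
    rw [h5, h6]; field_simp
  rw [h4, ← h1]
  ring

end IsSpectralSystem

end

end MagneticCell

end

/-! ### The main theorem. -/

theorem proposition6p5 (S : Set MagneticCell.E3) (hS : MagneticCell.IsInclusion S)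
    (εr : ℂ) (hεr : 0 < εr.im) (k0 : ℝ) (hk0 : 0 < k0)
    (α : ℕ → ℝ) (f : ℕ → MagneticCell.L2 MagneticCell.C3)
    (hf : MagneticCell.IsSpectralSystem S α f) :
    -- `(λₙ, uₙ)` are the eigenpairs of the curl-curl problem on `X₀^div`
    MagneticCell.IsCurlEigenbasis S (MagneticCell.lam α) (MagneticCell.uField S α f) ∧
    -- the cell problems defining the shape functions are well posed
    (∀ k, ∃! u, MagneticCell.IsCellSolution S εr k0 (MagneticCell.basisC k) u) ∧
    -- expansion of the shape functions, in `L²` and for all first derivatives (that is in `W^{1,2}`)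
    (∀ k,
      HasSum (fun n =>
          (inner ℂ (MagneticCell.uField S α f n)
              (MagneticCell.constField (MagneticCell.basisC k)) *
            (εr * (k0 : ℂ) ^ 2 / (MagneticCell.lam α n - εr * (k0 : ℂ) ^ 2))) •
          MagneticCell.uField S α f n)
        (MagneticCell.shapeField S εr k0 k - MagneticCell.constField (MagneticCell.basisC k)) ∧
      ∀ i, HasSum (fun n =>
          (inner ℂ (MagneticCell.uField S α f n)
              (MagneticCell.constField (MagneticCell.basisC k)) *
            (εr * (k0 : ℂ) ^ 2 / (MagneticCell.lam α n - εr * (k0 : ℂ) ^ 2))) •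
          MagneticCell.wpd i (MagneticCell.uField S α f n))
        (MagneticCell.wpd i (MagneticCell.shapeField S εr k0 k))) ∧
    -- expansion of the effective permeability in terms of `(λₙ, uₙ)`
    (∀ i j, HasSum (fun n =>
        εr * (k0 : ℂ) ^ 2 / (MagneticCell.lam α n - εr * (k0 : ℂ) ^ 2) *
          (∫ y, MagneticCell.uField S α f n y i ∂MagneticCell.muY) *
          (∫ y, MagneticCell.uField S α f n y j ∂MagneticCell.muY))
      (MagneticCell.muEff S εr k0 i j - if i = j then 1 else 0)) ∧
    -- expansion of the effective permeability in terms of `(αₙ, fₙ)`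
    (∀ i j, HasSum (fun n =>
        (1 / 4 : ℂ) * (εr * (k0 : ℂ) ^ 2 / (1 - εr * α n * (k0 : ℂ) ^ 2) *
          MagneticCell.moment S (f n) i * MagneticCell.moment S (f n) j))
      (MagneticCell.muEff S εr k0 i j - if i = j then 1 else 0)) := by
  -- The factor `k₀²` is real and positive, so it preserves the sign of the imaginary part.
  have hε : 0 < (εr * (k0 : ℂ) ^ 2).im := by
    rw [← Complex.ofReal_pow, Complex.im_mul_ofReal]
    positivity
  exact ⟨hf.isCurlEigenbasis hS, fun k => hf.existsUnique_isCellSolution hS hε _,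
    fun k => ⟨hf.hasSum_shapeField hS hε k, fun i => hf.hasSum_wpd_shapeField hS hε k i⟩,
    hf.hasSum_muEff hS hε, hf.hasSum_muEff_moment hS hε⟩
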